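/- **Setting.** For $n\ge 0$ let $\tilde S_n$ be the group generated by $z,t_1,\dots,t_{n-1}$ with relations $z^2=1$, $t_i^2=(t_it_{i+1})^3=z$, $t_it_j=zt_jt_i$ ($i>j+1$), $zt_i=t_iz$; it maps onto $S_n$ by $z\mapsto 1$, $t_i\mapsto (i,i+1)$. Let $\Gamma$ be a finite group, $\Gamma_*$ its set of conjugacy classes, $\Gamma^*$ its set of complex irreducible characters, $\zeta_c$ the order of the centralizer of an element of $c\in\Gamma_*$. Let $\tilde\Gamma_n=\Gamma^n\rtimes\tilde S_n$, where $\tilde S_n$ acts on $\Gamma^n$ by permuting the indices through $S_n$, with the parity $d:\tilde\Gamma_n\to\mathbb Z/2$, $d(g,t_i)=1$, $d(g,z)=0$. Let $R^-(\tilde\Gamma_n)$ be the space of class functions $f:\tilde\Gamma_n\to\mathbb C$ with $f(zx)=-f(x)$ that vanish on all odd elements, and $R^-_\Gamma=\bigoplus_{n\ge 0}R^-(\tilde\Gamma_n)$. **Operations on $R^-_\Gamma$.** Let $\tilde\Gamma_n\hat\times\tilde\Gamma_m$ be the quotient by $\{(1,1),(z,z)\}$ of the set $\tilde\Gamma_n\times\tilde\Gamma_m$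 with the multiplication $(t,t')(s,s')=(ts\,z^{d(t')d(s)},t's')$; it maps canonically to $\tilde\Gamma_{n+m}$ (first $n$ indices, last $m$ indices). Let $R^-(\tilde\Gamma_n\hat\times\tilde\Gamma_m)$ be its space of class functions $F$ with $F(zw)=-F(w)$ that vanish on odd elements. The super outer tensor product is the isomorphism $\phi_{n,m}:R^-(\tilde\Gamma_n)\otimes R^-(\tilde\Gamma_m)\to R^-(\tilde\Gamma_n\hat\times\tilde\Gamma_m)$, $\phi_{n,m}(f\otimes g)(x,y)=f(x)g(y)$. The product of $R^-_\Gamma$ is $\mathrm{Ind}\circ\phi_{n,m}$ on $R^-(\tilde\Gamma_n)\otimes R^-(\tilde\Gamma_m)$, with values in $R^-(\tilde\Gamma_{n+m})$; the coproduct on $R^-(\tilde\Gamma_n)$ is $\bigoplus_{m=0}^n\phi_{n-m,m}^{-1}\circ\mathrm{Res}$; the unit is the function on $\tilde\Gamma_0=\{1,z\}$ with values $1,-1$; the counit evaluates the degree $0$ component at $1$. **The Hopf algebra $S^-_\Gamma$.** It is the symmetric algebra on the vector space with basis $a_{-k}(\gamma)$, $k\ge 1$ odd, $\gamma\in\Gamma^*$,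 with $\Delta(a_{-k}(\gamma))=a_{-k}(\gamma)\otimes 1+1\otimes a_{-k}(\gamma)$. Put $a_{-k}(c)=\sum_{\gamma\in\Gamma^*}\gamma(c^{-1})a_{-k}(\gamma)$ for $c\in\Gamma_*$. **The characteristic map.** Let $\rho=(\rho(c))_{c\in\Gamma_*}$ be a family of partitions with odd parts, of total size $n$; let $l(\rho)$ be its total number of parts, $\bar\rho(c)=\rho(c^{-1})$, $a'_{-\rho}=\prod_c\prod_i a_{-\rho(c)_i}(c)$ and $Z_\rho=\prod_c z_{\rho(c)}\zeta_c^{l(\rho(c))}$, where $z_\lambda=\prod_i i^{m_i}m_i!$ for $\lambda=(1^{m_1}2^{m_2}\cdots)$. Fix an enumeration of $\Gamma_*$ and exponents $\varepsilon(k)$ that fix a lift $z^{\varepsilon(k)}t_{a+1}t_{a+2}\cdots t_{a+k-1}$ of each cycle $(a+1,\dots,a+k)$ of odd length $k$ (the normalization $[a+1,\dots,a+k]=z^{k-1}t_{a+1}\cdots t_{a+k-1}$ corresponds to $\varepsilon(k)=k-1$). Let $t^\rho\in\tilde S_n$ be the product of these lifts over consecutive blocks of $1,\dots,n$ whose lengths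 are the parts of the $\rho(c)$, taken class by class in the chosen order and in decreasing order within each class, and let $f(\rho)$ be the value of $f\in R^-(\tilde\Gamma_n)$ at $(g,t^\rho)$, where $g\in\Gamma^n$ is such that the cycle product over every block belonging to $c$ lies in $c$. Define the linear map $ch:R^-_\Gamma\to S^-_\Gamma$ by $$ch(f)=\sum_{\rho}\frac{2^{l(\rho)/2}}{Z_\rho}\,f(\rho)\,a'_{-\bar\rho},\qquad f\in R^-(\tilde\Gamma_n).$$ **Proposition.** For every finite group $\Gamma$, every enumeration of $\Gamma_*$ and every choice of the exponents $\varepsilon(k)$, the operations above make $R^-_\Gamma$ a Hopf algebra, and $ch:R^-_\Gamma\to S^-_\Gamma$ is an isomorphism of Hopf algebras: it is bijective and compatible with products, units, coproducts, counits and antipodes. -/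

import Mathlib

open scoped TensorProduct DirectSum

universe u

namespace SpinWreath

/-! ### The spin group -/

/-- Generators: `none` is the central element `z`, and `some i` is the `(i+1)`-st generator `t`. -/
abbrev Gen (n : ℕ) : Type := Option {i : ℕ // i + 1 < n}

/-- The defining relations of the spin group on `n` letters. -/
inductive SpinRel (n : ℕ) : FreeGroup (Gen n) → Prop
  | z_sq : SpinRel n (FreeGroup.of none ^ 2)
  | t_sq (i : {i : ℕ // i + 1 < n}) :
      SpinRel n (FreeGroup.of (some i) ^ 2 * (FreeGroup.of none)⁻¹)
  | braid (i j : {i : ℕ // i + 1 < n}) (h : j.1 = i.1 + 1) :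
      SpinRel n ((FreeGroup.of (some i) * FreeGroup.of (some j)) ^ 3 * (FreeGroup.of none)⁻¹)
  | comm (i j : {i : ℕ // i + 1 < n}) (h : j.1 + 1 < i.1) :
      SpinRel n (FreeGroup.of (some i) * FreeGroup.of (some j) *
        (FreeGroup.of none * FreeGroup.of (some j) * FreeGroup.of (some i))⁻¹)
  | central (i : {i : ℕ // i + 1 < n}) :
      SpinRel n (FreeGroup.of none * FreeGroup.of (some i) *
        (FreeGroup.of (some i) * FreeGroup.of none)⁻¹)

/-- The spin group on `n` letters, a double cover of the symmetric group. -/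
abbrev SpinGroup (n : ℕ) : Type := PresentedGroup {r | SpinRel n r}

/-- The central involution `z`. -/
def sz (n : ℕ) : SpinGroup n := PresentedGroup.of none

/-- The generators `t` (indexed from `0`). -/
def st (n : ℕ) (i : {i : ℕ // i + 1 < n}) : SpinGroup n := PresentedGroup.of (some i)

/-- The universal property of the spin group. -/
def spinLift {n : ℕ} {G : Type*} [Group G] (ζ : G) (τ : {i : ℕ // i + 1 < n} → G)
    (h1 : ζ ^ 2 = 1) (h2 : ∀ i, τ i ^ 2 = ζ)
    (h3 : ∀ i j, j.1 = i.1 + 1 → (τ i * τ j) ^ 3 = ζ)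
    (h4 : ∀ i j, j.1 + 1 < i.1 → τ i * τ j = ζ * τ j * τ i)
    (h5 : ∀ i, ζ * τ i = τ i * ζ) : SpinGroup n →* G :=
  PresentedGroup.toGroup (f := fun x : Gen n => x.elim ζ τ) (by
    rintro r (_ | i | ⟨i, j, h⟩ | ⟨i, j, h⟩ | i)
    · simpa using h1
    · simp [h2 i]
    · simp [h3 i j h]
    · simp only [map_mul, map_inv, FreeGroup.lift_apply_of, Option.elim]
      rw [mul_inv_eq_one]
      exact h4 i j h
    · simp [h5 i])

section
variable {n : ℕ}

theorem sz_sq : sz n ^ 2 = 1 := PresentedGroup.one_of_mem (SpinRel.z_sq)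

theorem st_sq (i) : st n i ^ 2 = sz n := PresentedGroup.mk_eq_mk_of_mul_inv_mem (SpinRel.t_sq i)

theorem st_braid (i j) (h : j.1 = i.1 + 1) : (st n i * st n j) ^ 3 = sz n :=
  PresentedGroup.mk_eq_mk_of_mul_inv_mem (SpinRel.braid i j h)

theorem st_comm (i j) (h : j.1 + 1 < i.1) : st n i * st n j = sz n * st n j * st n i :=
  PresentedGroup.mk_eq_mk_of_mul_inv_mem (SpinRel.comm i j h)

theorem sz_st (i) : sz n * st n i = st n i * sz n :=
  PresentedGroup.mk_eq_mk_of_mul_inv_mem (SpinRel.central i)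

@[simp] theorem spinLift_sz {G : Type*} [Group G] (ζ : G) (τ : {i : ℕ // i + 1 < n} → G)
    (h1 h2 h3 h4 h5) : spinLift ζ τ h1 h2 h3 h4 h5 (sz n) = ζ := PresentedGroup.toGroup.of _

@[simp] theorem spinLift_st {G : Type*} [Group G] (ζ : G) (τ : {i : ℕ // i + 1 < n} → G)
    (h1 h2 h3 h4 h5) (i) : spinLift ζ τ h1 h2 h3 h4 h5 (st n i) = τ i := PresentedGroup.toGroup.of _

theorem spin_induction {P : SpinGroup n → Prop} (one : P 1) (z : P (sz n))
    (t : ∀ i, P (st n i)) (mul : ∀ x y, P x → P y → P (x * y)) (x : SpinGroup n) : P x := by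
  have key : ∀ x ∈ Subgroup.closure (Set.range
      (PresentedGroup.of : Gen n → SpinGroup n)), P x := by
    intro x hx
    have hz3 : (sz n)⁻¹ = sz n := by
      rw [inv_eq_iff_mul_eq_one, ← sq, sz_sq]
    induction hx using Subgroup.closure_induction_left with
    | one => exact one
    | mul_left a ha y _ hy =>
      obtain ⟨i, rfl⟩ := ha
      cases i with
      | none => exact mul _ _ z hy
      | some i => exact mul _ _ (t i) hy
    | inv_mul_cancel a ha y _ hy =>
      obtain ⟨i, rfl⟩ := ha
      cases i with
      | none => exact mul _ _ (by change P (sz n)⁻¹; rw [hz3]; exact z) hy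
      | some i =>
        refine mul _ _ ?_ hy
        change P (st n i)⁻¹
        have : (st n i)⁻¹ = sz n * st n i := by
          rw [inv_eq_iff_mul_eq_one, sz_st, ← mul_assoc, ← sq, st_sq, ← sq, sz_sq]
        rw [this]
        exact mul _ _ z (t i)
  exact key x (by rw [PresentedGroup.closure_range_of]; trivial)

theorem spin_hom_ext {G : Type*} [Monoid G] {f g : SpinGroup n →* G} (hz : f (sz n) = g (sz n))
    (ht : ∀ i, f (st n i) = g (st n i)) (x : SpinGroup n) : f x = g x := by
  induction x using spin_induction with
  | one => simp
  | z => exact hz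
  | t i => exact ht i
  | mul x y hx hy => simp [hx, hy]

theorem sz_central (x : SpinGroup n) : sz n * x = x * sz n := by
  induction x using spin_induction with
  | one => simp
  | z => rfl
  | t i => exact sz_st i
  | mul x y hx hy => rw [← mul_assoc, hx, mul_assoc, hy, mul_assoc]

end

/-- The projection to the symmetric group, sending `t_i` to the `i`-th simple transposition. -/
def spinToPerm (n : ℕ) : SpinGroup n →* Equiv.Perm (Fin n) :=
  spinLift 1 (fun i => Equiv.swap ⟨i.1, by have := i.2; omega⟩ ⟨i.1 + 1, i.2⟩)
    (by simp) (by intro i; rw [sq, Equiv.swap_mul_self])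
    (by
      rintro ⟨i, hi⟩ ⟨j, hj⟩ h
      simp only at h
      subst h
      rw [Equiv.swap_comm, ← (Equiv.Perm.isThreeCycle_swap_mul_swap_same
        (a := (⟨i + 1, hi⟩ : Fin n)) (b := ⟨i, by omega⟩) (c := ⟨i + 1 + 1, hj⟩)
        (by simp) (by simp) (by simp; omega)).orderOf]
      exact pow_orderOf_eq_one _)
    (by
      rintro ⟨i, hi⟩ ⟨j, hj⟩ h
      simp only at h
      rw [one_mul]
      refine Equiv.Perm.Disjoint.commute (Equiv.Perm.disjoint_swap_swap ?_)
      simp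
      omega)
    (by simp)

/-- The parity of the spin group: the generators `t_i` are odd and `z` is even. -/
def spinParity (n : ℕ) : SpinGroup n →* Multiplicative (ZMod 2) :=
  spinLift 1 (fun _ => Multiplicative.ofAdd 1) (by decide) (fun _ => by decide) (fun _ _ _ => by decide)
    (fun _ _ _ => by decide) (fun _ => by decide)

/-! ### Finiteness of the spin group -/

/-- The generators indexed by all natural numbers (with value `1` outside the range). -/
def tgen (n i : ℕ) : SpinGroup n := if h : i + 1 < n then st n ⟨i, h⟩ else 1

section
variable {n : ℕ}

/-- The product `t_{i+m-1} ⋯ t_{i+1} t_i`. -/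
def chain (n : ℕ) : ℕ → ℕ → SpinGroup n
  | _, 0 => 1
  | i, m + 1 => chain n (i + 1) m * tgen n i

theorem tgen_sq {i : ℕ} (h : i + 1 < n) : tgen n i * tgen n i = sz n := by
  simp only [tgen, dif_pos h, ← sq, st_sq]

theorem tgen_comm {i j : ℕ} (hi : i + 1 < n) (h : j + 1 < i) :
    tgen n i * tgen n j = sz n * (tgen n j * tgen n i) := by
  have hj : j + 1 < n := by omega
  simp only [tgen, dif_pos hi, dif_pos hj, ← mul_assoc]
  exact st_comm _ _ h

theorem sz_mul_self : sz n * sz n = 1 := by rw [← sq, sz_sq]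

theorem tgen_comm' {i j : ℕ} (hi : i + 1 < n) (h : j + 1 < i) :
    tgen n j * tgen n i = sz n * (tgen n i * tgen n j) := by
  rw [tgen_comm hi h, ← mul_assoc, sz_mul_self, one_mul]

theorem tgen_braid {i : ℕ} (h : i + 2 < n) :
    tgen n (i + 1) * tgen n i * tgen n (i + 1) = tgen n i * tgen n (i + 1) * tgen n i := by
  have hi : i + 1 < n := by omega
  have h3 : (tgen n i * tgen n (i + 1)) ^ 3 = sz n := by
    simp only [tgen, dif_pos hi, dif_pos (show i + 1 + 1 < n from h)]
    exact st_braid _ _ rfl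
  have ha := tgen_sq hi
  have hb := tgen_sq (n := n) (i := i + 1) h
  have hz := sz_mul_self (n := n)
  have za := sz_central (tgen n i)
  have zb := sz_central (tgen n (i + 1))
  generalize tgen n i = a at *
  generalize tgen n (i + 1) = b at *
  generalize sz n = z at *
  have e : (a * b * a) * (b * a * b) = z := by
    rw [← h3]; simp only [pow_succ, pow_zero, one_mul, mul_assoc]
  have e2 : (a * b * a) * (a * b * a) = z := by
    calc (a * b * a) * (a * b * a) = a * b * (a * a) * b * a := by simp only [mul_assoc]
      _ = a * (b * z) * b * a := by rw [ha]; simp only [mul_assoc]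
      _ = a * z * (b * b) * a := by rw [← zb]; simp only [mul_assoc]
      _ = a * (z * z) * a := by rw [hb]; simp only [mul_assoc]
      _ = z := by rw [hz, mul_one, ha]
  exact mul_left_cancel (e.trans e2.symm)

theorem chain_comm_low {l : ℕ} : ∀ {m i : ℕ}, l + 1 < i → i + m < n + 0 → ∃ e : ℕ,
    chain n i m * tgen n l = sz n ^ e * (tgen n l * chain n i m)
  | 0, i, _, _ => ⟨0, by simp [chain]⟩
  | m + 1, i, hl, hm => by
    obtain ⟨e, he⟩ := chain_comm_low (l := l) (m := m) (i := i + 1) (by omega) (by omega)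
    refine ⟨e + 1, ?_⟩
    have hz : chain n (i + 1) m * sz n = sz n * chain n (i + 1) m := (sz_central _).symm
    calc chain n (i + 1) m * tgen n i * tgen n l
        = chain n (i + 1) m * sz n * (tgen n l * tgen n i) := by
          rw [mul_assoc, tgen_comm (by omega) hl, mul_assoc]
      _ = sz n * (chain n (i + 1) m * tgen n l) * tgen n i := by
          rw [hz]; simp only [mul_assoc]
      _ = _ := by rw [he, pow_succ']; simp only [mul_assoc, chain]

theorem chain_comm_mid {l : ℕ} : ∀ {m i : ℕ}, i < l → l < i + m → i + m < n → ∃ e : ℕ,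
    chain n i m * tgen n l = sz n ^ e * (tgen n (l - 1) * chain n i m)
  | 0, i, _, _, _ => by omega
  | 1, i, _, _, _ => by omega
  | m + 2, i, hl, hm, hn => by
    by_cases h : l = i + 1
    · subst h
      obtain ⟨e, he⟩ := chain_comm_low (n := n) (l := i) (m := m) (i := i + 1 + 1)
        (by omega) (by omega)
      refine ⟨e, ?_⟩
      simp only [chain, Nat.add_sub_cancel]
      calc chain n (i + 1 + 1) m * tgen n (i + 1) * tgen n i * tgen n (i + 1)
          = chain n (i + 1 + 1) m * (tgen n (i + 1) * tgen n i * tgen n (i + 1)) := by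
            simp only [mul_assoc]
        _ = (chain n (i + 1 + 1) m * tgen n i) * (tgen n (i + 1) * tgen n i) := by
            rw [tgen_braid (by omega)]; simp only [mul_assoc]
        _ = _ := by rw [he]; simp only [mul_assoc]
    · obtain ⟨e, he⟩ := chain_comm_mid (l := l) (m := m + 1) (i := i + 1)
        (by omega) (by omega) (by omega)
      refine ⟨e + 1, ?_⟩
      have hz : chain n (i + 1) (m + 1) * sz n = sz n * chain n (i + 1) (m + 1) :=
        (sz_central _).symm
      rw [chain]
      calc chain n (i + 1) (m + 1) * tgen n i * tgen n l
          = chain n (i + 1) (m + 1) * sz n * (tgen n l * tgen n i) := by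
            rw [mul_assoc, tgen_comm' (by omega) (by omega), mul_assoc]
        _ = sz n * (chain n (i + 1) (m + 1) * tgen n l) * tgen n i := by
            rw [hz]; simp only [mul_assoc]
        _ = _ := by rw [he, pow_succ']; simp only [mul_assoc]

/-- The subgroup generated by `z` and the first `j` generators. -/
def lowSub (n j : ℕ) : Subgroup (SpinGroup n) :=
  Subgroup.closure (insert (sz n) {x | ∃ i < j, x = tgen n i})

theorem sz_mem (j : ℕ) : sz n ∈ lowSub n j :=
  Subgroup.subset_closure (Set.mem_insert _ _)

theorem tgen_mem {i j : ℕ} (h : i < j) : tgen n i ∈ lowSub n j :=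
  Subgroup.subset_closure (Set.mem_insert_of_mem _ ⟨i, h, rfl⟩)

theorem lowSub_finite (n : ℕ) : ∀ j : ℕ, (lowSub n j : Set (SpinGroup n)).Finite
  | 0 => by
    have : lowSub n 0 = Subgroup.zpowers (sz n) := by
      rw [Subgroup.zpowers_eq_closure]; simp [lowSub]
    rw [this]
    have h : IsOfFinOrder (sz n) := isOfFinOrder_iff_pow_eq_one.2 ⟨2, by norm_num, sz_sq⟩
    exact finite_zpowers.2 h
  | j + 1 => by
    have ih := lowSub_finite n j
    by_cases hj : j + 1 < n
    swap
    · refine ih.subset ?_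
      have : lowSub n (j + 1) ≤ lowSub n j := by
        refine (Subgroup.closure_le _).2 ?_
        rintro x (rfl | ⟨i, hi, rfl⟩)
        · exact sz_mem j
        · by_cases h : i < j
          · exact tgen_mem h
          · have : ¬ i + 1 < n := by omega
            simp only [tgen, dif_neg this]
            exact one_mem _
      exact this
    set X : Set (SpinGroup n) :=
      ⋃ i ∈ Set.Iic (j + 1), (fun k => k * chain n i (j + 1 - i)) '' (lowSub n j : Set _) with hX
    have hXf : X.Finite := (Set.finite_Iic _).biUnion fun i _ => ih.image _
    have memX : ∀ x, x ∈ X ↔ ∃ i m, i + m = j + 1 ∧ ∃ k ∈ lowSub n j, k * chain n i m = x := by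
      intro x
      simp only [hX, Set.mem_iUnion, Set.mem_Iic, Set.mem_image, SetLike.mem_coe, exists_prop]
      constructor
      · rintro ⟨i, hi, h⟩; exact ⟨i, j + 1 - i, by omega, h⟩
      · rintro ⟨i, m, hm, h⟩
        exact ⟨i, by omega, by rwa [show j + 1 - i = m by omega]⟩
    have hz : ∀ x ∈ X, x * sz n ∈ X := by
      intro x hx
      obtain ⟨i, m, hm, k, hk, rfl⟩ := (memX x).1 hx
      exact (memX _).2 ⟨i, m, hm, k * sz n, mul_mem hk (sz_mem j), by
        rw [mul_assoc, sz_central, mul_assoc]⟩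
    have ht : ∀ l < j + 1, ∀ x ∈ X, x * tgen n l ∈ X := by
      intro l hl x hx
      obtain ⟨i, m, hm, k, hk, rfl⟩ := (memX x).1 hx
      rcases lt_trichotomy l i with h | h | h
      · by_cases h1 : l + 1 = i
        · subst h1
          exact (memX _).2 ⟨l, m + 1, by omega, k, hk, by simp only [chain, mul_assoc]⟩
        · obtain ⟨e, he⟩ := chain_comm_low (n := n) (l := l) (m := m) (i := i)
            (by omega) (by omega)
          refine (memX _).2 ⟨i, m, hm, k * (sz n ^ e * tgen n l),
            mul_mem hk (mul_mem (pow_mem (sz_mem j) e) (tgen_mem (by omega))), ?_⟩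
          rw [mul_assoc k (chain n i m), he]; simp only [mul_assoc]
      · subst h
        obtain ⟨m, rfl⟩ : ∃ m', m = m' + 1 := ⟨m - 1, by omega⟩
        refine (memX _).2 ⟨l + 1, m, by omega, k * sz n, mul_mem hk (sz_mem j), ?_⟩
        simp only [chain, mul_assoc]
        rw [tgen_sq (by omega), sz_central]
      · obtain ⟨e, he⟩ := chain_comm_mid (n := n) (l := l) (m := m) (i := i) h
          (by omega) (by omega)
        refine (memX _).2 ⟨i, m, hm, k * (sz n ^ e * tgen n (l - 1)),
          mul_mem hk (mul_mem (pow_mem (sz_mem j) e) (tgen_mem (by omega))), ?_⟩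
        rw [mul_assoc k (chain n i m), he]; simp only [mul_assoc]
    refine hXf.subset ?_
    intro x hx
    induction hx using Subgroup.closure_induction_right with
    | one => exact (memX _).2 ⟨j + 1, 0, by omega, 1, one_mem _, by simp [chain]⟩
    | mul_right x _ y hy h =>
      rcases hy with rfl | ⟨i, hi, rfl⟩
      · exact hz _ h
      · exact ht i hi _ h
    | mul_inv_cancel x _ y hy h =>
      rcases hy with rfl | ⟨i, hi, rfl⟩
      · rw [show (sz n)⁻¹ = sz n by rw [inv_eq_iff_mul_eq_one, sz_mul_self]]
        exact hz _ h
      · rw [show (tgen n i)⁻¹ = sz n * tgen n i by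
          rw [inv_eq_iff_mul_eq_one, sz_central, ← mul_assoc, tgen_sq (by omega), sz_mul_self],
          ← mul_assoc]
        exact ht i hi _ (hz _ h)

instance spinGroup_finite : Finite (SpinGroup n) := by
  have h : (lowSub n n : Set (SpinGroup n)) = Set.univ := by
    refine Set.eq_univ_of_forall fun x => ?_
    refine spin_induction (P := fun x => x ∈ lowSub n n) (one_mem _) (sz_mem n) (fun i => ?_)
      (fun x y hx hy => mul_mem hx hy) x
    have := tgen_mem (n := n) (i := i.1) (j := n) (by have := i.2; omega)
    simpa only [tgen, dif_pos i.2] using this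
  exact Set.finite_univ_iff.1 (h ▸ lowSub_finite n n)

end

/-! ### The spin wreath product -/

/-- The action of the spin group on `Γ^n` by permuting indices:
`(t · g) i = g (s⁻¹ i)` where `s` is the permutation below `t`. -/
def wreathAction (Γ : Type u) [Group Γ] (n : ℕ) : SpinGroup n →* MulAut (Fin n → Γ) :=
  (mulAutArrow (G := Equiv.Perm (Fin n)) (A := Fin n) (M := Γ)).comp (spinToPerm n)

/-- The spin wreath product `Γ^n ⋊ S̃_n`. -/
abbrev SpinWreathProduct (Γ : Type u) [Group Γ] (n : ℕ) : Type u :=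
  (Fin n → Γ) ⋊[wreathAction Γ n] SpinGroup n

section
variable {Γ : Type u} [Group Γ] {n : ℕ}

theorem wreathAction_apply (t : SpinGroup n) (g : Fin n → Γ) (i : Fin n) :
    wreathAction Γ n t g i = g ((spinToPerm n t)⁻¹ i) := rfl

variable (Γ n) in
/-- The central involution `z` of the spin wreath product. -/
def wz : SpinWreathProduct Γ n := SemidirectProduct.inr (sz n)

variable (Γ n) in
/-- The parity homomorphism `d`, multiplicatively. -/
def wParity : SpinWreathProduct Γ n →* Multiplicative (ZMod 2) :=
  (spinParity n).comp SemidirectProduct.rightHom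

/-- The parity `d x ∈ ℤ/2` of an element. -/
def par (x : SpinWreathProduct Γ n) : ZMod 2 := (wParity Γ n x).toAdd

theorem par_mul (x y : SpinWreathProduct Γ n) : par (x * y) = par x + par y := by
  simp [par]

@[simp] theorem par_one : par (1 : SpinWreathProduct Γ n) = 0 := by simp [par]

theorem par_inv (x : SpinWreathProduct Γ n) : par x⁻¹ = par x := by
  have : ∀ a : ZMod 2, -a = a := by decide
  simp [par, this]

theorem par_wz : par (wz Γ n) = 0 := by
  simp [par, wParity, wz, spinParity]

theorem wz_sq : wz Γ n * wz Γ n = 1 := by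
  rw [wz, ← map_mul, ← sq, sz_sq, map_one]

theorem wz_central (x : SpinWreathProduct Γ n) : wz Γ n * x = x * wz Γ n := by
  have h : spinToPerm n (sz n) = 1 := by simp [spinToPerm]
  refine SemidirectProduct.ext ?_ ?_
  · funext i
    change ((1 : Fin n → Γ) * wreathAction Γ n (sz n) x.left) i =
      (x.left * wreathAction Γ n x.right 1) i
    rw [map_one, one_mul, mul_one, wreathAction_apply, h, inv_one, Equiv.Perm.one_apply]
  · exact sz_central _

/-- `z ^ a` for `a ∈ ℤ/2`. -/
def zpar (Γ : Type u) [Group Γ] (n : ℕ) (a : ZMod 2) : SpinWreathProduct Γ n := wz Γ n ^ a.val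

@[simp] theorem zpar_zero : zpar Γ n 0 = 1 := by simp [zpar]

@[simp] theorem zpar_one : zpar Γ n 1 = wz Γ n := by
  simp [zpar, show (1 : ZMod 2).val = 1 from rfl]

theorem zpar_add (a b : ZMod 2) : zpar Γ n (a + b) = zpar Γ n a * zpar Γ n b := by
  have h2 : ∀ a : ZMod 2, a = 0 ∨ a = 1 := by decide
  rcases h2 a with rfl | rfl <;> rcases h2 b with rfl | rfl
  · simp
  · simp
  · simp
  · rw [show (1 + 1 : ZMod 2) = 0 by decide]; simp [wz_sq]

theorem zpar_central (a : ZMod 2) (x : SpinWreathProduct Γ n) :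
    zpar Γ n a * x = x * zpar Γ n a :=
  (Commute.pow_left (show Commute (wz Γ n) x from wz_central x) a.val)

theorem par_zpar (a : ZMod 2) : par (zpar Γ n a) = 0 := by
  have h2 : ∀ a : ZMod 2, a = 0 ∨ a = 1 := by decide
  rcases h2 a with rfl | rfl <;> simp [par_wz]

instance [Finite Γ] : Finite (SpinWreathProduct Γ n) :=
  Finite.of_equiv _ SemidirectProduct.equivProd.symm

noncomputable instance [Finite Γ] : Fintype (SpinWreathProduct Γ n) := Fintype.ofFinite _

/-- Every element is a product of elements of `Γ^n`, of `z` and of the generators `t`. -/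
theorem wreath_induction {P : SpinWreathProduct Γ n → Prop}
    (g : ∀ g : Fin n → Γ, P (SemidirectProduct.inl g)) (z : P (wz Γ n))
    (t : ∀ i, P (SemidirectProduct.inr (st n i))) (mul : ∀ x y, P x → P y → P (x * y))
    (x : SpinWreathProduct Γ n) : P x := by
  rw [← SemidirectProduct.inl_left_mul_inr_right x]
  refine mul _ _ (g _) ?_
  have h1 : P 1 := by simpa using g 1
  induction x.right using spin_induction with
  | one => simpa using h1
  | z => exact z
  | t i => exact t i
  | mul x y hx hy => rw [map_mul]; exact mul _ _ hx hy

/-- The space of spin super class functions: class functions `f` with `f (z x) = - f x`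
that vanish on odd elements. -/
def RMinus (Γ : Type u) [Group Γ] (n : ℕ) : Submodule ℂ (SpinWreathProduct Γ n → ℂ) where
  carrier := {f | (∀ g x, f (g * x * g⁻¹) = f x) ∧ (∀ x, f (wz Γ n * x) = -f x) ∧
    ∀ x, par x = 1 → f x = 0}
  zero_mem' := by simp
  add_mem' := by
    rintro a b ⟨h1, h2, h3⟩ ⟨k1, k2, k3⟩
    refine ⟨fun g x => by simp [h1, k1], fun x => ?_, fun x hx => by simp [h3 x hx, k3 x hx]⟩
    simp only [Pi.add_apply, h2, k2]; ring
  smul_mem' := by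
    rintro c a ⟨h1, h2, h3⟩
    exact ⟨fun g x => by simp [h1], fun x => by simp [h2], fun x hx => by simp [h3 x hx]⟩

end

/-! ### The spin product of two spin wreath products -/

/-- The product with twisted multiplication `(t, t') (s, s') = (t s z^{d(t') d(s)}, t' s')`. -/
@[ext] structure TwistedProd (Γ : Type u) [Group Γ] (n m : ℕ) : Type u where
  /-- first component -/
  fst : SpinWreathProduct Γ n
  /-- second component -/
  snd : SpinWreathProduct Γ m

section
variable {Γ : Type u} [Group Γ] {n m : ℕ}

instance : Mul (TwistedProd Γ n m) :=
  ⟨fun x y => ⟨x.fst * y.fst * zpar Γ n (par x.snd * par y.fst), x.snd * y.snd⟩⟩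

instance : One (TwistedProd Γ n m) := ⟨⟨1, 1⟩⟩

instance : Inv (TwistedProd Γ n m) :=
  ⟨fun x => ⟨x.fst⁻¹ * zpar Γ n (par x.snd * par x.fst), x.snd⁻¹⟩⟩

theorem tw_mul_fst (x y : TwistedProd Γ n m) :
    (x * y).fst = x.fst * y.fst * zpar Γ n (par x.snd * par y.fst) := rfl

theorem tw_mul_snd (x y : TwistedProd Γ n m) : (x * y).snd = x.snd * y.snd := rfl

theorem tw_one_fst : (1 : TwistedProd Γ n m).fst = 1 := rfl

theorem tw_one_snd : (1 : TwistedProd Γ n m).snd = 1 := rfl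

theorem tw_inv_fst (x : TwistedProd Γ n m) :
    x⁻¹.fst = x.fst⁻¹ * zpar Γ n (par x.snd * par x.fst) := rfl

theorem tw_inv_snd (x : TwistedProd Γ n m) : x⁻¹.snd = x.snd⁻¹ := rfl

instance : Group (TwistedProd Γ n m) := Group.ofLeftAxioms
  (by
    intro x y w
    refine TwistedProd.ext ?_ ?_
    · simp only [tw_mul_fst, tw_mul_snd, par_mul, par_zpar, add_zero, mul_add, add_mul, zpar_add]
      have h := zpar_central (par x.snd * par y.fst) w.fst
      calc x.fst * y.fst * zpar Γ n (par x.snd * par y.fst) * w.fst *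
              (zpar Γ n (par x.snd * par w.fst) * zpar Γ n (par y.snd * par w.fst))
          = x.fst * y.fst * (zpar Γ n (par x.snd * par y.fst) * w.fst) *
              (zpar Γ n (par x.snd * par w.fst) * zpar Γ n (par y.snd * par w.fst)) := by
            simp only [mul_assoc]
        _ = x.fst * (y.fst * w.fst) * (zpar Γ n (par x.snd * par y.fst) *
              (zpar Γ n (par x.snd * par w.fst) * zpar Γ n (par y.snd * par w.fst))) := by
            rw [h]; simp only [mul_assoc]
        _ = x.fst * (y.fst * w.fst) * (zpar Γ n (par y.snd * par w.fst) *
              (zpar Γ n (par x.snd * par y.fst) * zpar Γ n (par x.snd * par w.fst))) := by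
            congr 1
            rw [← zpar_add, ← zpar_add, ← zpar_add, ← zpar_add]
            congr 1; ring
        _ = _ := by simp only [mul_assoc]
    · simp only [tw_mul_snd, mul_assoc])
  (by
    intro x
    refine TwistedProd.ext ?_ ?_
    · simp [tw_mul_fst, tw_one_fst, tw_one_snd]
    · simp [tw_mul_snd, tw_one_snd])
  (by
    intro x
    refine TwistedProd.ext ?_ ?_
    · simp only [tw_mul_fst, tw_inv_fst, tw_inv_snd, par_inv, tw_one_fst]
      rw [mul_assoc x.fst⁻¹, zpar_central, ← mul_assoc, inv_mul_cancel, one_mul, ← zpar_add]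
      have : ∀ a : ZMod 2, a + a = 0 := by decide
      rw [this, zpar_zero]
    · simp [tw_mul_snd, tw_inv_snd, tw_one_snd])

/-- The subgroup `{(1, 1), (z, z)}`. -/
def diagZ (Γ : Type u) [Group Γ] (n m : ℕ) : Subgroup (TwistedProd Γ n m) where
  carrier := {x | x = ⟨1, 1⟩ ∨ x = ⟨wz Γ n, wz Γ m⟩}
  one_mem' := Or.inl rfl
  mul_mem' := by
    rintro x y (rfl | rfl) (rfl | rfl)
    · left; exact TwistedProd.ext (by simp [tw_mul_fst]) (by simp [tw_mul_snd])
    · right; exact TwistedProd.ext (by simp [tw_mul_fst]) (by simp [tw_mul_snd])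
    · right; exact TwistedProd.ext (by simp [tw_mul_fst]) (by simp [tw_mul_snd])
    · left
      exact TwistedProd.ext (by simp [tw_mul_fst, par_wz, wz_sq]) (by simp [tw_mul_snd, wz_sq])
  inv_mem' := by
    have h : ∀ k, (wz Γ k)⁻¹ = wz Γ k := fun k => by rw [inv_eq_iff_mul_eq_one, wz_sq]
    rintro x (rfl | rfl)
    · left; exact TwistedProd.ext (by simp [tw_inv_fst]) (by simp [tw_inv_snd])
    · right; exact TwistedProd.ext (by simp [tw_inv_fst, par_wz, h]) (by simp [tw_inv_snd, h])

instance : (diagZ Γ n m).Normal where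
  conj_mem := by
    rintro x (rfl | rfl) g
    · change g * 1 * g⁻¹ ∈ _
      simp [one_mem]
    · have : g * (⟨wz Γ n, wz Γ m⟩ : TwistedProd Γ n m) = ⟨wz Γ n, wz Γ m⟩ * g :=
        TwistedProd.ext (by simp [tw_mul_fst, par_wz, wz_central])
          (by simp [tw_mul_snd, wz_central])
      rw [this, mul_inv_cancel_right]
      exact Or.inr rfl

/-- The spin product of two spin wreath products. -/
abbrev SpinProd (Γ : Type u) [Group Γ] (n m : ℕ) : Type u := TwistedProd Γ n m ⧸ diagZ Γ n m

/-- The class of the pair `(x, y)` in the spin product. -/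
def SpinProd.mk (x : SpinWreathProduct Γ n) (y : SpinWreathProduct Γ m) : SpinProd Γ n m :=
  QuotientGroup.mk (⟨x, y⟩ : TwistedProd Γ n m)

/-- The space of spin class functions on the spin product vanishing on odd elements; the parity
of the class of `(x, y)` is `d x + d y`, and the central involution is the class of `(z, 1)`. -/
def RMinusProd (Γ : Type u) [Group Γ] (n m : ℕ) : Submodule ℂ (SpinProd Γ n m → ℂ) where
  carrier := {F | (∀ g x, F (g * x * g⁻¹) = F x) ∧
    (∀ x, F (SpinProd.mk (wz Γ n) 1 * x) = -F x) ∧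
    ∀ (x : SpinWreathProduct Γ n) (y : SpinWreathProduct Γ m),
      par x + par y = 1 → F (SpinProd.mk x y) = 0}
  zero_mem' := by simp
  add_mem' := by
    rintro a b ⟨h1, h2, h3⟩ ⟨k1, k2, k3⟩
    refine ⟨fun g x => by simp [h1, k1], fun x => ?_,
      fun x y hx => by simp [h3 x y hx, k3 x y hx]⟩
    simp only [Pi.add_apply, h2, k2]; ring
  smul_mem' := by
    rintro c a ⟨h1, h2, h3⟩
    exact ⟨fun g x => by simp [h1], fun x => by simp [h2], fun x y hx => by simp [h3 x y hx]⟩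

instance [Finite Γ] : Finite (TwistedProd Γ n m) :=
  Finite.of_injective (fun x => (x.fst, x.snd)) fun x y h => by
    simp only [Prod.mk.injEq] at h
    exact TwistedProd.ext h.1 h.2

noncomputable instance [Finite Γ] : Fintype (SpinProd Γ n m) := Fintype.ofFinite _

end

/-! ### Embedding the spin product into a spin wreath product -/

/-- The embedding of the first `k` indices into `N` indices, shifted by `a`. -/
def shiftFin {a k N : ℕ} (h : a + k ≤ N) : Fin k ↪ Fin N :=
  ⟨fun i => ⟨a + i.1, by have := i.2; omega⟩, fun i j hij => by
    simp only [Fin.mk.injEq] at hij; exact Fin.ext (by omega)⟩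

/-- The homomorphism of spin groups sending `z` to `z` and `t_i` to `t_{a+i}`. -/
def spinEmbed {a k N : ℕ} (h : a + k ≤ N) : SpinGroup k →* SpinGroup N :=
  spinLift (sz N) (fun i => st N ⟨a + i.1, by have := i.2; omega⟩) sz_sq (fun _ => st_sq _)
    (fun i j hij => st_braid _ _ (by simp only; omega))
    (fun i j hij => st_comm _ _ (by simp only; omega)) (fun _ => sz_st _)

section
variable {Γ : Type u} [Group Γ] {a k l N : ℕ}

theorem viaEmbedding_swap {α β : Type*} [DecidableEq α] [DecidableEq β] (f : α ↪ β) (u v : α) :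
    Equiv.Perm.viaEmbedding (Equiv.swap u v) f = Equiv.swap (f u) (f v) := by
  ext x
  by_cases hx : x ∈ Set.range f
  · obtain ⟨y, rfl⟩ := hx
    rw [Equiv.Perm.viaEmbedding_apply, f.injective.map_swap]
  · rw [Equiv.Perm.viaEmbedding_apply_of_notMem _ _ _ hx, Equiv.swap_apply_of_ne_of_ne]
    · rintro rfl; exact hx ⟨u, rfl⟩
    · rintro rfl; exact hx ⟨v, rfl⟩

theorem spinToPerm_spinEmbed (h : a + k ≤ N) (t : SpinGroup k) :
    spinToPerm N (spinEmbed h t) = (spinToPerm k t).viaEmbedding (shiftFin h) := by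
  refine spin_hom_ext (f := (spinToPerm N).comp (spinEmbed h))
    (g := (Equiv.Perm.viaEmbeddingHom (shiftFin h)).comp (spinToPerm k)) ?_ ?_ t
  · simp [spinToPerm, spinEmbed]
  · intro i
    simp only [spinToPerm, spinEmbed, MonoidHom.comp_apply, spinLift_st,
      Equiv.Perm.viaEmbeddingHom_apply, viaEmbedding_swap]
    rfl

/-- The homomorphism of spin wreath products placing the indices after the first `a` ones
(and extending the `Γ`-part by `1`). -/
noncomputable def wEmbed (Γ : Type u) [Group Γ] {a k N : ℕ} (h : a + k ≤ N) :
    SpinWreathProduct Γ k →* SpinWreathProduct Γ N :=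
  SemidirectProduct.map (Function.ExtendByOne.hom Γ (shiftFin h)) (spinEmbed h) (by
    intro t
    refine MonoidHom.ext fun g => funext fun i => ?_
    change Function.extend (shiftFin h) (wreathAction Γ k t g) 1 i =
      Function.extend (shiftFin h) g 1 ((spinToPerm N (spinEmbed h t))⁻¹ i)
    rw [← map_inv, ← map_inv, spinToPerm_spinEmbed]
    by_cases hi : i ∈ Set.range (shiftFin h)
    · obtain ⟨j, rfl⟩ := hi
      rw [(shiftFin h).injective.extend_apply, Equiv.Perm.viaEmbedding_apply,
        (shiftFin h).injective.extend_apply, wreathAction_apply, map_inv]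
    · rw [Equiv.Perm.viaEmbedding_apply_of_notMem _ _ _ hi, Function.extend_apply' _ _ _ hi,
        Function.extend_apply' _ _ _ hi])

theorem wEmbed_left (h : a + k ≤ N) (x : SpinWreathProduct Γ k) :
    (wEmbed Γ h x).left = Function.extend (shiftFin h) x.left 1 := rfl

theorem wEmbed_right (h : a + k ≤ N) (x : SpinWreathProduct Γ k) :
    (wEmbed Γ h x).right = spinEmbed h x.right := rfl

theorem wEmbed_inl (h : a + k ≤ N) (g : Fin k → Γ) :
    wEmbed Γ h (SemidirectProduct.inl g) =
      SemidirectProduct.inl (Function.extend (shiftFin h) g 1) :=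
  SemidirectProduct.ext (by rw [wEmbed_left]; rfl) (by rw [wEmbed_right]; simp)

theorem wEmbed_inr (h : a + k ≤ N) (t : SpinGroup k) :
    wEmbed Γ h (SemidirectProduct.inr t) = SemidirectProduct.inr (spinEmbed h t) :=
  SemidirectProduct.ext (by
    rw [wEmbed_left]; exact Function.extend_one _) (by rw [wEmbed_right]; rfl)

theorem wEmbed_wz (h : a + k ≤ N) : wEmbed Γ h (wz Γ k) = wz Γ N := by
  rw [wz, wEmbed_inr, wz]; simp [spinEmbed]

theorem wEmbed_zpar (h : a + k ≤ N) (e : ZMod 2) : wEmbed Γ h (zpar Γ k e) = zpar Γ N e := by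
  rw [zpar, map_pow, wEmbed_wz, zpar]

theorem par_wEmbed (h : a + k ≤ N) (x : SpinWreathProduct Γ k) : par (wEmbed Γ h x) = par x := by
  change (spinParity N (spinEmbed h x.right)).toAdd = (spinParity k x.right).toAdd
  congr 1
  refine spin_hom_ext (f := (spinParity N).comp (spinEmbed h)) ?_ ?_ x.right
  · simp [spinParity, spinEmbed]
  · intro i; simp [spinParity, spinEmbed]

theorem par_inl {n : ℕ} (g : Fin n → Γ) :
    par (SemidirectProduct.inl g : SpinWreathProduct Γ n) = 0 := by
  simp [par, wParity]

theorem par_st {n : ℕ} (i) :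
    par (SemidirectProduct.inr (st n i) : SpinWreathProduct Γ n) = 1 := by
  simp [par, wParity, spinParity]

theorem wEmbed_comm (h : k + l ≤ N) (y : SpinWreathProduct Γ l) (x : SpinWreathProduct Γ k) :
    wEmbed Γ h y * wEmbed Γ (a := 0) (by omega) x =
      wEmbed Γ (a := 0) (N := N) (by omega) x * wEmbed Γ h y * zpar Γ N (par y * par x) := by
  have h0 : 0 + k ≤ N := by omega
  change wEmbed Γ h y * wEmbed Γ h0 x = wEmbed Γ h0 x * wEmbed Γ h y * zpar Γ N (par y * par x)
  have hdis : ∀ (i : Fin k) (j : Fin l), shiftFin h0 i ≠ shiftFin h j := by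
    intro i j hij
    have e : 0 + i.1 = k + j.1 := congrArg Fin.val hij
    have := i.2
    omega
  have hfix : ∀ {k l a b : ℕ} (h0 : a + k ≤ N) (h : b + l ≤ N)
      (_ : ∀ (i : Fin k) (j : Fin l), shiftFin h0 i ≠ shiftFin h j) (t : SpinGroup l)
      (g : Fin k → Γ), wreathAction Γ N (spinEmbed h t) (Function.extend (shiftFin h0) g 1) =
        Function.extend (shiftFin h0) g 1 := by
    intro k l a b h0 h hd t g
    funext i
    rw [wreathAction_apply, ← map_inv, ← map_inv, spinToPerm_spinEmbed]
    by_cases hi : i ∈ Set.range (shiftFin h)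
    · obtain ⟨j, rfl⟩ := hi
      rw [Equiv.Perm.viaEmbedding_apply, Function.extend_apply', Function.extend_apply']
      · rfl
      · rintro ⟨u, hu⟩; exact hd u _ hu
      · rintro ⟨u, hu⟩; exact hd u _ hu
    · rw [Equiv.Perm.viaEmbedding_apply_of_notMem _ _ _ hi]
  have hgt : ∀ {k l a b : ℕ} (h0 : a + k ≤ N) (h : b + l ≤ N)
      (_ : ∀ (i : Fin k) (j : Fin l), shiftFin h0 i ≠ shiftFin h j) (t : SpinGroup l)
      (g : Fin k → Γ), wEmbed Γ h (SemidirectProduct.inr t) *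
        wEmbed Γ h0 (SemidirectProduct.inl g) = wEmbed Γ h0 (SemidirectProduct.inl g) *
        wEmbed Γ h (SemidirectProduct.inr t) := by
    intro k l a b h0 h hd t g
    rw [wEmbed_inr, wEmbed_inl, ← mul_inv_eq_iff_eq_mul, ← map_inv, ← SemidirectProduct.inl_aut,
      hfix h0 h hd]
  induction x using wreath_induction with
  | z => 
    rw [wEmbed_wz, par_wz, mul_zero, zpar_zero, mul_one, wz_central]
  | mul x₁ x₂ h₁ h₂ =>
    rw [map_mul, par_mul, mul_add, zpar_add, ← mul_assoc, h₁, mul_assoc _ (zpar _ _ _),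
      zpar_central (par y * par x₁), ← mul_assoc, mul_assoc _ _ (wEmbed Γ h0 x₂), h₂]
    simp only [mul_assoc]
    rw [zpar_central (par y * par x₂)]
  | g g =>
    rw [par_inl, mul_zero, zpar_zero, mul_one]
    induction y using wreath_induction with
    | z => rw [wEmbed_wz, wz_central]
    | mul y₁ y₂ h₁ h₂ => rw [map_mul, mul_assoc, h₂, ← mul_assoc, h₁, mul_assoc]
    | t i => exact hgt h0 h hdis _ _
    | g g' =>
      rw [wEmbed_inl, wEmbed_inl, ← map_mul, ← map_mul]
      congr 1
      funext i
      simp only [Pi.mul_apply]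
      by_cases hi : i ∈ Set.range (shiftFin h)
      · obtain ⟨j, rfl⟩ := hi
        rw [Function.extend_apply' (f := shiftFin h0)]
        · simp
        · rintro ⟨u, hu⟩; exact hdis u _ hu
      · rw [Function.extend_apply' (f := shiftFin h) _ _ _ hi]
        simp
  | t i =>
    induction y using wreath_induction with
    | z => rw [wEmbed_wz, par_wz, zero_mul, zpar_zero, mul_one, wz_central]
    | mul y₁ y₂ h₁ h₂ =>
      rw [map_mul, par_mul, add_mul, zpar_add, mul_assoc, h₂, ← mul_assoc, ← mul_assoc, h₁]
      simp only [mul_assoc]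
      congr 2
      rw [← mul_assoc, zpar_central, mul_assoc]
    | g g' =>
      rw [par_inl, zero_mul, zpar_zero, mul_one]
      exact (hgt h h0 (fun i j => (hdis j i).symm) _ _).symm
    | t j =>
      rw [par_st, par_st, mul_one, zpar_one, wEmbed_inr, wEmbed_inr, wz, ← map_mul, ← map_mul,
        ← map_mul]
      congr 1
      simp only [spinEmbed, spinLift_st]
      rw [st_comm _ _ (by have := i.2; simp only; omega), mul_assoc, sz_central]

theorem par_mk_wEmbed (h : k + l = N) (x : SpinWreathProduct Γ k) (y : SpinWreathProduct Γ l) :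
    par (wEmbed Γ (a := 0) (N := N) (by omega) x * wEmbed Γ h.le y) = par x + par y := by
  rw [par_mul, par_wEmbed, par_wEmbed]

/-- The canonical homomorphism from the spin product of the `k`-th and the `l`-th spin wreath
product to the `(k+l)`-th one: the class of `(x, y)` is sent to the product of `x`, acting on the
first `k` indices, and `y`, acting on the last `l` indices. -/
noncomputable def prodEmbed (Γ : Type u) [Group Γ] {k l N : ℕ} (h : k + l = N) :
    SpinProd Γ k l →* SpinWreathProduct Γ N :=
  QuotientGroup.lift (diagZ Γ k l)
    (MonoidHom.mk' (fun x : TwistedProd Γ k l =>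
        wEmbed Γ (a := 0) (N := N) (by omega) x.fst * wEmbed Γ h.le x.snd) (by
      intro x y
      simp only [tw_mul_fst, tw_mul_snd, map_mul, wEmbed_zpar]
      have e := wEmbed_comm h.le x.snd y.fst
      have c := zpar_central (par x.snd * par y.fst) (wEmbed Γ h.le x.snd)
      rw [mul_assoc _ (zpar _ _ _), ← mul_assoc (zpar Γ N _), c]
      simp only [← mul_assoc]
      rw [mul_assoc (wEmbed Γ _ x.fst) (wEmbed Γ _ x.snd), e]
      simp only [mul_assoc]))
    (by
      rintro x (rfl | rfl)
      · simp
      · simp [wEmbed_wz, wz_sq])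

theorem prodEmbed_mk (h : k + l = N) (x : SpinWreathProduct Γ k) (y : SpinWreathProduct Γ l) :
    prodEmbed Γ h (SpinProd.mk x y) =
      wEmbed Γ (a := 0) (N := N) (by omega) x * wEmbed Γ h.le y := rfl

theorem SpinProd.exists_mk (w : SpinProd Γ k l) : ∃ x y, w = SpinProd.mk x y := by
  obtain ⟨⟨x, y⟩, rfl⟩ := QuotientGroup.mk_surjective w
  exact ⟨x, y, rfl⟩

/-! ### Induction and restriction -/

/-- Restriction of spin super class functions along the embedding of a spin product. -/
noncomputable def res (Γ : Type u) [Group Γ] {k l N : ℕ} (h : k + l = N) :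
    RMinus Γ N →ₗ[ℂ] RMinusProd Γ k l where
  toFun f := ⟨fun w => f.1 (prodEmbed Γ h w), by
    obtain ⟨h1, h2, h3⟩ := f.2
    refine ⟨fun g x => by simp [h1], fun x => ?_, fun x y hxy => h3 _ ?_⟩
    · simp only [map_mul, prodEmbed_mk, wEmbed_wz, map_one, mul_one, h2]
    · rw [prodEmbed_mk, par_mk_wEmbed h, hxy]⟩
  map_add' f g := rfl
  map_smul' c f := rfl

/-- Induction of spin super class functions along the embedding of a spin product:
`(Ind F)(x) = |H|⁻¹ ∑ F (g⁻¹ x g)`, the sum being over the `g` with `g⁻¹ x g` in the (image of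
the) subgroup `H`. -/
noncomputable def ind (Γ : Type u) [Group Γ] [Finite Γ] {k l N : ℕ} (h : k + l = N) :
    RMinusProd Γ k l →ₗ[ℂ] RMinus Γ N where
  toFun F := ⟨fun x => by
      classical
      exact (Nat.card (SpinProd Γ k l) : ℂ)⁻¹ * ∑ g : SpinWreathProduct Γ N,
        ∑ w : SpinProd Γ k l, if prodEmbed Γ h w = g⁻¹ * x * g then F.1 w else 0, by
    classical
    obtain ⟨h1, h2, h3⟩ := F.2
    refine ⟨fun a x => ?_, fun x => ?_, fun x hx => ?_⟩
    · simp only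
      congr 1
      refine Fintype.sum_equiv (Equiv.mulLeft a⁻¹) _ _ fun g => ?_
      simp only [Equiv.coe_mulLeft, mul_inv_rev, inv_inv, mul_assoc]
    · simp only
      rw [← mul_neg, ← Finset.sum_neg_distrib]
      congr 1
      refine Finset.sum_congr rfl fun g _ => ?_
      rw [← Finset.sum_neg_distrib]
      refine Fintype.sum_equiv (Equiv.mulLeft (SpinProd.mk (wz Γ k) 1)) _ _ fun w => ?_
      simp only [Equiv.coe_mulLeft, h2, map_mul, prodEmbed_mk, wEmbed_wz, map_one, mul_one]
      have e : prodEmbed Γ h w = g⁻¹ * (wz Γ N * x) * g ↔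
          wz Γ N * prodEmbed Γ h w = g⁻¹ * x * g := by
        have : g⁻¹ * (wz Γ N * x) * g = wz Γ N * (g⁻¹ * x * g) := by
          rw [← mul_assoc g⁻¹, ← wz_central]; simp only [mul_assoc]
        rw [this]
        constructor
        · intro hh; rw [hh, ← mul_assoc, wz_sq, one_mul]
        · intro hh; rw [← hh, ← mul_assoc, wz_sq, one_mul]
      simp only [e]
      split_ifs <;> simp
    · simp only
      rw [Finset.sum_eq_zero, mul_zero]
      refine fun g _ => Finset.sum_eq_zero fun w _ => ?_
      split_ifs with hw
      · obtain ⟨u, v, rfl⟩ := w.exists_mk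
        refine h3 u v ?_
        rw [← par_mk_wEmbed h, ← prodEmbed_mk h, hw, par_mul, par_mul, par_inv, hx]
        have : ∀ b : ZMod 2, b + 1 + b = 1 := by decide
        exact this _
      · rfl⟩
  map_add' F G := by
    classical
    refine Subtype.ext (funext fun x => ?_)
    simp only [Submodule.coe_add, Pi.add_apply, ← mul_add, ← Finset.sum_add_distrib]
    congr 1
    refine Finset.sum_congr rfl fun g _ => Finset.sum_congr rfl fun w _ => ?_
    split_ifs <;> simp
  map_smul' c F := by
    classical
    refine Subtype.ext (funext fun x => ?_)
    simp only [Submodule.coe_smul, Pi.smul_apply, smul_eq_mul, RingHom.id_apply,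
      mul_left_comm c, Finset.mul_sum]
    refine Finset.sum_congr rfl fun g _ => Finset.sum_congr rfl fun w _ => ?_
    split_ifs <;> simp

end

/-! ### The super outer tensor product -/

section
variable {Γ : Type u} [Group Γ] {n m : ℕ}

theorem RMinus.mul_wz (f : RMinus Γ n) (x : SpinWreathProduct Γ n) :
    f.1 (x * wz Γ n) = -f.1 x := by
  rw [← wz_central]; exact f.2.2.1 x

/-- The function `(x, y) ↦ f x * g y` on the spin product. This is the character of the super outer
tensor product of supermodules with characters `f` and `g`. -/
def outerFun (f : RMinus Γ n) (g : RMinus Γ m) (w : SpinProd Γ n m) : ℂ :=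
  Quotient.liftOn' w (fun p => f.1 p.fst * g.1 p.snd) (by
    intro p q hpq
    obtain ⟨d, hd, rfl⟩ : ∃ d ∈ diagZ Γ n m, q = p * d :=
      ⟨p⁻¹ * q, QuotientGroup.leftRel_apply.1 hpq, by group⟩
    rcases hd with rfl | rfl
    · simp [tw_mul_fst, tw_mul_snd]
    · simp [tw_mul_fst, tw_mul_snd, par_wz, RMinus.mul_wz])

theorem outerFun_mk (f : RMinus Γ n) (g : RMinus Γ m) (x : SpinWreathProduct Γ n)
    (y : SpinWreathProduct Γ m) : outerFun f g (SpinProd.mk x y) = f.1 x * g.1 y := rfl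

theorem zmod_two_cases (a : ZMod 2) : a = 0 ∨ a = 1 := by
  revert a; decide

theorem outerFun_mem (f : RMinus Γ n) (g : RMinus Γ m) : outerFun f g ∈ RMinusProd Γ n m := by
  refine ⟨fun c w => ?_, fun w => ?_, fun x y h => ?_⟩
  · obtain ⟨x, y, rfl⟩ := w.exists_mk
    obtain ⟨a, b, rfl⟩ := c.exists_mk
    change outerFun f g (QuotientGroup.mk
      ((⟨a, b⟩ : TwistedProd Γ n m) * ⟨x, y⟩ * ⟨a, b⟩⁻¹)) = f.1 x * g.1 y
    change f.1 ((⟨a, b⟩ : TwistedProd Γ n m) * ⟨x, y⟩ * ⟨a, b⟩⁻¹).fst *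
      g.1 ((⟨a, b⟩ : TwistedProd Γ n m) * ⟨x, y⟩ * ⟨a, b⟩⁻¹).snd = _
    have h2 : ((⟨a, b⟩ : TwistedProd Γ n m) * ⟨x, y⟩ * ⟨a, b⟩⁻¹).snd = b * y * b⁻¹ := rfl
    rw [h2, g.2.1]
    rcases zmod_two_cases (par y) with hy | hy
    swap
    · rw [g.2.2.2 y hy, mul_zero, mul_zero]
    congr 1
    simp only [tw_mul_fst, tw_mul_snd, tw_inv_fst, par_mul, par_inv, par_zpar, hy, add_zero]
    rcases zmod_two_cases (par x) with hx | hx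
    · rw [hx, mul_zero, zpar_zero, mul_one, ← mul_assoc, mul_assoc _ (zpar _ _ _), ← zpar_add]
      have : ∀ a : ZMod 2, a + a = 0 := by decide
      rw [this, zpar_zero, mul_one, f.2.1]
    · rw [f.2.2.2 x hx, f.2.2.2]
      simp only [par_mul, par_inv, par_zpar, hx, add_zero]
      have : ∀ a : ZMod 2, a + 1 + a = 1 := by decide
      exact this _
  · obtain ⟨x, y, rfl⟩ := w.exists_mk
    change f.1 ((⟨wz Γ n, 1⟩ : TwistedProd Γ n m) * ⟨x, y⟩).fst *
      g.1 ((⟨wz Γ n, 1⟩ : TwistedProd Γ n m) * ⟨x, y⟩).snd = -(f.1 x * g.1 y)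
    simp [tw_mul_fst, tw_mul_snd, f.2.2.1]
  · rw [outerFun_mk]
    rcases zmod_two_cases (par x) with hx | hx
    · rw [hx, zero_add] at h
      rw [g.2.2.2 y h, mul_zero]
    · rw [f.2.2.2 x hx, zero_mul]

variable (Γ n m) in
/-- The super outer tensor product `φ`. -/
def phi : RMinus Γ n ⊗[ℂ] RMinus Γ m →ₗ[ℂ] RMinusProd Γ n m :=
  TensorProduct.lift (LinearMap.mk₂ ℂ (fun f g => ⟨outerFun f g, outerFun_mem f g⟩)
    (by
      intro f f' g; refine Subtype.ext (funext fun w => ?_)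
      obtain ⟨x, y, rfl⟩ := w.exists_mk
      exact add_mul _ _ _)
    (by
      intro c f g; refine Subtype.ext (funext fun w => ?_)
      obtain ⟨x, y, rfl⟩ := w.exists_mk
      exact mul_assoc _ _ _)
    (by
      intro f g g'; refine Subtype.ext (funext fun w => ?_)
      obtain ⟨x, y, rfl⟩ := w.exists_mk
      exact mul_add _ _ _)
    (by
      intro c f g; refine Subtype.ext (funext fun w => ?_)
      obtain ⟨x, y, rfl⟩ := w.exists_mk
      exact mul_left_comm _ _ _))

theorem phi_tmul (f : RMinus Γ n) (g : RMinus Γ m) (x : SpinWreathProduct Γ n)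
    (y : SpinWreathProduct Γ m) : (phi Γ n m (f ⊗ₜ g)).1 (SpinProd.mk x y) = f.1 x * g.1 y := rfl

theorem mk_mul_mk (x x' : SpinWreathProduct Γ n) (y y' : SpinWreathProduct Γ m) :
    SpinProd.mk x y * SpinProd.mk x' y' =
      SpinProd.mk (x * x' * zpar Γ n (par y * par x')) (y * y') := rfl

theorem mk_inv (x : SpinWreathProduct Γ n) (y : SpinWreathProduct Γ m) :
    (SpinProd.mk x y)⁻¹ = SpinProd.mk (x⁻¹ * zpar Γ n (par y * par x)) y⁻¹ := rfl

theorem mk_mul_wz (x : SpinWreathProduct Γ n) (y : SpinWreathProduct Γ m) :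
    SpinProd.mk (x * wz Γ n) (y * wz Γ m) = SpinProd.mk x y := by
  have h := QuotientGroup.mk_mul_of_mem (s := diagZ Γ n m) (⟨x, y⟩ : TwistedProd Γ n m)
    (b := ⟨wz Γ n, wz Γ m⟩) (Or.inr rfl)
  rw [SpinProd.mk, SpinProd.mk, ← h]
  congr 1
  exact TwistedProd.ext (by simp [tw_mul_fst, par_wz]) (by simp [tw_mul_snd])

theorem slice_left (F : RMinusProd Γ n m) (y : SpinWreathProduct Γ m) :
    (fun x => F.1 (SpinProd.mk x y)) ∈ RMinus Γ n := by
  obtain ⟨h1, h2, h3⟩ := F.2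
  have hz : ∀ x, F.1 (SpinProd.mk (wz Γ n * x) y) = -F.1 (SpinProd.mk x y) := by
    intro x
    rw [← h2, mk_mul_mk, par_one, zero_mul, zpar_zero, mul_one, one_mul]
  have hc : ∀ a x, F.1 (SpinProd.mk (a * x * a⁻¹ * zpar Γ n (par y * par a)) y) =
      F.1 (SpinProd.mk x y) := by
    intro a x
    rw [← h1 (SpinProd.mk a 1) (SpinProd.mk x y), mk_inv, mk_mul_mk, mk_mul_mk]
    simp [par_inv]
  rcases zmod_two_cases (par y) with hy | hy
  · refine ⟨fun a x => ?_, hz, fun x hx => h3 x y (by rw [hx, hy, add_zero])⟩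
    have := hc a x
    rwa [hy, zero_mul, zpar_zero, mul_one] at this
  · have h0 : ∀ x, F.1 (SpinProd.mk x y) = 0 := by
      intro x
      rcases zmod_two_cases (par x) with hx | hx
      · exact h3 x y (by rw [hx, hy, zero_add])
      · have := hc x x
        rw [hy, hx, mul_one, zpar_one, mul_inv_cancel_right, ← wz_central, hz] at this
        exact self_eq_neg.1 this.symm
    exact ⟨fun a x => by simp [h0], fun x => by simp [h0], fun x _ => h0 x⟩

theorem slice_right (F : RMinusProd Γ n m) (x : SpinWreathProduct Γ n) :
    (fun y => F.1 (SpinProd.mk x y)) ∈ RMinus Γ m := by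
  obtain ⟨h1, h2, h3⟩ := F.2
  have hz : ∀ y, F.1 (SpinProd.mk x (wz Γ m * y)) = -F.1 (SpinProd.mk x y) := by
    intro y
    rw [← h2, mk_mul_mk, par_one, zero_mul, zpar_zero, mul_one, one_mul, wz_central, wz_central,
      ← mk_mul_wz, mul_assoc y, wz_sq, mul_one]
  have hc : ∀ b y, F.1 (SpinProd.mk (x * zpar Γ n (par b * par x)) (b * y * b⁻¹)) =
      F.1 (SpinProd.mk x y) := by
    intro b y
    rw [← h1 (SpinProd.mk 1 b) (SpinProd.mk x y), mk_inv, mk_mul_mk, mk_mul_mk]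
    simp
  have hzl : ∀ y, F.1 (SpinProd.mk (x * wz Γ n) y) = -F.1 (SpinProd.mk x y) := by
    intro y
    rw [← wz_central]
    exact (slice_left F y).2.1 x
  rcases zmod_two_cases (par x) with hx | hx
  · refine ⟨fun b y => ?_, hz, fun y hy => h3 x y (by rw [hx, hy, zero_add])⟩
    have := hc b y
    rwa [hx, mul_zero, zpar_zero, mul_one] at this
  · have h0 : ∀ y, F.1 (SpinProd.mk x y) = 0 := fun y => (slice_left F y).2.2 x hx
    exact ⟨fun a y => by simp [h0], fun y => by simp [h0], fun y _ => h0 y⟩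

theorem phi_bijective [Finite Γ] : Function.Bijective (phi Γ n m) := by
  classical
  let b := Module.finBasis ℂ (RMinus Γ n)
  let e := TensorProduct.equivFinsuppOfBasisLeft (N := RMinus Γ m) b
  have he : ∀ c, e.symm c = ∑ i, b i ⊗ₜ[ℂ] c i := by
    intro c
    rw [TensorProduct.equivFinsuppOfBasisLeft_symm_apply, Finsupp.sum_fintype]
    simp
  have hval : ∀ (c : Fin _ → RMinus Γ m) x y,
      (phi Γ n m (∑ i, b i ⊗ₜ[ℂ] c i)).1 (SpinProd.mk x y) = ∑ i, (b i).1 x * (c i).1 y := by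
    intro c x y
    rw [map_sum, AddSubmonoidClass.coe_finsetSum, Finset.sum_apply]
    rfl
  constructor
  · rw [injective_iff_map_eq_zero]
    intro t ht
    obtain ⟨c, rfl⟩ := e.symm.surjective t
    rw [he] at ht ⊢
    have h0 : ∀ i y, (c i).1 y = 0 := by
      intro i y
      have hs : ∑ i, (c i).1 y • b i = 0 := by
        refine Subtype.ext (funext fun x => ?_)
        rw [AddSubmonoidClass.coe_finsetSum, Finset.sum_apply]
        have := hval (fun i => c i) x y
        rw [ht] at this
        simp only [Submodule.coe_smul, Pi.smul_apply, smul_eq_mul]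
        simp only [mul_comm ((c _).1 y)]
        exact this.symm
      exact (Fintype.linearIndependent_iff.1 b.linearIndependent) _ hs i
    refine Finset.sum_eq_zero fun i _ => ?_
    rw [show c i = 0 from Subtype.ext (funext (h0 i)), TensorProduct.tmul_zero]
  · intro F
    have hL : ∀ i, ∃ L : (SpinWreathProduct Γ n → ℂ) →ₗ[ℂ] ℂ,
        L.comp (RMinus Γ n).subtype = b.coord i := fun i => LinearMap.exists_extend _
    choose L hL using hL
    let s : SpinWreathProduct Γ m → RMinus Γ n := fun y => ⟨_, slice_left F y⟩
    let r : SpinWreathProduct Γ n → RMinus Γ m := fun x => ⟨_, slice_right F x⟩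
    let c : Fin _ → RMinus Γ m := fun i => ∑ x, L i (Pi.single x 1) • r x
    have hc : ∀ i y, (c i).1 y = b.repr (s y) i := by
      intro i y
      have h1 : b.repr (s y) i = L i (s y).1 := (LinearMap.congr_fun (hL i) (s y)).symm
      rw [h1, LinearMap.pi_apply_eq_sum_univ]
      simp only [c]
      rw [AddSubmonoidClass.coe_finsetSum, Finset.sum_apply]
      refine Finset.sum_congr rfl fun x _ => ?_
      simp only [Submodule.coe_smul, Pi.smul_apply, smul_eq_mul, mul_comm]
      congr 2
      funext j
      simp [Pi.single_apply, eq_comm]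
    refine ⟨∑ i, b i ⊗ₜ[ℂ] c i, Subtype.ext (funext fun w => ?_)⟩
    obtain ⟨x, y, rfl⟩ := w.exists_mk
    rw [hval]
    simp only [hc]
    have := congrArg (fun v : RMinus Γ n => v.1 x) (b.sum_repr (s y))
    simp only [AddSubmonoidClass.coe_finsetSum, Finset.sum_apply, Submodule.coe_smul,
      Pi.smul_apply, smul_eq_mul] at this
    simp only [mul_comm ((b _).1 x)]
    exact this

variable (Γ n m) in
/-- The isomorphism given by the super outer tensor product. -/
noncomputable def phiEquiv [Finite Γ] : RMinus Γ n ⊗[ℂ] RMinus Γ m ≃ₗ[ℂ] RMinusProd Γ n m :=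
  LinearEquiv.ofBijective (phi Γ n m) phi_bijective

end

/-! ### Hopf algebras, with explicitly given operations -/

/-- The vector space `A` is a Hopf algebra with multiplication `μ`, unit `e`, comultiplication
`Δ`, counit `κ` and antipode `S`. -/
structure IsHopfAlgebra {A : Type*} [AddCommGroup A] [Module ℂ A] (μ : A ⊗[ℂ] A →ₗ[ℂ] A) (e : A)
    (Δ : A →ₗ[ℂ] A ⊗[ℂ] A) (κ : A →ₗ[ℂ] ℂ) (S : A →ₗ[ℂ] A) : Prop where
  mul_assoc : ∀ x y w, μ (μ (x ⊗ₜ y) ⊗ₜ w) = μ (x ⊗ₜ μ (y ⊗ₜ w))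
  one_mul : ∀ x, μ (e ⊗ₜ x) = x
  mul_one : ∀ x, μ (x ⊗ₜ e) = x
  coassoc : ∀ x, TensorProduct.assoc ℂ A A A (Δ.rTensor A (Δ x)) = Δ.lTensor A (Δ x)
  counit_left : ∀ x, TensorProduct.lid ℂ A (κ.rTensor A (Δ x)) = x
  counit_right : ∀ x, TensorProduct.rid ℂ A (κ.lTensor A (Δ x)) = x
  comul_one : Δ e = e ⊗ₜ e
  comul_mul : ∀ x y, Δ (μ (x ⊗ₜ y)) = TensorProduct.map μ μ
    (TensorProduct.tensorTensorTensorComm ℂ A A A A (Δ x ⊗ₜ Δ y))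
  counit_one : κ e = 1
  counit_mul : ∀ x y, κ (μ (x ⊗ₜ y)) = κ x * κ y
  antipode_left : ∀ x, μ (S.rTensor A (Δ x)) = κ x • e
  antipode_right : ∀ x, μ (S.lTensor A (Δ x)) = κ x • e

/-! ### The Hopf algebra of super spin characters -/

/-- The direct sum over `n ≥ 0` of the spaces of spin super class functions. -/
abbrev RGamma (Γ : Type u) [Group Γ] : Type u := ⨁ n : ℕ, RMinus Γ n

section
variable (Γ : Type u) [Group Γ]

/-- The spin function on `{1, z}`, the spin wreath product for `n = 0`, with value `1` at `1` and
`-1` at `z`. -/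
noncomputable def unitFun : RMinus Γ 0 :=
  ⟨fun x => ((spinLift (G := ℤˣ) (n := 0) (-1) (fun i => absurd i.2 (by omega)) (by decide)
      (fun i => absurd i.2 (by omega)) (fun i => absurd i.2 (by omega))
      (fun i => absurd i.2 (by omega)) (fun i => absurd i.2 (by omega)) x.right : ℤˣ) : ℂ), by
    refine ⟨fun g x => ?_, fun x => ?_, fun x hx => ?_⟩
    · simp only [SemidirectProduct.mul_right, SemidirectProduct.inv_right, map_mul, map_inv]
      rw [mul_comm, inv_mul_cancel_left]
    · simp only [SemidirectProduct.mul_right, map_mul, wz, SemidirectProduct.right_inr,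
        spinLift_sz]
      simp
    · exfalso
      have h : spinParity 0 x.right = 1 :=
        spin_hom_ext (f := spinParity 0) (g := 1) (by simp [spinParity])
          (fun i => absurd i.2 (by omega)) x.right
      have h' : (spinParity 0 x.right).toAdd = 1 := hx
      rw [h] at h'
      exact absurd h' (by decide)⟩

/-- The unit of `R⁻`. -/
noncomputable def rOne : RGamma Γ := DirectSum.lof ℂ ℕ (fun n => RMinus Γ n) 0 (unitFun Γ)

/-- The counit of `R⁻`: evaluation of the degree `0` component at the identity element. -/
noncomputable def rCounit : RGamma Γ →ₗ[ℂ] ℂ :=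
  (LinearMap.proj (1 : SpinWreathProduct Γ 0)).comp
    ((RMinus Γ 0).subtype.comp (DirectSum.component ℂ ℕ (fun n => RMinus Γ n) 0))

variable [Finite Γ]

/-- The multiplication of `R⁻`: the outer tensor product followed by induction. -/
noncomputable def rMul : RGamma Γ ⊗[ℂ] RGamma Γ →ₗ[ℂ] RGamma Γ :=
  TensorProduct.lift (DirectSum.toModule ℂ ℕ _ fun n =>
    LinearMap.flip (DirectSum.toModule ℂ ℕ _ fun m => LinearMap.flip (TensorProduct.curry
      ((DirectSum.lof ℂ ℕ (fun N => RMinus Γ N) (n + m)).comp ((ind Γ rfl).comp (phi Γ n m))))))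

/-- The comultiplication of `R⁻`: restriction followed by the inverse of the outer tensor
product. -/
noncomputable def rComul : RGamma Γ →ₗ[ℂ] RGamma Γ ⊗[ℂ] RGamma Γ :=
  DirectSum.toModule ℂ ℕ _ fun N => ∑ p ∈ (Finset.HasAntidiagonal.antidiagonal N).attach,
    (TensorProduct.map (DirectSum.lof ℂ ℕ (fun n => RMinus Γ n) p.1.1)
      (DirectSum.lof ℂ ℕ (fun n => RMinus Γ n) p.1.2)).comp
      ((phiEquiv Γ p.1.1 p.1.2).symm.toLinearMap.comp
        (res Γ (Finset.HasAntidiagonal.mem_antidiagonal.1 p.2)))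

end

/-! ### The symmetric algebra -/

/-- The odd positive integers. -/
abbrev OddNat : Type := {k : ℕ // Odd k}

/-- The set `Γ^*` of complex irreducible characters of `Γ`. -/
def IrrChar (Γ : Type u) [Group Γ] : Type u :=
  {χ : Γ → ℂ // ∃ (k : ℕ) (ρ : Representation ℂ Γ (Fin k → ℂ)),
    ρ.IsIrreducible ∧ ρ.character = χ}

/-- There are finitely many irreducible characters, since they are linearly independent. -/
instance {Γ : Type u} [Group Γ] [Finite Γ] : Finite (IrrChar Γ) := by
  classical
  have := Fintype.ofFinite Γ
  have hne : (Nat.card Γ : ℂ) ≠ 0 := by exact_mod_cast Nat.card_pos.ne'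
  have : Invertible (Nat.card Γ : ℂ) := invertibleOfNonzero hne
  let B : (Γ → ℂ) →ₗ[ℂ] (Γ → ℂ) →ₗ[ℂ] ℂ := LinearMap.mk₂ ℂ (fun f g => ∑ x, f x * g x⁻¹)
    (by intros; simp [add_mul, Finset.sum_add_distrib])
    (by intros; simp [mul_assoc, Finset.mul_sum])
    (by intros; simp [mul_add, Finset.sum_add_distrib])
    (by intros; simp [mul_left_comm, Finset.mul_sum])
  have hB : ∀ f g, B f g = ∑ x, f x * g x⁻¹ := fun _ _ => rfl
  have hli : LinearIndependent ℂ (fun χ : IrrChar Γ => χ.1) := by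
    refine LinearMap.linearIndependent_of_isOrthoᵢ (B := B) ?_ ?_
    · rintro ⟨χ, k, ρ, hρ, rfl⟩ ⟨χ', k', ρ', hρ', rfl⟩ hχ
      have h := Representation.char_orthonormal ρ ρ'
      rw [if_neg] at h
      · exact (mul_eq_zero.1 h).resolve_left (inv_ne_zero hne)
      · rintro ⟨φ⟩
        exact hχ (Subtype.ext (Representation.char_iso φ).symm)
    · rintro ⟨χ, k, ρ, hρ, rfl⟩ h0
      have h := Representation.char_orthonormal ρ ρ
      rw [if_pos ⟨Representation.Equiv.refl ρ⟩] at h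
      rw [show ∑ g, ρ.character g * ρ.character g⁻¹ = 0 from h0, mul_zero] at h
      exact zero_ne_one h
  exact hli.finite_of_isNoetherian

noncomputable instance {Γ : Type u} [Group Γ] [Finite Γ] : Fintype (IrrChar Γ) :=
  Fintype.ofFinite _

/-- The symmetric algebra `S⁻` on the vector space with basis `a_{-k}(γ)`, for `k` odd positive and
`γ` an irreducible character. Mathlib's bialgebra structure on it is the one for which the elements
of this vector space are primitive. -/
abbrev SGamma (Γ : Type u) [Group Γ] : Type u := SymmetricAlgebra ℂ ((OddNat × IrrChar Γ) →₀ ℂ)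

/-- The antipode of a symmetric algebra, determined by `S (ι x) = - ι x`. -/
noncomputable instance symHopf {M : Type*} [AddCommGroup M] [Module ℂ M] :
    HopfAlgebra ℂ (SymmetricAlgebra ℂ M) where
  antipode := (SymmetricAlgebra.lift (-SymmetricAlgebra.ι ℂ M)).toLinearMap
  mul_antipode_rTensor_comul := by
    have h : (Algebra.TensorProduct.lift (SymmetricAlgebra.lift (-SymmetricAlgebra.ι ℂ M))
        (AlgHom.id ℂ (SymmetricAlgebra ℂ M)) (fun _ _ => Commute.all _ _)).comp
        (Bialgebra.comulAlgHom ℂ (SymmetricAlgebra ℂ M)) =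
        (Algebra.ofId ℂ _).comp (Bialgebra.counitAlgHom ℂ (SymmetricAlgebra ℂ M)) := by
      ext x
      simp [SymmetricAlgebra.algebraMapInv_ι]
    have e : LinearMap.mul' ℂ (SymmetricAlgebra ℂ M) ∘ₗ
        (SymmetricAlgebra.lift (-SymmetricAlgebra.ι ℂ M)).toLinearMap.rTensor _ =
        (Algebra.TensorProduct.lift (SymmetricAlgebra.lift (-SymmetricAlgebra.ι ℂ M))
        (AlgHom.id ℂ (SymmetricAlgebra ℂ M)) (fun _ _ => Commute.all _ _)).toLinearMap := by
      refine TensorProduct.ext' fun a b => ?_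
      simp
    refine LinearMap.ext fun x => ?_
    have hx := DFunLike.congr_fun h x
    exact (LinearMap.congr_fun e _).trans hx
  mul_antipode_lTensor_comul := by
    have h : (Algebra.TensorProduct.lift (AlgHom.id ℂ (SymmetricAlgebra ℂ M))
        (SymmetricAlgebra.lift (-SymmetricAlgebra.ι ℂ M)) (fun _ _ => Commute.all _ _)).comp
        (Bialgebra.comulAlgHom ℂ (SymmetricAlgebra ℂ M)) =
        (Algebra.ofId ℂ _).comp (Bialgebra.counitAlgHom ℂ (SymmetricAlgebra ℂ M)) := by
      ext x
      simp [SymmetricAlgebra.algebraMapInv_ι]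
    have e : LinearMap.mul' ℂ (SymmetricAlgebra ℂ M) ∘ₗ
        (SymmetricAlgebra.lift (-SymmetricAlgebra.ι ℂ M)).toLinearMap.lTensor _ =
        (Algebra.TensorProduct.lift (AlgHom.id ℂ (SymmetricAlgebra ℂ M))
        (SymmetricAlgebra.lift (-SymmetricAlgebra.ι ℂ M))
        (fun _ _ => Commute.all _ _)).toLinearMap := by
      refine TensorProduct.ext' fun a b => ?_
      simp
    refine LinearMap.ext fun x => ?_
    have hx := DFunLike.congr_fun h x
    exact (LinearMap.congr_fun e _).trans hx

/-! ### The characteristic map -/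

section
variable {Γ : Type u} [Group Γ]

/-- The generator `a_{-k}(γ)` for an irreducible character `γ`. -/
noncomputable def aIrr (k : OddNat) (γ : IrrChar Γ) : SGamma Γ :=
  SymmetricAlgebra.ι ℂ _ (Finsupp.single (k, γ) 1)

/-- `a_{-k}(c) = ∑ γ, γ(c⁻¹) a_{-k}(γ)` for a conjugacy class `c`. -/
noncomputable def aClass [Finite Γ] (k : OddNat) (c : ConjClasses Γ) : SGamma Γ :=
  ∑ γ : IrrChar Γ, γ.1 (Quotient.out c)⁻¹ • aIrr k γ

/-- The class of inverses of the elements of a conjugacy class. -/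
def classInv (c : ConjClasses Γ) : ConjClasses Γ :=
  Quotient.map (fun x : Γ => x⁻¹) (fun a b h => by
    obtain ⟨g, hg⟩ := isConj_iff.1 h
    exact isConj_iff.2 ⟨g, by rw [← hg]; group⟩) c

/-- The order `ζ_c` of the centralizer of an element of the conjugacy class `c`. -/
noncomputable def zeta (c : ConjClasses Γ) : ℕ := Nat.card (Subgroup.centralizer {Quotient.out c})

end

/-- Partitions into odd parts. -/
abbrev OddPartition : Type := Multiset OddNat

/-- The size `|μ|`. -/
def psize (μ : OddPartition) : ℕ := (μ.map Subtype.val).sum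

/-- `z_μ = ∏ i ^ m_i * m_i !`. -/
def zPart (μ : OddPartition) : ℕ :=
  ∏ i ∈ μ.toFinset, i.1 ^ μ.count i * (μ.count i).factorial

section
variable (Γ : Type u) [Group Γ] [Finite Γ]

noncomputable instance : Fintype (ConjClasses Γ) := Fintype.ofFinite _

/-- Families, indexed by the conjugacy classes of `Γ`, of partitions with odd parts and total size
`n`. -/
def OPFam (n : ℕ) : Type u := {ρ : ConjClasses Γ → OddPartition // ∑ c, psize (ρ c) = n}

instance (n : ℕ) : Finite (OPFam Γ n) := by
  have hfin : {μ : OddPartition | psize μ ≤ n}.Finite := by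
    have h : (Set.Iic ((n + 1) • Multiset.range (n + 1))).Finite := Set.finite_Iic _
    refine (h.preimage (f := fun μ : OddPartition => μ.map Subtype.val)
      (Multiset.map_injective Subtype.val_injective).injOn).subset ?_
    intro μ hμ
    change Multiset.map Subtype.val μ ≤ _
    have hμ' : (μ.map Subtype.val).sum ≤ n := hμ
    rw [Multiset.le_iff_count]
    intro a
    by_cases ha : a ∈ μ.map Subtype.val
    · have h1 : a ≤ n := (Multiset.single_le_sum (by simp) a ha).trans hμ'
      have h2 : (μ.map Subtype.val).count a ≤ n := by
        refine (Multiset.count_le_card _ _).trans (le_trans ?_ hμ')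
        have := Multiset.card_nsmul_le_sum (s := μ.map Subtype.val) (a := 1) (by
          intro x hx
          obtain ⟨y, _, rfl⟩ := Multiset.mem_map.1 hx
          exact y.2.pos)
        simpa using this
      rw [Multiset.count_nsmul, Multiset.count_eq_one_of_mem (Multiset.nodup_range _)
        (Multiset.mem_range.2 (by omega))]
      omega
    · rw [Multiset.count_eq_zero_of_notMem ha]; exact Nat.zero_le _
  have hpi := Set.Finite.pi (fun _ : ConjClasses Γ => hfin)
  have hsub : {ρ : ConjClasses Γ → OddPartition | ∑ c, psize (ρ c) = n}.Finite := by
    refine hpi.subset fun ρ hρ c _ => ?_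
    have hρ' : ∑ c, psize (ρ c) = n := hρ
    change psize (ρ c) ≤ n
    rw [← hρ']
    exact Finset.single_le_sum (f := fun c => psize (ρ c)) (fun _ _ => Nat.zero_le _)
      (Finset.mem_univ c)
  exact hsub.to_subtype

noncomputable instance (n : ℕ) : Fintype (OPFam Γ n) := Fintype.ofFinite _

end

section
variable {Γ : Type u} [Group Γ] [Finite Γ]

/-- The number `l(ρ)` of parts. -/
noncomputable def plen (ρ : ConjClasses Γ → OddPartition) : ℕ := ∑ c, Multiset.card (ρ c)

/-- `Z_ρ = ∏_c z_{ρ(c)} ζ_c ^ {l(ρ(c))}`. -/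
noncomputable def bigZ (ρ : ConjClasses Γ → OddPartition) : ℕ :=
  ∏ c, zPart (ρ c) * zeta c ^ Multiset.card (ρ c)

/-- `a'_{-ρ} = ∏_c ∏_i a_{-ρ(c)_i}(c)`. -/
noncomputable def aPrime (ρ : ConjClasses Γ → OddPartition) : SGamma Γ :=
  ∏ c, ((ρ c).map fun k => aClass k c).prod

/-- The rows of `ρ`, listed class by class in the order of the enumeration `e`, and in decreasing
order of the length for each class. -/
noncomputable def rows (e : Fin (Nat.card (ConjClasses Γ)) ≃ ConjClasses Γ)
    (ρ : ConjClasses Γ → OddPartition) : List (ConjClasses Γ × ℕ) :=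
  (List.finRange _).flatMap fun j =>
    (((ρ (e j)).map Subtype.val).sort (· ≥ ·)).map fun k => (e j, k)

end

/-- The lift `z ^ ε(k) t_{a+1} t_{a+2} ⋯ t_{a+k-1}` of the `k`-cycle `(a+1, a+2, …, a+k)`. The
exponents `ε` fix the normalization of the lifts: `[a+1, …, a+k] = z ^ (k-1) t_{a+1} ⋯ t_{a+k-1}`
is the case `ε(k) = k - 1`. -/
def cycleLift (ε : ℕ → ℕ) (n a k : ℕ) : SpinGroup n :=
  sz n ^ ε k * ((List.range (k - 1)).map fun j => tgen n (a + j)).prod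

section
variable {Γ : Type u} [Group Γ]

/-- The product of the cycles on consecutive blocks of letters, starting after the first `a`
letters, of lengths given by the list of rows. -/
def blockT (ε : ℕ → ℕ) (n : ℕ) : List (ConjClasses Γ × ℕ) → ℕ → SpinGroup n
  | [], _ => 1
  | (_, k) :: L, a => cycleLift ε n a k * blockT ε n L (a + k)

/-- The element of `Γ^n` (on indices starting from `0`) whose value at the last letter of the block
of a row with class `c` is a representative of `c`, all other values being `1`. Thus the cycle
product over this block lies in `c`. -/
noncomputable def blockG : List (ConjClasses Γ × ℕ) → ℕ → ℕ → Γ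
  | [], _, _ => 1
  | (c, k) :: L, a, i => if i + 1 = a + k then Quotient.out c else blockG L (a + k) i

variable [Finite Γ]

/-- The representative `(g, t^ρ)` of the conjugacy class `D_ρ^+`. -/
noncomputable def classRep (e : Fin (Nat.card (ConjClasses Γ)) ≃ ConjClasses Γ) (ε : ℕ → ℕ)
    {n : ℕ} (ρ : OPFam Γ n) : SpinWreathProduct Γ n :=
  ⟨fun i => blockG (rows e ρ.1) 0 i, blockT ε n (rows e ρ.1) 0⟩

/-- The characteristic map: for `f` of degree `n`,
`ch f = ∑_ρ 2^{l(ρ)/2} / Z_ρ * f(D_ρ^+) a'_{-ρ̄}` where `ρ̄(c) = ρ(c⁻¹)`. -/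
noncomputable def ch (e : Fin (Nat.card (ConjClasses Γ)) ≃ ConjClasses Γ) (ε : ℕ → ℕ) :
    RGamma Γ →ₗ[ℂ] SGamma Γ :=
  DirectSum.toModule ℂ ℕ _ fun n => ∑ ρ : OPFam Γ n,
    ((LinearMap.proj (classRep e ε ρ)).comp (RMinus Γ n).subtype).smulRight
      (((Real.sqrt 2 : ℂ) ^ plen ρ.1 / (bigZ ρ.1 : ℂ)) • aPrime fun c => ρ.1 (classInv c))

end

end SpinWreath

open SpinWreath

/-! Both sides acquire bases indexed by the same families ρ, in which `ch` is diagonal. A family ρ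
is encoded as a multiset of rows (class, odd length), with representative `rowElt`.

The main tool is the inner product formula `average_mul`: the average of f·h over the n-th spin
wreath product is Σ_ρ f(ρ)h(ρ)/Z_ρ. It is proved by induction on n. The cycle through the first
letter of a uniformly random permutation has each length 1,…,n equally often (`sum_perm`). Once that
cycle is brought to a normal form with a single cycle product γ, an average over the remaining
letters is left (`average_eq_sum`), and the recursion `bigZ_cons` for Z_ρ does the bookkeeping. Even
cycle lengths contribute nothing: with the other letters held fixed, f is again a spin super class
function of the first block, and it vanishes there because an even cycle is an odd element.

Signs need care, since elements over conjugate permutations are only conjugate up to z. The kernel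
of the projection to the symmetric group is {1, z} (`eq_one_or_sz`), and z ≠ 1 by a Clifford algebra
model (`sz_ne_one`). Some z^e t^ρ has odd order, whatever lifts of odd cycles were chosen, and an
element of odd order is never conjugate to z times another (`OddOrder.not_conj`). Hence f(ρ) does
not depend on the order of the blocks (`RMinus.listElt_perm`), and no representative is conjugate to
z times itself.

The formula with h the complex conjugate of f shows that f is determined by the values f(ρ)
(`RMinus.eq_zero_of_values`). Cycle statistics separate the representatives, so every ρ has a dual
function (`exists_dual`). On the other side, irreducible characters span the class functions of Γ,
the matrix γ(c⁻¹) is invertible, and the monomials a'_{-ρ̄} form a basis (`monoBasis`). Since the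
coefficients of `ch` are nonzero, `ch` is bijective.

For products, pairing an induced function with a dual function and using Frobenius reciprocity gives
Ind(f⊗g)(s)/Z_s = Σ_{u+t=s} f(u)g(t)/(Z_u Z_t) (`ind_phi_rowElt`). For coproducts, restriction
evaluates f at u+t, while u⊗t occurs Z_s/(Z_u Z_t) times in the coproduct of the monomial s
(`bigZ_mul_count_antidiagonal`). The factor 2^{l/2} is multiplicative in ρ and so is harmless. The
Hopf axioms, antipode included, are then carried over from the symmetric algebra along `ch`
(`isHopfAlgebra_of_linearEquiv`). -/

namespace SpinWreath

/-! ### The kernel of the projection to the symmetric group -/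

/-! ### A Clifford algebra in which z acts as -1. -/

section CliffordModel

/-- The quadratic form `-(1/2) ∑ x_i ^ 2`. -/
noncomputable def cliffordForm (n : ℕ) : QuadraticForm ℝ (Fin n → ℝ) :=
  QuadraticMap.weightedSumSquares ℝ (fun _ : Fin n => (-(1 / 2) : ℝ))

/-- The vector `e_i - e_{i+1}`. -/
noncomputable def simpleRoot {n : ℕ} (i : {i : ℕ // i + 1 < n}) : Fin n → ℝ :=
  Pi.single ⟨i.1, by have := i.2; omega⟩ 1 - Pi.single ⟨i.1 + 1, i.2⟩ 1

theorem cliffordForm_apply {n : ℕ} (v : Fin n → ℝ) :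
    cliffordForm n v = -(1 / 2) * ∑ i, v i * v i := by
  simp [cliffordForm, QuadraticMap.weightedSumSquares_apply, Finset.mul_sum]

theorem polar_cliffordForm {n : ℕ} (v w : Fin n → ℝ) :
    QuadraticMap.polar (cliffordForm n) v w = -∑ i, v i * w i := by
  simp only [QuadraticMap.polar, cliffordForm_apply, Finset.mul_sum, ← Finset.sum_sub_distrib,
    ← Finset.sum_neg_distrib]
  refine Finset.sum_congr rfl fun i _ => ?_
  simp only [Pi.add_apply]; ring

theorem sum_simpleRoot_mul {n : ℕ} (i : {i : ℕ // i + 1 < n}) (w : Fin n → ℝ) :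
    ∑ j, simpleRoot i j * w j = w ⟨i.1, by have := i.2; omega⟩ - w ⟨i.1 + 1, i.2⟩ := by
  simp [simpleRoot, sub_mul, Finset.sum_sub_distrib, Pi.single_apply]

/-- The factor -1/2 in the form is there for this: a simple root has squared length 2, so the form
takes the value -1 on it. -/
theorem ι_simpleRoot_sq {n : ℕ} (i : {i : ℕ // i + 1 < n}) :
    CliffordAlgebra.ι (cliffordForm n) (simpleRoot i) *
      CliffordAlgebra.ι (cliffordForm n) (simpleRoot i) = -1 := by
  have h : cliffordForm n (simpleRoot i) = -1 := by
    rw [cliffordForm_apply, sum_simpleRoot_mul]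
    simp [simpleRoot]
    norm_num
  rw [CliffordAlgebra.ι_sq_scalar, h, map_neg, map_one]

/-- The invertible element of the Clifford algebra attached to a simple root. -/
noncomputable def rootUnit {n : ℕ} (i : {i : ℕ // i + 1 < n}) :
    (CliffordAlgebra (cliffordForm n))ˣ where
  val := CliffordAlgebra.ι (cliffordForm n) (simpleRoot i)
  inv := -CliffordAlgebra.ι (cliffordForm n) (simpleRoot i)
  val_inv := by rw [mul_neg, ι_simpleRoot_sq, neg_neg]
  inv_val := by rw [neg_mul, ι_simpleRoot_sq, neg_neg]

/-- The basic spin representation, with values in the Clifford algebra. -/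
noncomputable def cliffordRep (n : ℕ) : SpinGroup n →* (CliffordAlgebra (cliffordForm n))ˣ :=
  spinLift (-1) rootUnit (by simp)
    (fun i => Units.ext ((sq _).trans (ι_simpleRoot_sq i)))
    (by
      intro i j h
      refine Units.ext ?_
      have hs := CliffordAlgebra.ι_mul_ι_add_swap (Q := cliffordForm n) (simpleRoot i)
        (simpleRoot j)
      rw [polar_cliffordForm, sum_simpleRoot_mul] at hs
      -- Neighbouring roots have inner product -1, so a b + b a = 1. With a² = b² = -1 this gives (a
      -- b)² = a b - 1, hence (a b)³ = -1.
      have hv : -(simpleRoot j ⟨i.1, by have := i.2; omega⟩ - simpleRoot j ⟨i.1 + 1, i.2⟩) = 1 := by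
        simp [simpleRoot, h, show i.1 ≠ i.1 + 1 + 1 by omega]
      rw [hv, map_one] at hs
      have ha := ι_simpleRoot_sq i
      have hb := ι_simpleRoot_sq j
      change (CliffordAlgebra.ι (cliffordForm n) (simpleRoot i) *
        CliffordAlgebra.ι (cliffordForm n) (simpleRoot j)) ^ 3 = -1
      generalize CliffordAlgebra.ι (cliffordForm n) (simpleRoot i) = a at *
      generalize CliffordAlgebra.ι (cliffordForm n) (simpleRoot j) = b at *
      have hba : b * a = 1 - a * b := by rw [← hs]; abel
      have h2 : (a * b) * (a * b) = a * b - 1 := by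
        calc (a * b) * (a * b) = a * (b * a) * b := by simp only [mul_assoc]
          _ = a * b - (a * a) * (b * b) := by rw [hba]; noncomm_ring
          _ = a * b - 1 := by rw [ha, hb]; simp
      rw [pow_succ, sq, h2, sub_mul, h2, one_mul]
      abel)
    (by
      intro i j h
      refine Units.ext ?_
      have hs := CliffordAlgebra.ι_mul_ι_add_swap (Q := cliffordForm n) (simpleRoot i)
        (simpleRoot j)
      rw [polar_cliffordForm, sum_simpleRoot_mul] at hs
      -- Distant roots are orthogonal, so their images anticommute.
      have hv : -(simpleRoot j ⟨i.1, by have := i.2; omega⟩ - simpleRoot j ⟨i.1 + 1, i.2⟩) = 0 := by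
        have h1 : i.1 ≠ j.1 := by omega
        have h2 : i.1 ≠ j.1 + 1 := by omega
        have h3 : i.1 + 1 ≠ j.1 := by omega
        simp [simpleRoot, h1, h2, h3]
      rw [hv, map_zero] at hs
      simpa [rootUnit] using! eq_neg_of_add_eq_zero_left hs)
    (fun i => by simp)

/-- The relations alone do not show that z survives. Its image in the Clifford algebra is the scalar
-1, and scalars embed there because 2 is invertible. -/
theorem sz_ne_one (n : ℕ) : sz n ≠ 1 := by
  intro h
  have h1 := congrArg (cliffordRep n) h
  rw [map_one, cliffordRep, spinLift_sz] at h1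
  have h2 : algebraMap ℝ (CliffordAlgebra (cliffordForm n)) (-1) = algebraMap ℝ _ 1 := by
    simpa using congrArg Units.val h1
  have : Invertible (2 : ℝ) := invertibleOfNonzero (by norm_num)
  exact absurd ((algebraMap ℝ (CliffordAlgebra (cliffordForm n))).injective h2) (by norm_num)

end CliffordModel

/-! ### Normal forms in the spin group and the kernel {1, z}. -/

section Kernel
variable {n : ℕ}

/-- The chains represent the cosets of the smaller subgroup, as for consecutive symmetric groups:
the products of this shape contain 1 and are stable under right multiplication by the generators and
their inverses. -/
theorem chain_normal_form (j : ℕ) (hj : j + 1 < n) {x : SpinGroup n} (hx : x ∈ lowSub n (j + 1)) :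
    ∃ i m, i + m = j + 1 ∧ ∃ k ∈ lowSub n j, k * chain n i m = x := by
  have hz : ∀ x, (∃ i m, i + m = j + 1 ∧ ∃ k ∈ lowSub n j, k * chain n i m = x) →
      ∃ i m, i + m = j + 1 ∧ ∃ k ∈ lowSub n j, k * chain n i m = x * sz n := by
    rintro _ ⟨i, m, hm, k, hk, rfl⟩
    exact ⟨i, m, hm, k * sz n, mul_mem hk (sz_mem j), by rw [mul_assoc, sz_central, mul_assoc]⟩
  have ht : ∀ l < j + 1, ∀ x, (∃ i m, i + m = j + 1 ∧ ∃ k ∈ lowSub n j, k * chain n i m = x) →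
      ∃ i m, i + m = j + 1 ∧ ∃ k ∈ lowSub n j, k * chain n i m = x * tgen n l := by
    rintro l hl _ ⟨i, m, hm, k, hk, rfl⟩
    -- A generator just below the chain lengthens it and one further below passes through it up to
    -- sign. The lowest generator of the chain cancels, and a higher one comes out on the left as
    -- `tgen n (l - 1)`.
    rcases lt_trichotomy l i with h | h | h
    · by_cases h1 : l + 1 = i
      · subst h1
        exact ⟨l, m + 1, by omega, k, hk, by simp only [chain, mul_assoc]⟩
      · obtain ⟨e, he⟩ := chain_comm_low (n := n) (l := l) (m := m) (i := i) (by omega) (by omega)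
        refine ⟨i, m, hm, k * (sz n ^ e * tgen n l),
          mul_mem hk (mul_mem (pow_mem (sz_mem j) e) (tgen_mem (by omega))), ?_⟩
        rw [mul_assoc k (chain n i m), he]; simp only [mul_assoc]
    · subst h
      obtain ⟨m, rfl⟩ : ∃ m', m = m' + 1 := ⟨m - 1, by omega⟩
      refine ⟨l + 1, m, by omega, k * sz n, mul_mem hk (sz_mem j), ?_⟩
      simp only [chain, mul_assoc]
      rw [tgen_sq (by omega), sz_central]
    · obtain ⟨e, he⟩ := chain_comm_mid (n := n) (l := l) (m := m) (i := i) h (by omega) (by omega)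
      refine ⟨i, m, hm, k * (sz n ^ e * tgen n (l - 1)),
        mul_mem hk (mul_mem (pow_mem (sz_mem j) e) (tgen_mem (by omega))), ?_⟩
      rw [mul_assoc k (chain n i m), he]; simp only [mul_assoc]
  induction hx using Subgroup.closure_induction_right with
  | one => exact ⟨j + 1, 0, by omega, 1, one_mem _, by simp [chain]⟩
  | mul_right x _ y hy h =>
    rcases hy with rfl | ⟨i, hi, rfl⟩
    · exact hz _ h
    · exact ht i hi _ h
  | mul_inv_cancel x _ y hy h =>
    rcases hy with rfl | ⟨i, hi, rfl⟩
    · rw [show (sz n)⁻¹ = sz n by rw [inv_eq_iff_mul_eq_one, sz_mul_self]]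
      exact hz _ h
    · rw [show (tgen n i)⁻¹ = sz n * tgen n i by
        rw [inv_eq_iff_mul_eq_one, sz_central, ← mul_assoc, tgen_sq (by omega), sz_mul_self],
        ← mul_assoc]
      exact ht i hi _ (hz _ h)

@[simp] theorem spinToPerm_sz : spinToPerm n (sz n) = 1 := by simp [spinToPerm]

theorem spinToPerm_tgen {i : ℕ} (h : i + 1 < n) :
    spinToPerm n (tgen n i) = Equiv.swap ⟨i, by omega⟩ ⟨i + 1, h⟩ := by
  simp [tgen, h, spinToPerm]

theorem spinToPerm_chain : ∀ (m i : ℕ) (h : i + m < n),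
    spinToPerm n (chain n i m) ⟨i, by omega⟩ = ⟨i + m, h⟩
  | 0, i, h => by simp [chain]
  | m + 1, i, h => by
    rw [chain, map_mul, Equiv.Perm.mul_apply, spinToPerm_tgen (by omega), Equiv.swap_apply_left,
      spinToPerm_chain m (i + 1) (by omega)]
    ext; simp; omega

theorem spinToPerm_lowSub {j : ℕ} {x : SpinGroup n} (hx : x ∈ lowSub n j) (a : Fin n)
    (ha : j < a.1) : spinToPerm n x a = a := by
  induction hx using Subgroup.closure_induction with
  | mem x hx =>
    rcases hx with rfl | ⟨i, hi, rfl⟩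
    · simp
    · rw [spinToPerm_tgen (by have := a.2; omega), Equiv.swap_apply_of_ne_of_ne]
      · intro h; rw [h] at ha; simp at ha; omega
      · intro h; rw [h] at ha; simp at ha; omega
  | one => simp
  | mul x y _ _ hx hy => rw [map_mul, Equiv.Perm.mul_apply, hy, hx]
  | inv x _ hx => rw [map_inv, Equiv.Perm.inv_eq_iff_eq, hx]

theorem lowSub_eq_top : lowSub n (n - 1) = ⊤ := by
  refine top_unique fun x _ => ?_
  refine spin_induction (P := fun x => x ∈ lowSub n (n - 1)) (one_mem _) (sz_mem _) (fun i => ?_)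
    (fun x y hx hy => mul_mem hx hy) x
  have := tgen_mem (n := n) (i := i.1) (j := n - 1) (by have := i.2; omega)
  simpa only [tgen, dif_pos i.2] using this

/-- Induction along the normal form. The chain moves the letter i to j+1, a letter fixed by the
smaller subgroup, so an element acting trivially has an empty chain and already lies in that
subgroup. -/
theorem eq_one_or_sz_of_mem_lowSub : ∀ (j : ℕ), j < n → ∀ {x : SpinGroup n}, x ∈ lowSub n j →
    spinToPerm n x = 1 → x = 1 ∨ x = sz n
  | 0, _, x, hx, _ => by
    have h0 : lowSub n 0 = Subgroup.zpowers (sz n) := by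
      rw [Subgroup.zpowers_eq_closure]; simp [lowSub]
    rw [h0] at hx
    obtain ⟨e, rfl⟩ := hx
    rcases Int.even_or_odd' e with ⟨f, rfl | rfl⟩
    · left; simp [zpow_mul, zpow_ofNat, sz_sq]
    · right; simp [zpow_add, zpow_mul, zpow_ofNat, sz_sq]
  | j + 1, hj, x, hx, h1 => by
    obtain ⟨i, m, hm, k, hk, rfl⟩ := chain_normal_form j hj hx
    have hi : spinToPerm n (k * chain n i m) ⟨i, by omega⟩ = ⟨i, by omega⟩ := by rw [h1]; rfl
    rw [map_mul, Equiv.Perm.mul_apply, spinToPerm_chain m i (by omega),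
      spinToPerm_lowSub hk _ (by simp; omega)] at hi
    have hm0 : m = 0 := by have := congrArg Fin.val hi; simp at this; omega
    subst hm0
    rw [chain, mul_one] at h1 ⊢
    exact eq_one_or_sz_of_mem_lowSub j (by omega) hk h1

theorem eq_one_or_sz {x : SpinGroup n} (h : spinToPerm n x = 1) : x = 1 ∨ x = sz n := by
  rcases Nat.eq_zero_or_pos n with rfl | hn
  · refine spin_induction (P := fun x => x = 1 ∨ x = sz 0) (Or.inl rfl) (Or.inr rfl)
      (fun i => absurd i.2 (by omega)) ?_ x
    rintro x y (rfl | rfl) (rfl | rfl) <;> simp [sz_mul_self]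
  · exact eq_one_or_sz_of_mem_lowSub (n - 1) (by omega) (by rw [lowSub_eq_top]; trivial) h

theorem eq_or_eq_sz_mul {x y : SpinGroup n} (h : spinToPerm n x = spinToPerm n y) :
    x = y ∨ x = sz n * y := by
  rcases eq_one_or_sz (x := x * y⁻¹) (by rw [map_mul, map_inv, h, mul_inv_cancel]) with h | h
  · left; exact mul_inv_eq_one.1 h
  · right; rw [← h, inv_mul_cancel_right]

theorem spinToPerm_surjective (n : ℕ) : Function.Surjective (spinToPerm n) := by
  rcases n with _ | n
  · intro s; exact ⟨1, Subsingleton.elim _ _⟩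
  intro s
  have hs : s ∈ Submonoid.closure
      (Set.range fun i : Fin n => Equiv.swap i.castSucc i.succ) := by
    rw [Equiv.Perm.mclosure_swap_castSucc_succ]; trivial
  refine (Submonoid.closure_le (S := MonoidHom.mrange (spinToPerm (n + 1)))).2 ?_ hs
  rintro _ ⟨i, rfl⟩
  exact ⟨tgen (n + 1) i, spinToPerm_tgen (by have := i.2; omega)⟩

end Kernel

/-! ### Juxtaposition of elements of two spin wreath products -/

section Join
variable {Γ : Type u} [Group Γ] {k l N n : ℕ}

/-- The element acting as `x` on the first `k` indices and as `y` on the last `l` ones. -/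
noncomputable def join (h : k + l = N) (x : SpinWreathProduct Γ k) (y : SpinWreathProduct Γ l) :
    SpinWreathProduct Γ N := prodEmbed Γ h (SpinProd.mk x y)

theorem join_eq (h : k + l = N) (x : SpinWreathProduct Γ k) (y : SpinWreathProduct Γ l) :
    join h x y = wEmbed Γ (a := 0) (by omega) x * wEmbed Γ h.le y := rfl

/-- The inclusion of the first `k` indices. -/
def finFst (h : k + l = N) (i : Fin k) : Fin N := ⟨i.1, by have := i.2; omega⟩

/-- The inclusion of the last `l` indices. -/
def finSnd (h : k + l = N) (i : Fin l) : Fin N := ⟨k + i.1, by have := i.2; omega⟩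

theorem shiftFin_zero (h : k + l = N) (i : Fin k) :
    shiftFin (a := 0) (by omega : 0 + k ≤ N) i = finFst h i :=
  Fin.ext (Nat.zero_add _)

theorem shiftFin_eq_finSnd (h : k + l = N) (i : Fin l) : shiftFin h.le i = finSnd h i := rfl

theorem finFst_or_finSnd (h : k + l = N) (a : Fin N) :
    (∃ i, a = finFst h i) ∨ ∃ j, a = finSnd h j := by
  by_cases ha : a.1 < k
  · exact Or.inl ⟨⟨a.1, ha⟩, rfl⟩
  · exact Or.inr ⟨⟨a.1 - k, by have := a.2; omega⟩, Fin.ext (by simp [finSnd]; omega)⟩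

theorem finFst_ne_finSnd (h : k + l = N) (i : Fin k) (j : Fin l) : finFst h i ≠ finSnd h j := by
  intro e
  have := congrArg Fin.val e
  have := i.2
  simp [finFst, finSnd] at *
  omega

theorem finFst_injective (h : k + l = N) : Function.Injective (finFst h) := fun _ _ e =>
  Fin.ext (congrArg (Fin.val (n := N)) e)

theorem finSnd_injective (h : k + l = N) : Function.Injective (finSnd h) :=
  (shiftFin h.le).injective

theorem spinToPerm_embed_fst (h : k + l = N) (t : SpinGroup k) (i : Fin k) :
    spinToPerm N (spinEmbed (a := 0) (by omega) t) (finFst h i) = finFst h (spinToPerm k t i) := by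
  rw [spinToPerm_spinEmbed, ← shiftFin_zero h, Equiv.Perm.viaEmbedding_apply, shiftFin_zero]

theorem spinToPerm_embed_fst_snd (h : k + l = N) (t : SpinGroup k) (i : Fin l) :
    spinToPerm N (spinEmbed (a := 0) (by omega) t) (finSnd h i) = finSnd h i := by
  rw [spinToPerm_spinEmbed, Equiv.Perm.viaEmbedding_apply_of_notMem]
  rintro ⟨j, hj⟩
  rw [shiftFin_zero h] at hj
  exact finFst_ne_finSnd h _ _ hj

theorem spinToPerm_embed_snd (h : k + l = N) (t : SpinGroup l) (i : Fin l) :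
    spinToPerm N (spinEmbed h.le t) (finSnd h i) = finSnd h (spinToPerm l t i) := by
  rw [spinToPerm_spinEmbed, ← shiftFin_eq_finSnd h, Equiv.Perm.viaEmbedding_apply]; rfl

theorem spinToPerm_embed_snd_fst (h : k + l = N) (t : SpinGroup l) (i : Fin k) :
    spinToPerm N (spinEmbed h.le t) (finFst h i) = finFst h i := by
  rw [spinToPerm_spinEmbed, Equiv.Perm.viaEmbedding_apply_of_notMem]
  rintro ⟨j, hj⟩
  exact finFst_ne_finSnd h _ _ hj.symm

theorem join_right (h : k + l = N) (x : SpinWreathProduct Γ k) (y : SpinWreathProduct Γ l) :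
    (join h x y).right = spinEmbed (a := 0) (by omega) x.right * spinEmbed h.le y.right := rfl

theorem join_perm_fst (h : k + l = N) (x : SpinWreathProduct Γ k) (y : SpinWreathProduct Γ l)
    (i : Fin k) : spinToPerm N (join h x y).right (finFst h i) =
      finFst h (spinToPerm k x.right i) := by
  rw [join_right, map_mul, Equiv.Perm.mul_apply, spinToPerm_embed_snd_fst, spinToPerm_embed_fst]

theorem join_perm_snd (h : k + l = N) (x : SpinWreathProduct Γ k) (y : SpinWreathProduct Γ l)
    (i : Fin l) : spinToPerm N (join h x y).right (finSnd h i) =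
      finSnd h (spinToPerm l y.right i) := by
  rw [join_right, map_mul, Equiv.Perm.mul_apply, spinToPerm_embed_snd, spinToPerm_embed_fst_snd]

theorem join_left (h : k + l = N) (x : SpinWreathProduct Γ k) (y : SpinWreathProduct Γ l)
    (a : Fin N) : (join h x y).left a =
      Function.extend (shiftFin (a := 0) (by omega : 0 + k ≤ N)) x.left 1 a *
        Function.extend (shiftFin h.le) y.left 1
          ((spinToPerm N (spinEmbed (a := 0) (by omega) x.right))⁻¹ a) := rfl

theorem join_left_fst (h : k + l = N) (x : SpinWreathProduct Γ k) (y : SpinWreathProduct Γ l)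
    (i : Fin k) : (join h x y).left (finFst h i) = x.left i := by
  rw [join_left, ← map_inv, ← map_inv, spinToPerm_embed_fst, ← shiftFin_zero h,
    (shiftFin _).injective.extend_apply, Function.extend_apply', Pi.one_apply, mul_one]
  rintro ⟨j, hj⟩
  exact finFst_ne_finSnd h _ _ hj.symm

theorem join_left_snd (h : k + l = N) (x : SpinWreathProduct Γ k) (y : SpinWreathProduct Γ l)
    (i : Fin l) : (join h x y).left (finSnd h i) = y.left i := by
  rw [join_left, ← map_inv, ← map_inv, spinToPerm_embed_fst_snd, Function.extend_apply',
    ← shiftFin_eq_finSnd h, (shiftFin _).injective.extend_apply, Pi.one_apply, one_mul]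
  rintro ⟨j, hj⟩
  rw [shiftFin_zero h] at hj
  exact finFst_ne_finSnd h _ _ hj

theorem par_join (h : k + l = N) (x : SpinWreathProduct Γ k) (y : SpinWreathProduct Γ l) :
    par (join h x y) = par x + par y := par_mk_wEmbed h x y

/-- This is what makes inductions on the number of letters possible. It holds for y of either
parity, the slice being zero when y is odd. -/
theorem slice_fst (h : k + l = N) (f : RMinus Γ N) (y : SpinWreathProduct Γ l) :
    (fun x => f.1 (join h x y)) ∈ RMinus Γ k := slice_left (res Γ h f) y

theorem slice_snd (h : k + l = N) (f : RMinus Γ N) (x : SpinWreathProduct Γ k) :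
    (fun y => f.1 (join h x y)) ∈ RMinus Γ l := slice_right (res Γ h f) x

theorem wz_mul_left (x : SpinWreathProduct Γ n) : (wz Γ n * x).left = x.left := by
  funext i
  change (1 : Γ) * x.left ((spinToPerm n (sz n))⁻¹ i) = _
  simp

theorem wz_mul_right (x : SpinWreathProduct Γ n) : (wz Γ n * x).right = sz n * x.right := rfl

theorem eq_or_eq_wz_mul {x y : SpinWreathProduct Γ n} (h1 : x.left = y.left)
    (h2 : spinToPerm n x.right = spinToPerm n y.right) : x = y ∨ x = wz Γ n * y := by
  rcases eq_or_eq_sz_mul h2 with h | h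
  · exact Or.inl (SemidirectProduct.ext h1 h)
  · exact Or.inr (SemidirectProduct.ext (by rw [wz_mul_left, h1]) h)

theorem conj_inr_left (t : SpinGroup n) (x : SpinWreathProduct Γ n) (i : Fin n) :
    (SemidirectProduct.inr t * x * (SemidirectProduct.inr t)⁻¹ : SpinWreathProduct Γ n).left i =
      x.left ((spinToPerm n t)⁻¹ i) := by
  rw [← map_inv]
  simp [wreathAction_apply]

theorem conj_inr_right (t : SpinGroup n) (x : SpinWreathProduct Γ n) :
    (SemidirectProduct.inr t * x * (SemidirectProduct.inr t)⁻¹ : SpinWreathProduct Γ n).right =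
      t * x.right * t⁻¹ := rfl

/-- Conjugation by a lift of the permutation exchanging two blocks. -/
theorem exists_conj_join_swap (h : k + l = N) (h' : l + k = N) (x : SpinWreathProduct Γ k)
    (y : SpinWreathProduct Γ l) : ∃ w : SpinWreathProduct Γ N,
      w * join h x y * w⁻¹ = join h' y x ∨ w * join h x y * w⁻¹ = wz Γ N * join h' y x := by
  obtain ⟨t, ht⟩ := spinToPerm_surjective N
    ((finCongr h.symm).trans (finAddFlip.trans (finCongr h')))
  have h1 : ∀ i, spinToPerm N t (finFst h i) = finSnd h' i := by
    intro i
    rw [ht]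
    have : finCongr h.symm (finFst h i) = Fin.castAdd l i := rfl
    simp only [Equiv.trans_apply, this, finAddFlip_apply_castAdd]
    rfl
  have h2 : ∀ i, spinToPerm N t (finSnd h i) = finFst h' i := by
    intro i
    rw [ht]
    have : finCongr h.symm (finSnd h i) = Fin.natAdd k i := rfl
    simp only [Equiv.trans_apply, this, finAddFlip_apply_natAdd]
    rfl
  have key : ∀ a : Fin N, ∃ b, a = spinToPerm N t b := fun a => ⟨(spinToPerm N t)⁻¹ a, by simp⟩
  have hinv : ∀ b, (spinToPerm N t)⁻¹ (spinToPerm N t b) = b := fun b =>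
    Equiv.Perm.inv_eq_iff_eq.2 rfl
  refine ⟨SemidirectProduct.inr t, eq_or_eq_wz_mul (funext fun a => ?_) (Equiv.ext fun a => ?_)⟩
  · obtain ⟨b, rfl⟩ := key a
    rw [conj_inr_left, hinv]
    rcases finFst_or_finSnd h b with ⟨i, rfl⟩ | ⟨i, rfl⟩
    · rw [h1, join_left_fst, join_left_snd]
    · rw [h2, join_left_fst, join_left_snd]
  · obtain ⟨b, rfl⟩ := key a
    rw [conj_inr_right, map_mul, map_mul, map_inv, Equiv.Perm.mul_apply, Equiv.Perm.mul_apply,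
      hinv]
    rcases finFst_or_finSnd h b with ⟨i, rfl⟩ | ⟨i, rfl⟩
    · rw [h1, join_perm_fst, join_perm_snd, h1]
    · rw [h2, join_perm_fst, join_perm_snd, h2]

end Join

/-! ### Elements of odd order up to the central involution -/

section OddOrder
variable {Γ : Type u} [Group Γ] {k l N n : ℕ}

theorem sz_pow_odd {m : ℕ} (hm : Odd m) : sz n ^ m = sz n := by
  obtain ⟨r, rfl⟩ := hm
  rw [pow_succ, pow_mul, sz_sq, one_pow, one_mul]

/-- `z ^ e * t` has odd order. -/
def OddOrder (e : ℕ) (t : SpinGroup n) : Prop := ∃ M, Odd M ∧ (sz n ^ e * t) ^ M = 1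

theorem commute_sz_pow (e : ℕ) (t : SpinGroup n) : Commute (sz n ^ e) t :=
  Commute.pow_left (sz_central t) e

/-- A conjugate of an element of odd order has odd order, whereas z times an element of odd order
does not, as z is central of order two. The exponent e must be the same on both sides, otherwise the
two signs are not comparable. -/
theorem OddOrder.not_conj {e : ℕ} {t t' : SpinGroup n} (h : OddOrder e t) (h' : OddOrder e t')
    (w : SpinGroup n) : w * t * w⁻¹ ≠ sz n * t' := by
  intro hw
  obtain ⟨M, hM, hp⟩ := h
  obtain ⟨M', hM', hp'⟩ := h'
  have e1 : w * (sz n ^ e * t) * w⁻¹ = sz n * (sz n ^ e * t') := by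
    rw [← mul_assoc w, ← (commute_sz_pow e w).eq, mul_assoc (sz n ^ e), mul_assoc (sz n ^ e), hw,
      ← mul_assoc, ← mul_assoc, ← pow_succ, ← pow_succ']
  have e2 : (w * (sz n ^ e * t) * w⁻¹) ^ (M * M') = 1 := by
    rw [conj_pow, pow_mul, hp, one_pow, mul_one, mul_inv_cancel]
  rw [e1, (show Commute (sz n) (sz n ^ e * t') from sz_central _).mul_pow, mul_comm M, pow_mul _ M',
    pow_mul _ M', hp', one_pow, mul_one, ← pow_mul] at e2
  rw [sz_pow_odd (hM'.mul hM)] at e2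
  exact sz_ne_one n e2

/-- As x is even, the sign in the commutation rule disappears and the two blocks commute, so the
product of the two odd exponents kills both. -/
theorem OddOrder.join {e e' : ℕ} (h : k + l = N) {x : SpinWreathProduct Γ k}
    {y : SpinWreathProduct Γ l} (hx0 : par x = 0) (hx : OddOrder e x.right)
    (hy : OddOrder e' y.right) : OddOrder (e + e') (join h x y).right := by
  obtain ⟨M, hM, hp⟩ := hx
  obtain ⟨M', hM', hp'⟩ := hy
  refine ⟨M * M', hM.mul hM', ?_⟩
  have hc := congrArg SemidirectProduct.right (wEmbed_comm h.le y x)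
  rw [hx0, mul_zero, zpar_zero, mul_one] at hc
  have hz : ∀ {a k} (h : a + k ≤ N), spinEmbed h (sz k) = sz N := fun h => by simp [spinEmbed]
  have a1 := congrArg (spinEmbed (a := 0) (by omega : 0 + k ≤ N)) hp
  have a2 := congrArg (spinEmbed h.le) hp'
  rw [map_one, map_pow, map_mul, map_pow, hz] at a1 a2
  rw [join_right]
  have hc' : Commute (spinEmbed (a := 0) (by omega : 0 + k ≤ N) x.right)
    (spinEmbed h.le y.right) := hc.symm
  generalize spinEmbed (a := 0) (by omega : 0 + k ≤ N) x.right = A at *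
  generalize spinEmbed h.le y.right = B at *
  have hcc : Commute (sz N ^ e * A) (sz N ^ e' * B) :=
    (commute_sz_pow e _).mul_left (((commute_sz_pow e' _).symm).mul_right hc')
  have e3 : sz N ^ (e + e') * (A * B) = (sz N ^ e * A) * (sz N ^ e' * B) := by
    rw [pow_add, mul_assoc, ← mul_assoc _ A, (commute_sz_pow e' A).eq]; simp only [mul_assoc]
  rw [e3, hcc.mul_pow, pow_mul, a1, one_pow, mul_comm M, pow_mul, a2, one_pow, mul_one]

end OddOrder

/-! ### Lifts of cycles -/

section Cycles
variable {n : ℕ}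

theorem spinToPerm_prod_tgen (a : ℕ) : ∀ (j : ℕ) (_ : a + j < n) (b : Fin n),
    (spinToPerm n ((List.range j).map fun i => tgen n (a + i)).prod b).1 =
      if a ≤ b.1 ∧ b.1 < a + j then b.1 + 1 else if b.1 = a + j then a else b.1
  | 0, h, b => by
    simp only [List.range_zero, List.map_nil, List.prod_nil, map_one, Equiv.Perm.one_apply]
    split_ifs <;> omega
  | j + 1, h, b => by
    rw [List.range_succ, List.map_append, List.prod_append, map_mul, Equiv.Perm.mul_apply,
      spinToPerm_prod_tgen a j (by omega)]
    have h1 : (spinToPerm n (List.map (fun i => tgen n (a + i)) [j]).prod b).1 =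
        if b.1 = a + j then a + j + 1 else if b.1 = a + j + 1 then a + j else b.1 := by
      simp only [List.map_cons, List.map_nil, List.prod_cons, List.prod_nil, mul_one]
      rw [spinToPerm_tgen (by omega), Equiv.swap_apply_def]
      split_ifs <;> simp_all [Fin.ext_iff]
    rw [h1]
    split_ifs <;> omega

theorem spinToPerm_cycleLift (ε : ℕ → ℕ) (a k : ℕ) (hk : 0 < k) (h : a + k ≤ n) (b : Fin n) :
    (spinToPerm n (cycleLift ε n a k) b).1 =
      if a ≤ b.1 ∧ b.1 + 1 < a + k then b.1 + 1 else if b.1 + 1 = a + k then a else b.1 := by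
  rw [cycleLift, map_mul, map_pow, spinToPerm_sz, one_pow, one_mul,
    spinToPerm_prod_tgen a (k - 1) (by omega)]
  split_ifs <;> omega

theorem spinToPerm_cycleLift_full (ε : ℕ → ℕ) (k : ℕ) (b : Fin k) :
    (spinToPerm k (cycleLift ε k 0 k) b).1 = (b.1 + 1) % k := by
  have := b.2
  rw [spinToPerm_cycleLift ε 0 k (by omega) (by omega)]
  split_ifs with h1 h2
  · rw [Nat.mod_eq_of_lt (by omega)]
  · rw [show b.1 + 1 = k by omega, Nat.mod_self]
  · omega

theorem spinToPerm_cycleLift_pow (ε : ℕ → ℕ) (k j : ℕ) (b : Fin k) :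
    ((spinToPerm k (cycleLift ε k 0 k) ^ j) b).1 = (b.1 + j) % k := by
  induction j with
  | zero => simp [Nat.mod_eq_of_lt b.2]
  | succ j ih =>
    rw [pow_succ', Equiv.Perm.mul_apply, spinToPerm_cycleLift_full, ih, Nat.mod_add_mod, add_assoc]

/-- The k-th power of a lift is 1 or z, and as k is odd, multiplying the lift by z exchanges the two
cases. This is why the exponents ε may be arbitrary. -/
theorem oddOrder_cycleLift (ε : ℕ → ℕ) (k : ℕ) (hk : Odd k) :
    ∃ e, OddOrder e (cycleLift ε k 0 k) := by
  have h : spinToPerm k (cycleLift ε k 0 k ^ k) = 1 := by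
    rw [map_pow]
    refine Equiv.ext fun b => Fin.ext ?_
    rw [spinToPerm_cycleLift_pow, Nat.add_mod_right, Nat.mod_eq_of_lt b.2]; rfl
  rcases eq_one_or_sz h with h | h
  · exact ⟨0, k, hk, by simpa using h⟩
  · refine ⟨1, k, hk, ?_⟩
    rw [(commute_sz_pow 1 _).mul_pow, h, pow_one]
    rw [sz_pow_odd hk, sz_mul_self]

theorem spinEmbed_tgen {a k N : ℕ} (h : a + k ≤ N) {i : ℕ} (hi : i + 1 < k) :
    spinEmbed h (tgen k i) = tgen N (a + i) := by
  have h' : a + i + 1 < N := by omega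
  simp [tgen, hi, h', spinEmbed]

theorem spinEmbed_cycleLift (ε : ℕ → ℕ) {a b k l N : ℕ} (h : a + l ≤ N) (hb : b + k ≤ l) :
    spinEmbed h (cycleLift ε l b k) = cycleLift ε N (a + b) k := by
  rw [cycleLift, cycleLift, map_mul, map_pow, map_list_prod, List.map_map]
  have hz : spinEmbed h (sz l) = sz N := by simp [spinEmbed]
  rw [hz]
  congr 2
  · refine List.map_congr_left fun j hj => ?_
    have := List.mem_range.1 hj
    rw [Function.comp_apply, spinEmbed_tgen h (by omega), add_assoc]

end Cycles

/-! ### Elements attached to lists of rows -/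

section Lists
variable {Γ : Type u} [Group Γ] {k l N n : ℕ}

/-- The total length of a list of rows. -/
def listSize (L : List (ConjClasses Γ × ℕ)) : ℕ := (L.map Prod.snd).sum

@[simp] theorem listSize_nil : listSize ([] : List (ConjClasses Γ × ℕ)) = 0 := rfl

@[simp] theorem listSize_cons (a : ConjClasses Γ × ℕ) (L : List (ConjClasses Γ × ℕ)) :
    listSize (a :: L) = a.2 + listSize L := by simp [listSize]

/-- The element `(g, t)` attached to a list of rows. -/
noncomputable def listElt (ε : ℕ → ℕ) (n : ℕ) (L : List (ConjClasses Γ × ℕ)) :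
    SpinWreathProduct Γ n := ⟨fun i => blockG L 0 i, blockT ε n L 0⟩

/-- The element with cycle product `γ` over the lift of the full cycle. -/
noncomputable def cycElt (ε : ℕ → ℕ) (k : ℕ) (γ : Γ) : SpinWreathProduct Γ k :=
  ⟨fun i => if i.1 + 1 = k then γ else 1, cycleLift ε k 0 k⟩

theorem listElt_singleton (ε : ℕ → ℕ) (c : ConjClasses Γ) (k : ℕ) :
    listElt ε k [(c, k)] = cycElt ε k (Quotient.out c) := by
  refine SemidirectProduct.ext (funext fun i => ?_) ?_
  · simp [listElt, cycElt, blockG]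
  · simp [listElt, cycElt, blockT]

theorem blockT_append (ε : ℕ → ℕ) (n : ℕ) (L' : List (ConjClasses Γ × ℕ)) :
    ∀ (L : List (ConjClasses Γ × ℕ)) (a : ℕ),
      blockT ε n (L ++ L') a = blockT ε n L a * blockT ε n L' (a + listSize L)
  | [], a => by simp [blockT]
  | (c, k) :: L, a => by
    rw [List.cons_append, blockT, blockT, blockT_append ε n L' L, mul_assoc, listSize_cons,
      add_assoc]

theorem spinEmbed_blockT (ε : ℕ → ℕ) {a l N : ℕ} (h : a + l ≤ N) :
    ∀ (L : List (ConjClasses Γ × ℕ)) (b : ℕ), b + listSize L ≤ l →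
      spinEmbed h (blockT ε l L b) = blockT ε N L (a + b)
  | [], b, _ => by simp [blockT]
  | (c, k) :: L, b, hb => by
    rw [listSize_cons] at hb
    simp only at hb
    rw [blockT, blockT, map_mul, spinEmbed_cycleLift ε h (by omega),
      spinEmbed_blockT ε h L _ (by omega), add_assoc]

theorem blockG_of_lt : ∀ (L : List (ConjClasses Γ × ℕ)) (_ : ∀ p ∈ L, 0 < p.2) (a i : ℕ),
    i < a → blockG L a i = 1
  | [], _, a, i, _ => rfl
  | (c, k) :: L, hL, a, i, h => by
    have hk : 0 < k := hL (c, k) (by simp)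
    rw [blockG, if_neg (by omega),
      blockG_of_lt L (fun p hp => hL p (List.mem_cons_of_mem _ hp)) _ _ (by omega)]

theorem blockG_add : ∀ (L : List (ConjClasses Γ × ℕ)) (a b i : ℕ),
    blockG L (a + b) (a + i) = blockG L b i
  | [], a, b, i => rfl
  | (c, k) :: L, a, b, i => by
    rw [blockG, blockG, add_assoc a b k, blockG_add L]
    have : a + i + 1 = a + (b + k) ↔ i + 1 = b + k := by omega
    simp only [this]

theorem blockG_append (L' : List (ConjClasses Γ × ℕ)) (hL' : ∀ p ∈ L', 0 < p.2) :
    ∀ (L : List (ConjClasses Γ × ℕ)) (a i : ℕ), blockG (L ++ L') a i =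
      if i < a + listSize L then blockG L a i else blockG L' (a + listSize L) i
  | [], a, i => by
    simp only [List.nil_append, listSize_nil, add_zero]
    split_ifs with h
    · exact blockG_of_lt L' hL' a i h
    · rfl
  | (c, k) :: L, a, i => by
    rw [List.cons_append, blockG, blockG, blockG_append L' hL' L, listSize_cons]
    simp only [add_assoc]
    split_ifs <;> first | rfl | omega

theorem listElt_append (ε : ℕ → ℕ) (h : k + l = N) {L L' : List (ConjClasses Γ × ℕ)}
    (hL : listSize L = k) (hL' : listSize L' = l) (hpos : ∀ p ∈ L', 0 < p.2) :
    listElt ε N (L ++ L') = join h (listElt ε k L) (listElt ε l L') := by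
  refine SemidirectProduct.ext (funext fun a => ?_) ?_
  · rcases finFst_or_finSnd h a with ⟨i, rfl⟩ | ⟨i, rfl⟩
    · rw [join_left_fst]
      simp only [listElt, blockG_append L' hpos, zero_add, finFst]
      rw [if_pos (by rw [hL]; exact i.2)]
    · rw [join_left_snd]
      simp only [listElt, blockG_append L' hpos, zero_add, finSnd]
      rw [if_neg (by omega), hL]
      exact blockG_add L' k 0 i
  · rw [join_right]
    simp only [listElt]
    rw [blockT_append, spinEmbed_blockT _ _ _ _ (by omega), spinEmbed_blockT _ _ _ _ (by omega), hL]
    simp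

theorem par_cycElt_eq (ε : ℕ → ℕ) {k : ℕ} (hk : 0 < k) (γ : Γ) :
    par (cycElt ε k γ) = ((k - 1 : ℕ) : ZMod 2) := by
  have h1 : ∀ j, j < k → (spinParity k ((List.range j).map fun i => tgen k (0 + i)).prod) =
      Multiplicative.ofAdd (j : ZMod 2) := by
    intro j
    induction j with
    | zero => simp
    | succ j ih =>
      intro hj
      rw [List.range_succ, List.map_append, List.prod_append, map_mul, ih (by omega)]
      simp [tgen, hj, spinParity]
  change (spinParity k (cycleLift ε k 0 k)).toAdd = _
  rw [cycleLift, map_mul, h1 _ (by omega)]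
  simp [spinParity]

theorem par_cycElt (ε : ℕ → ℕ) {k : ℕ} (hk : Odd k) (γ : Γ) : par (cycElt ε k γ) = 0 := by
  rw [par_cycElt_eq ε hk.pos, ZMod.natCast_eq_zero_iff_even]
  exact Nat.Odd.sub_odd hk odd_one

/-- The exponent serves all γ at once, because only the spin component enters. `OddOrder.not_conj`
needs such a common exponent. -/
theorem oddOrder_cycElt (ε : ℕ → ℕ) {k : ℕ} (hk : Odd k) :
    ∃ e, ∀ γ : Γ, OddOrder e (cycElt ε k γ).right :=
  (oddOrder_cycleLift ε k hk).imp fun _ h _ => h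

theorem listElt_cons (ε : ℕ → ℕ) {c : ConjClasses Γ} {L : List (ConjClasses Γ × ℕ)}
    (h : k + listSize L = N) (hpos : ∀ p ∈ L, 0 < p.2) : listElt ε N ((c, k) :: L) =
      join h (cycElt ε k (Quotient.out c)) (listElt ε (listSize L) L) := by
  rw [← listElt_singleton, ← listElt_append ε h (by simp) rfl hpos]; rfl

theorem par_listElt (ε : ℕ → ℕ) : ∀ (L : List (ConjClasses Γ × ℕ)), (∀ p ∈ L, Odd p.2) →
    par (listElt ε (listSize L) L) = 0
  | [], _ => by
    have : listElt ε 0 ([] : List (ConjClasses Γ × ℕ)) = 1 := rfl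
    rw [listSize_nil, this, par_one]
  | (c, k) :: L, hL => by
    have hL' : ∀ p ∈ L, Odd p.2 := fun p hp => hL p (List.mem_cons_of_mem _ hp)
    rw [listElt_cons ε (listSize_cons (c, k) L).symm (fun p hp => (hL' p hp).pos), par_join,
      par_cycElt ε (hL (c, k) (by simp)), par_listElt ε L hL', add_zero]

theorem oddOrder_listElt (ε : ℕ → ℕ) : ∀ (L : List (ConjClasses Γ × ℕ)), (∀ p ∈ L, Odd p.2) →
    ∃ e, OddOrder e (listElt ε (listSize L) L).right
  | [], _ => ⟨0, 1, odd_one, by simp only [listElt, blockT, mul_one, pow_zero, pow_one]⟩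
  | (c, k) :: L, hL => by
    have hL' : ∀ p ∈ L, Odd p.2 := fun p hp => hL p (List.mem_cons_of_mem _ hp)
    have hk : Odd k := hL (c, k) (by simp)
    obtain ⟨e, he⟩ := oddOrder_cycElt (Γ := Γ) ε hk
    obtain ⟨e', he'⟩ := oddOrder_listElt ε L hL'
    rw [listElt_cons ε (listSize_cons (c, k) L).symm (fun p hp => (hL' p hp).pos)]
    exact ⟨e + e', OddOrder.join _ (par_cycElt ε hk _) (he _) he'⟩

theorem RMinus.conj_eq (f : RMinus Γ n) {x y : SpinWreathProduct Γ n}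
    (h : ∃ w, w * x * w⁻¹ = y) : f.1 x = f.1 y := by
  obtain ⟨w, rfl⟩ := h
  exact (f.2.1 w x).symm

/-- Exchanging the blocks is a conjugation up to z. Both arrangements become of odd order after
multiplication by the same power of z, so the sign -1 is excluded. -/
theorem RMinus.join_cycElt_swap (ε : ℕ → ℕ) (h : k + l = N) (h' : l + k = N) (hk : Odd k)
    (hl : Odd l) (f : RMinus Γ N) (γ δ : Γ) :
    f.1 (join h (cycElt ε k γ) (cycElt ε l δ)) = f.1 (join h' (cycElt ε l δ) (cycElt ε k γ)) := by
  obtain ⟨w, hw | hw⟩ := exists_conj_join_swap h h' (cycElt ε k γ) (cycElt ε l δ)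
  · exact RMinus.conj_eq f ⟨w, hw⟩
  · obtain ⟨e, he⟩ := oddOrder_cycElt (Γ := Γ) ε hk
    obtain ⟨e', he'⟩ := oddOrder_cycElt (Γ := Γ) ε hl
    have h1 := OddOrder.join h (par_cycElt ε hk γ) (he γ) (he' δ)
    have h2 := OddOrder.join h' (par_cycElt ε hl δ) (he' δ) (he γ)
    rw [add_comm] at h2
    exact absurd (congrArg SemidirectProduct.right hw) (h1.not_conj h2 w.right)

/-- Conjugation by a constant tuple leaves the spin component alone, since permuting the indices
fixes such a tuple. -/
theorem RMinus.cycElt_conj (ε : ℕ → ℕ) (f : RMinus Γ k) {γ δ : Γ} (h : IsConj γ δ) :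
    f.1 (cycElt ε k γ) = f.1 (cycElt ε k δ) := by
  obtain ⟨a, rfl⟩ := isConj_iff.1 h
  refine RMinus.conj_eq f ⟨SemidirectProduct.inl fun _ => a, ?_⟩
  rw [← map_inv]
  refine SemidirectProduct.ext (funext fun i => ?_) ?_
  · simp only [SemidirectProduct.mul_left, SemidirectProduct.left_inl, Pi.mul_apply,
      SemidirectProduct.mul_right, SemidirectProduct.right_inl, map_one, MulAut.one_apply,
      wreathAction_apply, Pi.inv_apply, one_mul]
    by_cases hi : i.1 + 1 = k <;> simp [cycElt, hi]
  · simp; rfl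

/-- The value of f depends only on the multiset of rows. The quantification over all n and f is
inside the induction, because the induction hypothesis is applied to a slice of f with fewer
letters. -/
theorem RMinus.listElt_perm (ε : ℕ → ℕ) {L L' : List (ConjClasses Γ × ℕ)} (h : L.Perm L') :
    ∀ (n : ℕ) (f : RMinus Γ n), (∀ p ∈ L, Odd p.2) → listSize L = n →
      f.1 (listElt ε n L) = f.1 (listElt ε n L') := by
  induction h with
  | nil => intros; rfl
  | @cons a L L' h ih =>
    intro n f hL hn
    obtain ⟨c, k⟩ := a
    have hs : listSize L = listSize L' := (h.map Prod.snd).sum_eq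
    have hodd : ∀ p ∈ L, Odd p.2 := fun p hp => hL p (List.mem_cons_of_mem _ hp)
    rw [listSize_cons] at hn
    rw [listElt_cons ε hn (fun p hp => (hodd p hp).pos),
      listElt_cons ε (hs ▸ hn) (fun p hp => (hodd p (h.mem_iff.2 hp)).pos)]
    have := ih _ ⟨_, slice_snd hn f (cycElt ε k (Quotient.out c))⟩ hodd rfl
    simp only at this
    rw [this]
    congr! 3
  | swap a b L =>
    intro n f hL hn
    obtain ⟨c, k⟩ := a
    obtain ⟨d, l⟩ := b
    have hk : Odd k := hL (c, k) (by simp)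
    have hl : Odd l := hL (d, l) (by simp)
    have hodd : ∀ p ∈ L, 0 < p.2 := fun p hp => (hL p (by simp [hp])).pos
    rw [listSize_cons, listSize_cons] at hn
    have hn' : (l + k) + listSize L = n := by rw [← hn]; exact add_assoc _ _ _
    have e1 := listElt_append ε hn' (L := [(d, l), (c, k)]) (L' := L) (by simp) rfl hodd
    have e2 := listElt_append ε hn' (L := [(c, k), (d, l)]) (L' := L) (by simp [add_comm]) rfl hodd
    simp only [List.cons_append, List.nil_append] at e1 e2
    rw [e1, e2]
    have e3 : listElt ε (l + k) [(d, l), (c, k)] =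
        join rfl (cycElt ε l (Quotient.out d)) (cycElt ε k (Quotient.out c)) := by
      rw [← listElt_singleton, ← listElt_singleton]
      exact listElt_append ε rfl (L := [(d, l)]) (L' := [(c, k)]) (by simp) (by simp)
        (by simp [hk.pos])
    have e4 : listElt ε (l + k) [(c, k), (d, l)] =
        join (add_comm k l) (cycElt ε k (Quotient.out c)) (cycElt ε l (Quotient.out d)) := by
      rw [← listElt_singleton, ← listElt_singleton]
      exact listElt_append ε _ (L := [(c, k)]) (L' := [(d, l)]) (by simp) (by simp)
        (by simp [hl.pos])
    rw [e3, e4]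
    exact RMinus.join_cycElt_swap ε rfl (add_comm k l) hl hk
      ⟨_, slice_fst hn' f (listElt ε (listSize L) L)⟩ _ _
  | @trans L₁ L₂ L₃ h1 h2 ih1 ih2 =>
    intro n f hL hn
    rw [ih1 n f hL hn]
    exact ih2 n f (fun p hp => hL p (h1.mem_iff.2 hp))
      (by rw [← hn]; exact ((h1.map Prod.snd).sum_eq).symm)

end Lists

/-! ### Summation of class functions over a spin wreath product -/

/-! ### The cycle through the first letter of a permutation. -/

section PermRecursion
variable {n : ℕ}

/-- Permutations of the last `m` letters. -/
noncomputable def permSnd {a m : ℕ} (h : a + m = n) (e : Equiv.Perm (Fin m)) :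
    Equiv.Perm (Fin n) := e.viaEmbedding (shiftFin h.le)

theorem permSnd_finSnd {a m : ℕ} (h : a + m = n) (e : Equiv.Perm (Fin m)) (i : Fin m) :
    permSnd h e (finSnd h i) = finSnd h (e i) := Equiv.Perm.viaEmbedding_apply _ _ _

theorem permSnd_finFst {a m : ℕ} (h : a + m = n) (e : Equiv.Perm (Fin m)) (i : Fin a) :
    permSnd h e (finFst h i) = finFst h i :=
  Equiv.Perm.viaEmbedding_apply_of_notMem _ _ _ (by
    rintro ⟨j, hj⟩
    exact finFst_ne_finSnd h _ _ hj.symm)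

theorem permSnd_mul {a m : ℕ} (h : a + m = n) (e e' : Equiv.Perm (Fin m)) :
    permSnd h (e * e') = permSnd h e * permSnd h e' :=
  (Equiv.Perm.viaEmbeddingHom (shiftFin h.le)).map_mul e e'

theorem permSnd_inv {a m : ℕ} (h : a + m = n) (e : Equiv.Perm (Fin m)) :
    permSnd h e⁻¹ = (permSnd h e)⁻¹ := (Equiv.Perm.viaEmbeddingHom (shiftFin h.le)).map_inv e

/-- The cycle on the first `j + 1` letters. -/
def initCycle (n j : ℕ) : Equiv.Perm (Fin n) :=
  spinToPerm n ((List.range j).map fun i => tgen n (0 + i)).prod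

theorem initCycle_of_lt (j : ℕ) (h : j < n) (b : Fin n) (hb : j < b.1) : initCycle n j b = b := by
  refine Fin.ext ?_
  rw [initCycle, spinToPerm_prod_tgen 0 j (by omega), if_neg (by omega), if_neg (by omega)]

theorem initCycle_succ (j : ℕ) (h : j + 1 < n) :
    initCycle n (j + 1) = initCycle n j * Equiv.swap ⟨j, by omega⟩ ⟨j + 1, h⟩ := by
  simp only [initCycle, zero_add]
  rw [List.range_succ, List.map_append, List.prod_append, map_mul]
  simp [spinToPerm_tgen h]

/-- Elements of two permutation groups with disjoint supports commute. -/
theorem commute_initCycle_permSnd {a m : ℕ} (h : a + 1 + m = n) (e : Equiv.Perm (Fin m)) :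
    Commute (initCycle n a) (permSnd h e) := by
  refine Equiv.Perm.Disjoint.commute fun b => ?_
  rcases finFst_or_finSnd h b with ⟨i, rfl⟩ | ⟨i, rfl⟩
  · exact Or.inr (permSnd_finFst h e i)
  · exact Or.inl (initCycle_of_lt a (by omega) _ (by simp [finSnd]; omega))

theorem permSnd_decomposeFin {a m : ℕ} (h : a + (m + 1) = n) (p : Fin (m + 1))
    (e : Equiv.Perm (Fin m)) : permSnd h (Equiv.Perm.decomposeFin.symm (p, e)) =
      Equiv.swap (finSnd h 0) (finSnd h p) * permSnd (a := a + 1) (by omega) e := by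
  have h' : a + 1 + m = n := by omega
  have hs : ∀ i : Fin m, finSnd h' i = finSnd h i.succ := fun i =>
    Fin.ext (by simp [finSnd]; omega)
  refine Equiv.ext fun b => ?_
  rw [Equiv.Perm.mul_apply]
  rcases finFst_or_finSnd h b with ⟨i, rfl⟩ | ⟨i, rfl⟩
  · have e1 : finFst h i = finFst h' ⟨i.1, by have := i.2; omega⟩ := rfl
    rw [permSnd_finFst, e1, permSnd_finFst, ← e1, Equiv.swap_apply_of_ne_of_ne] <;>
    exact finFst_ne_finSnd h _ _
  · rw [permSnd_finSnd]
    induction i using Fin.cases with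
    | zero =>
      have e1 : finSnd h 0 = finFst h' ⟨a, by omega⟩ := rfl
      have e2 : permSnd h' e (finSnd h 0) = finSnd h 0 := by rw [e1, permSnd_finFst]
      rw [Equiv.Perm.decomposeFin_symm_apply_zero, e2, Equiv.swap_apply_left]
    | succ i =>
      rw [Equiv.Perm.decomposeFin_symm_apply_succ, ← hs i, permSnd_finSnd, hs,
        (finSnd_injective h).swap_apply]

variable {A : Equiv.Perm (Fin n) → ℂ}

/-- The letter a belongs both to the initial cycle and to the block being permuted. If it is fixed
in the block, the initial cycle closes with length a+1. Otherwise one of m further letters is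
appended to the cycle, and by conjugation invariance each choice contributes as much as the letter
a+1. -/
theorem sum_permSnd_succ (hA : ∀ w s, A (w * s * w⁻¹) = A s) {a m : ℕ} (h : a + (m + 1) = n) :
    ∑ e : Equiv.Perm (Fin (m + 1)), A (initCycle n a * permSnd h e) =
      ∑ e : Equiv.Perm (Fin m), A (initCycle n a * permSnd (a := a + 1) (by omega) e) +
        m * ∑ e : Equiv.Perm (Fin m), A (initCycle n (a + 1) * permSnd (a := a + 1) (m := m) (by omega) e) := by
  have h' : a + 1 + m = n := by omega
  rw [← Equiv.sum_comp Equiv.Perm.decomposeFin.symm, Fintype.sum_prod_type, Fin.sum_univ_succ]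
  congr 1
  · refine Finset.sum_congr rfl fun e _ => ?_
    rw [permSnd_decomposeFin, Equiv.swap_self]
    congr 1
  · have key : ∀ q : Fin m, ∑ e : Equiv.Perm (Fin m),
        A (initCycle n a * permSnd h (Equiv.Perm.decomposeFin.symm (q.succ, e))) =
        ∑ e : Equiv.Perm (Fin m), A (initCycle n (a + 1) * permSnd h' e) := by
      intro q
      have hm : 0 < m := by have := q.2; omega
      -- Conjugation by u brings the appended letter to position a+1. It commutes with the initial
      -- cycle, the supports being disjoint, and only reindexes the sum over e.
      set u : Equiv.Perm (Fin m) := Equiv.swap ⟨0, hm⟩ q with hu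
      refine Fintype.sum_equiv (MulAut.conj u).toEquiv _ _ fun e => ?_
      rw [← hA (permSnd h' u), permSnd_decomposeFin, initCycle_succ a (by omega)]
      congr 1
      have c := (commute_initCycle_permSnd h' u).eq
      have s1 : permSnd h' u * Equiv.swap (finSnd h 0) (finSnd h q.succ) * (permSnd h' u)⁻¹ =
          Equiv.swap ⟨a, by omega⟩ ⟨a + 1, by omega⟩ := by
        rw [← Equiv.swap_apply_apply]
        have e1 : finSnd h 0 = finFst h' ⟨a, by omega⟩ := rfl
        have e2 : finSnd h q.succ = finSnd h' q := Fin.ext (by simp [finSnd]; omega)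
        rw [e1, permSnd_finFst, e2, permSnd_finSnd, hu, Equiv.swap_apply_right]
        rfl
      calc permSnd h' u * (initCycle n a * (Equiv.swap (finSnd h 0) (finSnd h q.succ) *
              permSnd h' e)) * (permSnd h' u)⁻¹
          = (permSnd h' u * initCycle n a) * Equiv.swap (finSnd h 0) (finSnd h q.succ) *
              permSnd h' e * (permSnd h' u)⁻¹ := by simp only [mul_assoc]
        _ = initCycle n a * (permSnd h' u * Equiv.swap (finSnd h 0) (finSnd h q.succ) *
              (permSnd h' u)⁻¹) * (permSnd h' u * permSnd h' e * (permSnd h' u)⁻¹) := by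
            rw [← c]; group
        _ = _ := by
            rw [s1, ← permSnd_inv, ← permSnd_mul, ← permSnd_mul]; rfl
    rw [Finset.sum_congr rfl fun q _ => key q]
    simp

/-- After division by the factorials the recursion unrolls to a plain sum: all possible lengths of
the initial cycle carry equal weight. Here `t j` is the normalized contribution of the length j+1.
-/
theorem sum_permSnd (hA : ∀ w s, A (w * s * w⁻¹) = A s) (t : ℕ → ℂ)
    (ht : ∀ j l (h : j + 1 + l = n), ((l.factorial : ℂ))⁻¹ *
      ∑ e : Equiv.Perm (Fin l), A (initCycle n j * permSnd h e) = t j) :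
    ∀ (m a : ℕ) (h : a + m = n), (m : ℂ) * ((m.factorial : ℂ)⁻¹ *
      ∑ e : Equiv.Perm (Fin m), A (initCycle n a * permSnd h e)) =
        ∑ j ∈ Finset.range m, t (a + j)
  | 0, a, h => by simp
  | m + 1, a, h => by
    have ih := sum_permSnd hA t ht m (a + 1) (by omega)
    have h0 := ht a m (by omega)
    rw [Finset.sum_range_succ', sum_permSnd_succ hA, Nat.factorial_succ]
    have e1 : ∀ j, t (a + (j + 1)) = t (a + 1 + j) := fun j => by congr 1; omega
    simp only [e1, add_zero]
    rw [← ih, ← h0]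
    have : ((m + 1 : ℕ) : ℂ) ≠ 0 := by exact_mod_cast Nat.succ_ne_zero m
    have hf : (m.factorial : ℂ) ≠ 0 := by exact_mod_cast m.factorial_ne_zero
    generalize ∑ e : Equiv.Perm (Fin m), A (initCycle n (a + 1) * permSnd _ e) = X
    generalize ∑ e : Equiv.Perm (Fin m), A (initCycle n a * permSnd _ e) = Y
    push_cast at this ⊢
    field_simp
    ring

theorem sum_perm (hA : ∀ w s, A (w * s * w⁻¹) = A s) (t : ℕ → ℂ)
    (ht : ∀ j l (h : j + 1 + l = n), ((l.factorial : ℂ))⁻¹ *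
      ∑ e : Equiv.Perm (Fin l), A (initCycle n j * permSnd h e) = t j) :
    (n : ℂ) * ((n.factorial : ℂ)⁻¹ * ∑ s, A s) = ∑ j ∈ Finset.range n, t j := by
  have h := sum_permSnd hA t ht n 0 (by omega)
  simp only [zero_add] at h
  rw [← h]
  congr 2
  refine Finset.sum_congr rfl fun s _ => ?_
  congr 1
  refine Equiv.ext fun b => ?_
  rw [Equiv.Perm.mul_apply]
  have hb : b = finSnd (Nat.zero_add n) b := Fin.ext (by simp [finSnd])
  have h1 : ∀ c : Fin n, finSnd (Nat.zero_add n) c = c := fun c => Fin.ext (by simp [finSnd])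
  have h2 : permSnd (Nat.zero_add n) s b = s b := by
    conv_lhs => rw [hb]
    rw [permSnd_finSnd, h1]
  rw [h2]
  simp [initCycle]

end PermRecursion

/-! ### Passage from permutations to the spin wreath product. -/

section WreathRecursion
variable {Γ : Type u} [Group Γ] {n : ℕ}

noncomputable instance : Fintype (SpinGroup n) := Fintype.ofFinite _

/-- A lift of a permutation to the spin group. -/
noncomputable def permLift (s : Equiv.Perm (Fin n)) : SpinGroup n :=
  Function.surjInv (spinToPerm_surjective n) s

theorem spinToPerm_permLift (s : Equiv.Perm (Fin n)) : spinToPerm n (permLift s) = s :=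
  Function.surjInv_eq _ s

theorem sum_comp_spinToPerm (φ : Equiv.Perm (Fin n) → ℂ) :
    ∑ t : SpinGroup n, φ (spinToPerm n t) = 2 * ∑ s, φ s := by
  classical
  rw [← Finset.sum_fiberwise Finset.univ (spinToPerm n), Finset.mul_sum]
  refine Finset.sum_congr rfl fun s _ => ?_
  rw [Finset.sum_congr rfl (g := fun _ => φ s) (fun t ht => by rw [(Finset.mem_filter.1 ht).2]),
    Finset.sum_const, nsmul_eq_mul]
  congr 1
  have : Finset.univ.filter (fun t => spinToPerm n t = s) =
      {permLift s, sz n * permLift s} := by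
    ext t
    simp only [Finset.mem_filter, Finset.mem_univ, true_and, Finset.mem_insert,
      Finset.mem_singleton]
    constructor
    · intro h
      exact eq_or_eq_sz_mul (h.trans (spinToPerm_permLift s).symm)
    · rintro (rfl | rfl) <;> simp [spinToPerm_permLift]
  rw [this, Finset.card_pair]
  · norm_num
  · intro h
    exact sz_ne_one n (right_eq_mul.1 h)

/-- The average of a function on a finite type. -/
noncomputable def average {α : Type*} [Fintype α] (A : α → ℂ) : ℂ :=
  (Nat.card α : ℂ)⁻¹ * ∑ x, A x

theorem eq_of_wz_invariant {A : SpinWreathProduct Γ n → ℂ} (hz : ∀ x, A (wz Γ n * x) = A x)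
    {g : Fin n → Γ} {t t' : SpinGroup n} (h : spinToPerm n t = spinToPerm n t') :
    A ⟨g, t⟩ = A ⟨g, t'⟩ := by
  rcases eq_or_eq_wz_mul (x := (⟨g, t⟩ : SpinWreathProduct Γ n)) (y := ⟨g, t'⟩) rfl h with h | h
  · rw [h]
  · rw [h, hz]

theorem sum_perm_conj [Fintype Γ] {A : SpinWreathProduct Γ n → ℂ} (hc : ∀ g x, A (g * x * g⁻¹) = A x)
    (hz : ∀ x, A (wz Γ n * x) = A x) (w s : Equiv.Perm (Fin n)) :
    ∑ g : Fin n → Γ, A ⟨g, permLift (w * s * w⁻¹)⟩ = ∑ g : Fin n → Γ, A ⟨g, permLift s⟩ := by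
  symm
  refine Fintype.sum_equiv (wreathAction Γ n (permLift w)).toEquiv _ _ fun g => ?_
  rw [← hc (SemidirectProduct.inr (permLift w))]
  have e : (SemidirectProduct.inr (permLift w) * ⟨g, permLift s⟩ *
      (SemidirectProduct.inr (permLift w))⁻¹ : SpinWreathProduct Γ n) =
      ⟨wreathAction Γ n (permLift w) g, permLift w * permLift s * (permLift w)⁻¹⟩ :=
    SemidirectProduct.ext (funext fun i => by rw [conj_inr_left]; rfl) rfl
  rw [e]
  refine eq_of_wz_invariant hz ?_
  simp [spinToPerm_permLift]

theorem join_mul_fst {k l N : ℕ} (h : k + l = N) (w x : SpinWreathProduct Γ k)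
    (y : SpinWreathProduct Γ l) (hw : par w = 0) :
    join h (w * x * w⁻¹) y =
      wEmbed Γ (a := 0) (by omega) w * join h x y * (wEmbed Γ (a := 0) (by omega : 0 + k ≤ N) w)⁻¹ := by
  have c := wEmbed_comm h.le y w⁻¹
  rw [par_inv, hw, mul_zero, zpar_zero, mul_one] at c
  rw [join_eq, join_eq, map_mul, map_mul, mul_assoc _ _ (wEmbed Γ h.le y), ← c, map_inv]
  simp only [mul_assoc]

variable [Finite Γ]

theorem sum_wreath [Fintype Γ] {A : SpinWreathProduct Γ n → ℂ} (hz : ∀ x, A (wz Γ n * x) = A x) :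
    ∑ x, A x = 2 * ∑ s : Equiv.Perm (Fin n), ∑ g : Fin n → Γ, A ⟨g, permLift s⟩ := by
  rw [← sum_comp_spinToPerm, ← Equiv.sum_comp SemidirectProduct.equivProd.symm,
    Fintype.sum_prod_type, Finset.sum_comm]
  refine Finset.sum_congr rfl fun t _ => Finset.sum_congr rfl fun g _ => ?_
  exact eq_of_wz_invariant hz (spinToPerm_permLift _).symm

theorem card_spinWreathProduct [Fintype Γ] (n : ℕ) : (Nat.card (SpinWreathProduct Γ n) : ℂ) =
    2 * (Nat.card Γ : ℂ) ^ n * n.factorial := by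
  have h := sum_wreath (Γ := Γ) (n := n) (A := fun _ => 1) (fun _ => rfl)
  simp only [Finset.sum_const, Finset.card_univ, nsmul_eq_mul, mul_one, Fintype.card_pi,
    Finset.prod_const, Fintype.card_perm, Fintype.card_fin] at h
  rw [Nat.card_eq_fintype_card, h, Nat.card_eq_fintype_card]
  push_cast; ring

/-- Over a full cycle, conjugation by Γ^{k+1} concentrates a tuple at the last letter, where its
cycle product γ remains; each γ arises from |Γ|^k tuples. -/
theorem sum_cycle_normal_form [Fintype Γ] (ε : ℕ → ℕ) (k : ℕ)
    {B : SpinWreathProduct Γ (k + 1) → ℂ}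
    (hB : ∀ (h : Fin (k + 1) → Γ) x,
      B (SemidirectProduct.inl h * x * (SemidirectProduct.inl h)⁻¹) = B x) :
    ∑ g : Fin (k + 1) → Γ, B ⟨g, cycleLift ε (k + 1) 0 (k + 1)⟩ =
      (Nat.card Γ : ℂ) ^ k * ∑ γ, B (cycElt ε (k + 1) γ) := by
  classical
  -- Tuples are written as h_i h_{i-1}⁻¹ with h_{-1} = 1, so that the cycle product telescopes to
  -- the last entry of h.
  let Φ : (Fin (k + 1) → Γ) → Fin (k + 1) → Γ := fun h i =>
    h i * (Fin.cases 1 (fun j : Fin k => h j.castSucc) i)⁻¹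
  have hΦ : Function.Bijective Φ := by
    refine Function.Injective.bijective_of_finite fun h h' e => funext fun i => ?_
    induction i using Fin.induction with
    | zero => simpa [Φ] using congrFun e 0
    | succ i ih =>
      have := congrFun e i.succ
      simp only [Φ, Fin.cases_succ, ih] at this
      exact mul_right_cancel this
  rw [← (Equiv.ofBijective Φ hΦ).sum_comp]
  have hconj : ∀ h, B ⟨Φ h, cycleLift ε (k + 1) 0 (k + 1)⟩ =
      B (cycElt ε (k + 1) (h (Fin.last k))) := by
    intro h
    -- The last entry of the conjugating tuple is reset to 1, so that the cycle product stays at the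
    -- last letter instead of being cancelled.
    refine Eq.trans ?_ (hB (Function.update h (Fin.last k) 1) _)
    rw [← map_inv]
    congr 1
    refine SemidirectProduct.ext (funext fun i => ?_) (by simp; rfl)
    obtain ⟨b, rfl⟩ : ∃ b, i = spinToPerm (k + 1) (cycleLift ε (k + 1) 0 (k + 1)) b :=
      ⟨(spinToPerm (k + 1) (cycleLift ε (k + 1) 0 (k + 1)))⁻¹ i, by simp⟩
    simp only [SemidirectProduct.mul_left, SemidirectProduct.left_inl, Pi.mul_apply,
      SemidirectProduct.mul_right, SemidirectProduct.right_inl, map_one, MulAut.one_apply,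
      wreathAction_apply, Pi.inv_apply, one_mul, cycElt]
    rw [show (spinToPerm (k + 1) (cycleLift ε (k + 1) 0 (k + 1)))⁻¹
      (spinToPerm (k + 1) (cycleLift ε (k + 1) 0 (k + 1)) b) = b from
        Equiv.Perm.inv_eq_iff_eq.2 rfl]
    have hb := spinToPerm_cycleLift_full ε (k + 1) b
    induction b using Fin.lastCases with
    | last =>
      have e0 : spinToPerm (k + 1) (cycleLift ε (k + 1) 0 (k + 1)) (Fin.last k) = 0 :=
        Fin.ext (by rw [hb]; simp)
      rw [e0]
      simp only [Φ, Fin.cases_zero, inv_one, mul_one, Function.update_self]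
      rcases k with _ | k
      · simp
      · rw [Function.update_of_ne (by simp [Fin.ext_iff])]
        simp
    | cast b =>
      have e0 : spinToPerm (k + 1) (cycleLift ε (k + 1) 0 (k + 1)) b.castSucc = b.succ :=
        Fin.ext (by rw [hb, Nat.mod_eq_of_lt] <;> simp)
      rw [e0, Function.update_of_ne (Fin.castSucc_lt_last b).ne]
      simp only [Φ, Fin.cases_succ]
      congr 1
      by_cases hl : b.succ = Fin.last k
      · rw [hl]; simp
      · rw [Function.update_of_ne hl, if_neg, mul_one]
        intro h'
        exact hl (Fin.ext (by simpa using h'))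
  trans ∑ h : Fin (k + 1) → Γ, B (cycElt ε (k + 1) (h (Fin.last k)))
  · exact Finset.sum_congr rfl fun h _ => hconj h
  rw [← (Fin.snocEquiv fun _ => Γ).sum_comp, Fintype.sum_prod_type, Finset.mul_sum]
  refine Finset.sum_congr rfl fun γ _ => ?_
  simp [Fin.snocEquiv]

/-- Combines the recursion for permutations with the normal form of the first cycle. The index k is
one less than the cycle length. Invariance under z allows any lift of a permutation to be used. -/
theorem average_eq_sum [Fintype Γ] (ε : ℕ → ℕ) {A : SpinWreathProduct Γ n → ℂ}
    (hc : ∀ g x, A (g * x * g⁻¹) = A x) (hz : ∀ x, A (wz Γ n * x) = A x) (t : ℕ → ℂ)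
    (ht : ∀ k l (h : k + 1 + l = n), (Nat.card Γ : ℂ)⁻¹ *
      ∑ γ : Γ, average (fun y : SpinWreathProduct Γ l => A (join h (cycElt ε (k + 1) γ) y)) = t k) :
    (n : ℂ) * average A = ∑ k ∈ Finset.range n, t k := by
  have hΓ : (Nat.card Γ : ℂ) ≠ 0 := by exact_mod_cast Nat.card_pos.ne'
  have hf : ∀ m : ℕ, (m.factorial : ℂ) ≠ 0 := fun m => by exact_mod_cast m.factorial_ne_zero
  have key := sum_perm (n := n) (A := fun s => ∑ g : Fin n → Γ, A ⟨g, permLift s⟩)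
    (sum_perm_conj hc hz) (fun k => (Nat.card Γ : ℂ) ^ n * t k) (by
      intro k l h
      rw [← ht k l h]
      have hjz : ∀ x y, A (join h x (wz Γ l * y)) = A (join h x y) := by
        intro x y
        rw [join_eq, map_mul, wEmbed_wz, ← mul_assoc, ← wz_central, mul_assoc, hz, ← join_eq]
      have e1 : ∀ e : Equiv.Perm (Fin l),
          ∑ g : Fin n → Γ, A ⟨g, permLift (initCycle n k * permSnd h e)⟩ =
            (Nat.card Γ : ℂ) ^ k * ∑ γ, ∑ g' : Fin l → Γ,
              A (join h (cycElt ε (k + 1) γ) ⟨g', permLift e⟩) := by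
        intro e
        have e2 := fun g' : Fin l → Γ => sum_cycle_normal_form ε k
          (B := fun x => A (join h x ⟨g', permLift e⟩)) (fun g x => by
            rw [join_mul_fst h _ _ _ (par_inl g), hc])
        rw [Finset.sum_comm, Finset.mul_sum, ← Finset.sum_congr rfl fun g' _ => e2 g',
          Finset.sum_comm, ← Fintype.sum_prod_type']
        have hbij : Function.Bijective fun g : Fin n → Γ =>
            ((fun i => g (finFst h i), fun j => g (finSnd h j)) :
              (Fin (k + 1) → Γ) × (Fin l → Γ)) := by
          constructor
          · intro g g' e
            funext a
            rcases finFst_or_finSnd h a with ⟨i, rfl⟩ | ⟨i, rfl⟩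
            · exact congrFun (congrArg Prod.fst e) i
            · exact congrFun (congrArg Prod.snd e) i
          · rintro ⟨g, g'⟩
            refine ⟨(join h (⟨g, 1⟩ : SpinWreathProduct Γ (k + 1))
              (⟨g', 1⟩ : SpinWreathProduct Γ l)).left, Prod.ext (funext fun i => ?_)
                (funext fun i => ?_)⟩
            · exact join_left_fst h _ _ i
            · exact join_left_snd h _ _ i
        refine Fintype.sum_equiv (Equiv.ofBijective _ hbij) _ _ fun g => ?_
        simp only [Equiv.ofBijective_apply]
        have e3 : g = (join h (⟨fun i => g (finFst h i), cycleLift ε (k + 1) 0 (k + 1)⟩ :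
            SpinWreathProduct Γ (k + 1)) (⟨fun j => g (finSnd h j), permLift e⟩ :
              SpinWreathProduct Γ l)).left := by
          funext a
          rcases finFst_or_finSnd h a with ⟨i, rfl⟩ | ⟨i, rfl⟩
          · rw [join_left_fst]
          · rw [join_left_snd]
        conv_lhs => rw [e3]
        -- The chosen lift of the product and the product of the chosen lifts lie over the same
        -- permutation, so they differ at most by z, which A does not see.
        refine eq_of_wz_invariant (t' := (join h _ _).right) hz ?_
        rw [spinToPerm_permLift, join_right, map_mul, spinEmbed_cycleLift ε _ (by omega),
          spinToPerm_spinEmbed, spinToPerm_permLift, cycleLift, map_mul, map_pow, spinToPerm_sz,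
          one_pow, one_mul]
        rfl
      rw [Finset.sum_congr rfl fun e _ => e1 e, ← Finset.mul_sum, Finset.sum_comm]
      have e4 : ∀ γ, average (fun y : SpinWreathProduct Γ l =>
          A (join h (cycElt ε (k + 1) γ) y)) = ((Nat.card Γ : ℂ) ^ l * l.factorial)⁻¹ *
            ∑ e : Equiv.Perm (Fin l), ∑ g' : Fin l → Γ,
              A (join h (cycElt ε (k + 1) γ) ⟨g', permLift e⟩) := by
        intro γ
        rw [average, sum_wreath (hjz _), card_spinWreathProduct]
        field_simp
      rw [Finset.sum_congr rfl fun γ _ => e4 γ, ← Finset.mul_sum]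
      have : (Nat.card Γ : ℂ) ^ n = Nat.card Γ ^ k * Nat.card Γ * Nat.card Γ ^ l := by
        rw [← h]; ring
      rw [this]
      field_simp [hf l])
  rw [average, sum_wreath hz, card_spinWreathProduct]
  rw [← Finset.mul_sum] at key
  have h2 := hf n
  have h3 : (Nat.card Γ : ℂ) ^ n ≠ 0 := pow_ne_zero _ hΓ
  rw [← mul_right_inj' h3, ← key]
  field_simp

end WreathRecursion

/-! ### Multisets of rows -/

section Rows
variable {Γ : Type u} [Group Γ]

/-- A row: a conjugacy class together with an odd length. -/
abbrev Row (Γ : Type u) [Group Γ] : Type u := ConjClasses Γ × OddNat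

/-- The total length of a multiset of rows. -/
def rowSize (s : Multiset (Row Γ)) : ℕ := (s.map fun a => a.2.1).sum

@[simp] theorem rowSize_zero : rowSize (0 : Multiset (Row Γ)) = 0 := rfl

@[simp] theorem rowSize_cons (a : Row Γ) (s : Multiset (Row Γ)) :
    rowSize (a ::ₘ s) = a.2.1 + rowSize s := by simp [rowSize]

theorem rowSize_add (s t : Multiset (Row Γ)) : rowSize (s + t) = rowSize s + rowSize t := by
  simp [rowSize]

open Classical in
/-- The family of partitions attached to a multiset of rows. -/
noncomputable def toFam (s : Multiset (Row Γ)) (c : ConjClasses Γ) : OddPartition :=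
  (s.filter fun a => a.1 = c).map Prod.snd

open Classical in
theorem toFam_cons (a : Row Γ) (s : Multiset (Row Γ)) (c : ConjClasses Γ) :
    toFam (a ::ₘ s) c = if a.1 = c then a.2 ::ₘ toFam s c else toFam s c := by
  simp only [toFam, Multiset.filter_cons]
  split_ifs <;> simp

@[simp] theorem toFam_zero (c : ConjClasses Γ) : toFam (0 : Multiset (Row Γ)) c = 0 := rfl

theorem count_toFam [DecidableEq (Row Γ)] (s : Multiset (Row Γ)) (c : ConjClasses Γ) (k : OddNat) :
    (toFam s c).count k = s.count (c, k) := by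
  induction s using Multiset.induction with
  | empty => simp
  | cons a s ih =>
    obtain ⟨c', k'⟩ := a
    classical
    rw [toFam_cons, Multiset.count_cons, ← ih]
    by_cases h : c' = c
    · subst h; simp [Multiset.count_cons]
    · simp [h, Ne.symm h]

theorem toFam_injective : Function.Injective (toFam (Γ := Γ)) := by
  classical
  intro s t h
  refine Multiset.ext.2 fun ⟨c, k⟩ => ?_
  rw [← count_toFam, h, count_toFam]

variable [Finite Γ]

theorem toFam_sum (ρ : ConjClasses Γ → OddPartition) :
    toFam (∑ c, (ρ c).map (Prod.mk c)) = ρ := by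
  classical
  refine funext fun c => Multiset.ext.2 fun k => ?_
  rw [count_toFam, Multiset.count_sum', Finset.sum_eq_single c]
  · exact Multiset.count_map_eq_count' _ _ (Prod.mk_right_injective c) k
  · intro c' _ hc
    rw [Multiset.count_eq_zero]
    intro h
    obtain ⟨_, _, h⟩ := Multiset.mem_map.1 h
    exact hc (congrArg Prod.fst h)
  · simp

theorem toFam_surjective : Function.Surjective (toFam (Γ := Γ)) := fun ρ => ⟨_, toFam_sum ρ⟩

theorem sum_toFam_cons {M : Type*} [AddCommMonoid M] (φ : ConjClasses Γ → OddPartition → M)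
    (ψ : Row Γ → M) (s : Multiset (Row Γ)) (a : Row Γ)
    (h : φ a.1 (a.2 ::ₘ toFam s a.1) = ψ a + φ a.1 (toFam s a.1)) :
    ∑ c, φ c (toFam (a ::ₘ s) c) = ψ a + ∑ c, φ c (toFam s c) := by
  classical
  rw [← Finset.add_sum_erase _ _ (Finset.mem_univ a.1),
    ← Finset.add_sum_erase _ (fun c => φ c (toFam s c)) (Finset.mem_univ a.1), ← add_assoc, ← h,
    toFam_cons, if_pos rfl]
  congr 1
  refine Finset.sum_congr rfl fun c hc => ?_
  rw [toFam_cons, if_neg (Finset.ne_of_mem_erase hc).symm]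

theorem prod_toFam_cons {M : Type*} [CommMonoid M] (φ : ConjClasses Γ → OddPartition → M)
    (y : M) (s : Multiset (Row Γ)) (a : Row Γ)
    (h : φ a.1 (a.2 ::ₘ toFam s a.1) = y * φ a.1 (toFam s a.1)) :
    ∏ c, φ c (toFam (a ::ₘ s) c) = y * ∏ c, φ c (toFam s c) := by
  classical
  rw [← Finset.mul_prod_erase _ _ (Finset.mem_univ a.1),
    ← Finset.mul_prod_erase _ (fun c => φ c (toFam s c)) (Finset.mem_univ a.1), ← mul_assoc, ← h,
    toFam_cons, if_pos rfl]
  congr 1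
  refine Finset.prod_congr rfl fun c hc => ?_
  rw [toFam_cons, if_neg (Finset.ne_of_mem_erase hc).symm]

theorem sum_psize_toFam (s : Multiset (Row Γ)) : ∑ c, psize (toFam s c) = rowSize s := by
  induction s using Multiset.induction with
  | empty => simp [psize]
  | cons a s ih =>
    rw [sum_toFam_cons (fun _ => psize) (fun a => a.2.1) s a (by simp [psize]), ih, rowSize_cons]

theorem plen_toFam (s : Multiset (Row Γ)) : plen (toFam s) = Multiset.card s := by
  induction s using Multiset.induction with
  | empty => simp [plen]
  | cons a s ih =>
    rw [plen, sum_toFam_cons (fun _ => Multiset.card) (fun _ => 1) s a (by simp [add_comm]), ← plen,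
      ih, Multiset.card_cons, add_comm]

theorem zPart_cons (k : OddNat) (μ : OddPartition) :
    zPart (k ::ₘ μ) = k.1 * (μ.count k + 1) * zPart μ := by
  have h : ∀ (ν : OddPartition) (T : Finset OddNat), ν.toFinset ⊆ T →
      zPart ν = ∏ i ∈ T, i.1 ^ ν.count i * (ν.count i).factorial := by
    intro ν T hT
    refine Finset.prod_subset hT fun i _ hi => ?_
    rw [Multiset.mem_toFinset] at hi
    simp [Multiset.count_eq_zero_of_notMem hi]
  have hk : k ∈ (k ::ₘ μ).toFinset := by simp
  rw [h μ (k ::ₘ μ).toFinset (Multiset.toFinset_subset.2 (Multiset.subset_cons _ _)), zPart,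
    ← Finset.mul_prod_erase _ _ hk, ← Finset.mul_prod_erase _ _ hk,
    Multiset.count_cons_self, Finset.prod_congr rfl (g := fun i => i.1 ^ μ.count i *
      (μ.count i).factorial)]
  · rw [Nat.factorial_succ, pow_succ]; ring
  · intro i hi
    rw [Multiset.count_cons_of_ne (Finset.ne_of_mem_erase hi)]

/-- The recursion behind both the inner product formula and the multiplicities in the coproduct. -/
theorem bigZ_cons [DecidableEq (Row Γ)] (a : Row Γ) (s : Multiset (Row Γ)) :
    bigZ (toFam (a ::ₘ s)) = a.2.1 * zeta a.1 * (s.count a + 1) * bigZ (toFam s) := by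
  rw [bigZ, prod_toFam_cons (fun c μ => zPart μ * zeta c ^ Multiset.card μ)
    (a.2.1 * zeta a.1 * (s.count a + 1)) s a, bigZ]
  rw [zPart_cons, count_toFam, Multiset.card_cons, pow_succ]
  ring

theorem zeta_pos (c : ConjClasses Γ) : 0 < zeta c := Nat.card_pos

theorem bigZ_pos (s : Multiset (Row Γ)) : 0 < bigZ (toFam s) := by
  induction s using Multiset.induction with
  | empty => simp [bigZ, zPart]
  | cons a s ih =>
    classical
    rw [bigZ_cons]
    have := zeta_pos a.1
    have := a.2.2.pos
    positivity

theorem bigZ_ne_zero (s : Multiset (Row Γ)) : (bigZ (toFam s) : ℂ) ≠ 0 := by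
  exact_mod_cast (bigZ_pos s).ne'

theorem finite_rowSize (n : ℕ) : {s : Multiset (Row Γ) | rowSize s = n}.Finite := by
  refine Set.Finite.of_finite_image (f := toFam) (Set.Finite.subset
    (Set.finite_range fun ρ : OPFam Γ n => ρ.1) ?_) toFam_injective.injOn
  rintro _ ⟨s, hs, rfl⟩
  exact ⟨⟨toFam s, (sum_psize_toFam s).trans hs⟩, rfl⟩

variable (Γ) in
/-- The multisets of rows of total length `n`. -/
noncomputable def rowSets (n : ℕ) : Finset (Multiset (Row Γ)) := (finite_rowSize n).toFinset

@[simp] theorem mem_rowSets {n : ℕ} {s : Multiset (Row Γ)} : s ∈ rowSets Γ n ↔ rowSize s = n := by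
  simp [rowSets]

theorem sum_OPFam {M : Type*} [AddCommMonoid M] (n : ℕ) (φ : (ConjClasses Γ → OddPartition) → M) :
    ∑ ρ : OPFam Γ n, φ ρ.1 = ∑ s ∈ rowSets Γ n, φ (toFam s) := by
  symm
  refine Finset.sum_bij (fun s hs => ⟨toFam s, (sum_psize_toFam s).trans (mem_rowSets.1 hs)⟩)
    (fun _ _ => Finset.mem_univ _) (fun s _ t _ h => toFam_injective (congrArg Subtype.val h))
    (fun ρ _ => ?_) (fun _ _ => rfl)
  obtain ⟨s, hs⟩ := toFam_surjective ρ.1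
  refine ⟨s, ?_, Subtype.ext hs⟩
  rw [mem_rowSets, ← sum_psize_toFam, hs, ρ.2]

/-- By the orbit–stabilizer theorem for conjugation, the class c has |Γ|/ζ_c elements. -/
theorem inv_card_mul_sum_mk [Fintype Γ] (φ : ConjClasses Γ → ℂ) :
    (Nat.card Γ : ℂ)⁻¹ * ∑ γ : Γ, φ (ConjClasses.mk γ) = ∑ c, (zeta c : ℂ)⁻¹ * φ c := by
  classical
  rw [← Finset.sum_fiberwise Finset.univ (ConjClasses.mk : Γ → ConjClasses Γ), Finset.mul_sum]
  refine Finset.sum_congr rfl fun c _ => ?_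
  rw [Finset.sum_congr rfl (g := fun _ => φ c) (fun t ht => by rw [(Finset.mem_filter.1 ht).2]),
    Finset.sum_const, nsmul_eq_mul, ← mul_assoc]
  congr 1
  have h1 : zeta c * (Finset.univ.filter fun γ : Γ => ConjClasses.mk γ = c).card = Nat.card Γ := by
    have h2 := MulAction.card_orbit_mul_card_stabilizer_eq_card_group (ConjAct Γ) (Quotient.out c)
    have h3 : Fintype.card (MulAction.stabilizer (ConjAct Γ) (Quotient.out c)) = zeta c := by
      rw [zeta, Subgroup.nat_card_centralizer_nat_card_stabilizer, Nat.card_eq_fintype_card]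
    have h4 : Fintype.card (ConjAct Γ) = Nat.card Γ := by
      rw [← Nat.card_eq_fintype_card]; rfl
    rw [h3, h4, mul_comm] at h2
    rw [← h2, ← Set.toFinset_card]
    congr 2
    ext γ
    rw [Finset.mem_filter, Set.mem_toFinset, ConjAct.orbit_eq_carrier_conjClasses,
      ConjClasses.mem_carrier_iff_mk_eq, show ConjClasses.mk (Quotient.out c) = c from
        Quotient.out_eq c]
    simp
  have hz : (zeta c : ℂ) ≠ 0 := by exact_mod_cast (zeta_pos c).ne'
  have hΓ : (Nat.card Γ : ℂ) ≠ 0 := by exact_mod_cast Nat.card_pos.ne'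
  rw [← h1] at hΓ ⊢
  push_cast at hΓ ⊢
  have h2 := right_ne_zero_of_mul hΓ
  field_simp

end Rows

/-! ### Values at multisets of rows and the inner product formula -/

section Values
variable {Γ : Type u} [Group Γ] (ε : ℕ → ℕ) {k l n : ℕ}

/-- The list of pairs of a class and a length, with the oddness forgotten. -/
def rowList (L : List (Row Γ)) : List (ConjClasses Γ × ℕ) := L.map fun a => (a.1, a.2.1)

theorem odd_of_mem_rowList {L : List (Row Γ)} : ∀ p ∈ rowList L, Odd p.2 := by
  intro p hp
  obtain ⟨a, _, rfl⟩ := List.mem_map.1 hp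
  exact a.2.2

theorem listSize_rowList (L : List (Row Γ)) :
    listSize (rowList L) = rowSize (L : Multiset (Row Γ)) := by
  simp [listSize, rowList, rowSize, Function.comp_def]

/-- An element whose class is given by a multiset of rows. -/
noncomputable def rowElt (n : ℕ) (s : Multiset (Row Γ)) : SpinWreathProduct Γ n :=
  listElt ε n (rowList s.toList)

theorem listSize_rowList_toList (s : Multiset (Row Γ)) :
    listSize (rowList s.toList) = rowSize s := by
  rw [listSize_rowList, Multiset.coe_toList]

theorem apply_listElt (f : RMinus Γ n) (L : List (Row Γ)) (h : rowSize (L : Multiset (Row Γ)) = n) :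
    f.1 (listElt ε n (rowList L)) = f.1 (rowElt ε n (L : Multiset (Row Γ))) := by
  refine RMinus.listElt_perm ε ?_ n f odd_of_mem_rowList (by rw [listSize_rowList, h])
  exact (Multiset.coe_eq_coe.1 (Multiset.coe_toList _).symm).map _

theorem join_rowElt (h : k + l = n) (f : RMinus Γ n) {s t : Multiset (Row Γ)} (hs : rowSize s = k)
    (ht : rowSize t = l) : f.1 (join h (rowElt ε k s) (rowElt ε l t)) = f.1 (rowElt ε n (s + t)) := by
  rw [rowElt, rowElt, ← listElt_append ε h (by rw [listSize_rowList_toList, hs])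
    (by rw [listSize_rowList_toList, ht]) (fun p hp => (odd_of_mem_rowList p hp).pos)]
  have e : rowList s.toList ++ rowList t.toList = rowList (s.toList ++ t.toList) := by
    simp [rowList]
  have e' : ((s.toList ++ t.toList : List (Row Γ)) : Multiset (Row Γ)) = s + t := by
    rw [← Multiset.coe_add, Multiset.coe_toList, Multiset.coe_toList]
  rw [e, apply_listElt, e']
  rw [e', rowSize_add, hs, ht, h]

theorem join_cycElt_rowElt (h : k + l = n) (hk : Odd k) (f : RMinus Γ n) (γ : Γ)
    {s : Multiset (Row Γ)} (hs : rowSize s = l) :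
    f.1 (join h (cycElt ε k γ) (rowElt ε l s)) =
      f.1 (rowElt ε n ((ConjClasses.mk γ, ⟨k, hk⟩) ::ₘ s)) := by
  have h1 := RMinus.cycElt_conj ε ⟨_, slice_fst h f (rowElt ε l s)⟩ (γ := γ)
    (δ := Quotient.out (ConjClasses.mk γ))
    (ConjClasses.mk_eq_mk_iff_isConj.1 (Quotient.out_eq (ConjClasses.mk γ)).symm)
  simp only at h1
  rw [h1]
  have h2 : cycElt ε k (Quotient.out (ConjClasses.mk γ)) =
      rowElt ε k ({(ConjClasses.mk γ, ⟨k, hk⟩)} : Multiset (Row Γ)) := by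
    rw [← listElt_singleton, rowElt, Multiset.toList_singleton]; rfl
  rw [h2, join_rowElt ε h f (by simp [rowSize]) hs, Multiset.singleton_add]

theorem par_cycElt_of_even (hk : Even k) (hk0 : 0 < k) (γ : Γ) : par (cycElt ε k γ) = 1 := by
  rw [par_cycElt_eq ε hk0, ZMod.natCast_eq_one_iff_odd]
  exact Nat.Even.sub_odd hk0 hk odd_one

variable [Finite Γ]

/-- The inner product formula: the average of a product of two spin super class functions in terms
of their values at the representatives. -/
theorem average_mul : ∀ (n : ℕ) (f h : RMinus Γ n), average (fun x => f.1 x * h.1 x) =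
    ∑ s ∈ rowSets Γ n, f.1 (rowElt ε n s) * h.1 (rowElt ε n s) / (bigZ (toFam s) : ℂ) := by
  classical
  have := Fintype.ofFinite Γ
  intro n
  induction n using Nat.strong_induction_on with
  | _ n ih =>
  intro f h
  have hc : ∀ g x, f.1 (g * x * g⁻¹) * h.1 (g * x * g⁻¹) = f.1 x * h.1 x := fun g x => by
    rw [f.2.1, h.2.1]
  have hz : ∀ x, f.1 (wz Γ n * x) * h.1 (wz Γ n * x) = f.1 x * h.1 x := fun x => by
    rw [f.2.2.1, h.2.2.1, neg_mul_neg]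
  rcases Nat.eq_zero_or_pos n with rfl | hn
  · have h0 : rowSets Γ 0 = {0} := by
      ext s
      rw [mem_rowSets, Finset.mem_singleton]
      constructor
      · intro hs
        induction s using Multiset.induction with
        | empty => rfl
        | cons a s _ =>
          rw [rowSize_cons] at hs
          have := a.2.2.pos
          omega
      · rintro rfl; rfl
    rw [h0, Finset.sum_singleton, average, card_spinWreathProduct, sum_wreath hz]
    have e : ∀ (s : Equiv.Perm (Fin 0)) (g : Fin 0 → Γ), f.1 ⟨g, permLift s⟩ * h.1 ⟨g, permLift s⟩ =
        f.1 (rowElt ε 0 0) * h.1 (rowElt ε 0 0) := fun s g => by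
      rw [Subsingleton.elim g (rowElt ε 0 0).left]
      exact eq_of_wz_invariant (A := fun x => f.1 x * h.1 x) hz (Subsingleton.elim _ _)
    rw [Finset.sum_congr rfl fun s _ => Finset.sum_congr rfl fun g _ => e s g]
    simp [bigZ, zPart]
  have hn' : (n : ℂ) ≠ 0 := by exact_mod_cast hn.ne'
  rw [← mul_right_inj' hn']
  set F : Multiset (Row Γ) → ℂ := fun s => f.1 (rowElt ε n s) * h.1 (rowElt ε n s) with hF
  -- `t k` collects the pairs of a multiset s and a distinct row a of s of length k+1, with weight
  -- 1/(ζ Z_{s-a}). By `bigZ_cons` this weight is multiplicity times length over Z_s, so the rows of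
  -- s together contribute n/Z_s.
  let t : ℕ → ℂ := fun k => ∑ s ∈ rowSets Γ n, ∑ a ∈ s.toFinset with a.2.1 = k + 1,
    F s / (zeta a.1 * bigZ (toFam (s.erase a)))
  rw [average_eq_sum ε (A := fun x => f.1 x * h.1 x) hc hz t]
  · rw [Finset.mul_sum, Finset.sum_comm]
    refine Finset.sum_congr rfl fun s hs => ?_
    simp only [Finset.sum_filter]
    rw [Finset.sum_comm]
    have e1 : ∀ a ∈ s.toFinset, ∑ k ∈ Finset.range n, (if a.2.1 = k + 1 then
        F s / (zeta a.1 * bigZ (toFam (s.erase a))) else 0) =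
          ((s.count a * a.2.1 : ℕ) : ℂ) * (F s / bigZ (toFam s)) := by
      intro a ha
      rw [Multiset.mem_toFinset] at ha
      have h1 := Multiset.cons_erase ha
      have h2 : rowSize s = a.2.1 + rowSize (s.erase a) := by rw [← rowSize_cons, h1]
      rw [mem_rowSets] at hs
      have ha0 := a.2.2.pos
      rw [Finset.sum_eq_single (a.2.1 - 1)]
      · rw [if_pos (by omega)]
        have h3 := bigZ_cons a (s.erase a)
        rw [h1, Multiset.count_erase_self, Nat.sub_add_cancel (Multiset.one_le_count_iff_mem.2 ha)]
          at h3
        rw [h3]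
        have z1 := bigZ_ne_zero (s.erase a)
        have z2 : (zeta a.1 : ℂ) ≠ 0 := by exact_mod_cast (zeta_pos a.1).ne'
        have z3 : (a.2.1 : ℂ) ≠ 0 := by exact_mod_cast ha0.ne'
        have z4 : (s.count a : ℂ) ≠ 0 := by
          exact_mod_cast Multiset.count_ne_zero.2 ha
        push_cast
        field_simp
      · intro k _ hk
        rw [if_neg (by omega)]
      · intro hk
        exact absurd (Finset.mem_range.2 (by omega)) hk
    rw [Finset.sum_congr rfl e1, ← Finset.sum_mul, ← Nat.cast_sum]
    congr 2
    rw [← mem_rowSets.1 hs, rowSize, Finset.sum_multiset_map_count]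
    simp
  · intro k l hkl
    by_cases hk : Odd (k + 1)
    · have e1 : ∀ γ : Γ, average (fun y : SpinWreathProduct Γ l =>
          f.1 (join hkl (cycElt ε (k + 1) γ) y) * h.1 (join hkl (cycElt ε (k + 1) γ) y)) =
            ∑ s ∈ rowSets Γ l, F ((ConjClasses.mk γ, ⟨k + 1, hk⟩) ::ₘ s) / bigZ (toFam s) := by
        intro γ
        -- With the first cycle fixed, f and h restrict to spin super class functions on l < n
        -- letters.
        have e2 := ih l (by omega) ⟨_, slice_snd hkl f (cycElt ε (k + 1) γ)⟩
          ⟨_, slice_snd hkl h (cycElt ε (k + 1) γ)⟩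
        simp only at e2
        rw [e2]
        refine Finset.sum_congr rfl fun s hs => ?_
        rw [mem_rowSets] at hs
        rw [join_cycElt_rowElt ε hkl hk f γ hs, join_cycElt_rowElt ε hkl hk h γ hs]
      rw [Finset.sum_congr rfl fun γ _ => e1 γ,
        inv_card_mul_sum_mk (fun c => ∑ s ∈ rowSets Γ l, F ((c, ⟨k + 1, hk⟩) ::ₘ s) /
          (bigZ (toFam s) : ℂ))]
      simp only [Finset.mul_sum]
      rw [← Finset.sum_product']
      simp only [t]
      rw [Finset.sum_sigma']
      -- A class and a multiset of size l correspond to a multiset of size n with a marked row of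
      -- length k+1.
      refine Finset.sum_bij' (fun p _ => ⟨(p.1, ⟨k + 1, hk⟩) ::ₘ p.2, (p.1, ⟨k + 1, hk⟩)⟩)
        (fun q _ => (q.2.1, q.1.erase q.2)) ?_ ?_ ?_ ?_ ?_
      · rintro ⟨c, s⟩ hp
        simp only [Finset.mem_product, Finset.mem_univ, true_and, mem_rowSets] at hp
        simp [hp, hkl]
      · rintro ⟨s, c, m, hm⟩ hq
        simp only [Finset.mem_sigma, mem_rowSets, Finset.mem_filter, Multiset.mem_toFinset] at hq
        obtain ⟨h1, h2, h3⟩ := hq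
        have h4 := congrArg rowSize (Multiset.cons_erase h2)
        rw [rowSize_cons] at h4
        simp only at h4
        simp only [Finset.mem_product, Finset.mem_univ, true_and, mem_rowSets]
        omega
      · rintro ⟨c, s⟩ hp
        simp
      · rintro ⟨s, c, m, hm⟩ hq
        simp only [Finset.mem_sigma, mem_rowSets, Finset.mem_filter, Multiset.mem_toFinset] at hq
        obtain ⟨h1, h2, h3⟩ := hq
        subst h3
        simp only [Multiset.cons_erase h2]
      · rintro ⟨c, s⟩ hp
        simp only [Multiset.erase_cons_head]
        rw [div_eq_mul_inv, div_eq_mul_inv, mul_inv]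
        ring
    -- An even cycle is an odd element, and the slice of f in the first block vanishes there for
    -- every y.
    · have h0 : ∀ γ y, f.1 (join hkl (cycElt ε (k + 1) γ) y) = 0 := fun γ y =>
        (slice_fst hkl f y).2.2 _
          (par_cycElt_of_even ε (Nat.not_odd_iff_even.1 hk) (Nat.succ_pos k) γ)
      have h1 : t k = 0 := by
        refine Finset.sum_eq_zero fun s _ => Finset.sum_eq_zero fun a ha => ?_
        exact absurd ((Finset.mem_filter.1 ha).2 ▸ a.2.2) hk
      rw [h1]
      simp [average, h0]

end Values

/-! ### Separation of the representatives -/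

section Statistics
variable {Γ : Type u} [Group Γ] {k l n N : ℕ}

theorem mul_left_apply (x y : SpinWreathProduct Γ n) (i : Fin n) :
    (x * y).left i = x.left i * y.left ((spinToPerm n x.right)⁻¹ i) := rfl

theorem pow_right (x : SpinWreathProduct Γ n) (m : ℕ) : (x ^ m).right = x.right ^ m :=
  map_pow (SemidirectProduct.rightHom : SpinWreathProduct Γ n →* SpinGroup n) x m

theorem perm_inv_apply_self {α : Type*} (s : Equiv.Perm α) (a : α) : s⁻¹ (s a) = a :=
  Equiv.Perm.inv_eq_iff_eq.2 rfl

open Classical in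
/-- The number of letters on cycles of length `k` with cycle product in the class `c`. -/
noncomputable def cycleStat (k : ℕ) (c : ConjClasses Γ) (x : SpinWreathProduct Γ n) : ℕ :=
  ∑ i : Fin n, if (spinToPerm n x.right ^ k) i = i ∧
    (∀ j, 0 < j → j < k → (spinToPerm n x.right ^ j) i ≠ i) ∧
      ConjClasses.mk ((x ^ k).left i) = c then 1 else 0

/-- At a letter on a cycle of length k, the left component of the k-th power is the cycle product
read from that letter. Conjugation by w carries the letter i to its image under w and changes the
cycle product by a conjugation in Γ. -/
theorem cycleStat_conj (k : ℕ) (c : ConjClasses Γ) (w x : SpinWreathProduct Γ n) :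
    cycleStat k c (w * x * w⁻¹) = cycleStat k c x := by
  classical
  symm
  refine Fintype.sum_equiv (spinToPerm n w.right) _ _ fun i => ?_
  have hp : ∀ j, spinToPerm n (w * x * w⁻¹).right ^ j =
      spinToPerm n w.right * spinToPerm n x.right ^ j * (spinToPerm n w.right)⁻¹ := by
    intro j
    rw [SemidirectProduct.mul_right, SemidirectProduct.mul_right, SemidirectProduct.inv_right,
      map_mul, map_mul, map_inv, conj_pow]
  have hq : ∀ j, (spinToPerm n (w * x * w⁻¹).right ^ j) (spinToPerm n w.right i) =
      spinToPerm n w.right ((spinToPerm n x.right ^ j) i) := by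
    intro j
    rw [hp, Equiv.Perm.mul_apply, Equiv.Perm.mul_apply, perm_inv_apply_self]
  simp only [hq, (spinToPerm n w.right).injective.eq_iff, ne_eq]
  by_cases hi : (spinToPerm n x.right ^ k) i = i
  swap
  · simp only [hi, false_and]
  have hl : ConjClasses.mk (((w * x * w⁻¹) ^ k).left (spinToPerm n w.right i)) =
      ConjClasses.mk ((x ^ k).left i) := by
    have hi' : (spinToPerm n (x ^ k).right)⁻¹ i = i := by
      rw [pow_right, map_pow, Equiv.Perm.inv_eq_iff_eq, hi]
    rw [conj_pow, mul_left_apply, mul_left_apply, perm_inv_apply_self,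
      SemidirectProduct.mul_right, map_mul, mul_inv_rev, Equiv.Perm.mul_apply,
      perm_inv_apply_self, hi']
    have h1 : (w * w⁻¹).left (spinToPerm n w.right i) = 1 := by rw [mul_inv_cancel]; rfl
    rw [mul_left_apply, perm_inv_apply_self] at h1
    rw [eq_inv_of_mul_eq_one_right h1]
    exact (ConjClasses.mk_eq_mk_iff_isConj.2 (isConj_iff.2 ⟨_, rfl⟩)).symm
  rw [hl]

theorem wz_pow_mul_left (m : ℕ) (y : SpinWreathProduct Γ n) : (wz Γ n ^ m * y).left = y.left := by
  induction m with
  | zero => rw [pow_zero, one_mul]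
  | succ m ih => rw [pow_succ', mul_assoc, wz_mul_left, ih]

/-- The statistic therefore separates representatives even up to sign. -/
theorem cycleStat_wz (k : ℕ) (c : ConjClasses Γ) (x : SpinWreathProduct Γ n) :
    cycleStat k c (wz Γ n * x) = cycleStat k c x := by
  have h1 : ((wz Γ n * x) ^ k).left = (x ^ k).left := by
    rw [(show Commute (wz Γ n) x from wz_central x).mul_pow, wz_pow_mul_left]
  have h2 : spinToPerm n (wz Γ n * x).right = spinToPerm n x.right := by
    rw [wz_mul_right, map_mul, spinToPerm_sz, one_mul]
  classical
  refine Finset.sum_congr rfl fun i _ => if_congr ?_ rfl rfl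
  rw [h1, h2]

theorem join_pow (h : k + l = N) {x : SpinWreathProduct Γ k} (hx : par x = 0)
    (y : SpinWreathProduct Γ l) (m : ℕ) : join h x y ^ m = join h (x ^ m) (y ^ m) := by
  have c := wEmbed_comm h.le y x
  rw [hx, mul_zero, zpar_zero, mul_one] at c
  rw [join_eq, join_eq, (show Commute _ _ from c.symm).mul_pow, map_pow, map_pow]

theorem cycleStat_join (h : k + l = N) {x : SpinWreathProduct Γ k} (hx : par x = 0)
    (y : SpinWreathProduct Γ l) (m : ℕ) (c : ConjClasses Γ) :
    cycleStat m c (join h x y) = cycleStat m c x + cycleStat m c y := by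
  classical
  subst h
  have h1 : ∀ j i, (spinToPerm (k + l) (join rfl x y).right ^ j) (finFst rfl i) =
      finFst rfl ((spinToPerm k x.right ^ j) i) := by
    intro j i
    rw [← map_pow, ← pow_right, join_pow rfl hx, join_perm_fst, pow_right, map_pow]
  have h2 : ∀ j i, (spinToPerm (k + l) (join rfl x y).right ^ j) (finSnd rfl i) =
      finSnd rfl ((spinToPerm l y.right ^ j) i) := by
    intro j i
    rw [← map_pow, ← pow_right, join_pow rfl hx, join_perm_snd, pow_right, map_pow]
  rw [cycleStat, Fin.sum_univ_add]
  have e1 : ∀ i : Fin k, Fin.castAdd l i = finFst rfl i := fun i => rfl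
  have e2 : ∀ i : Fin l, Fin.natAdd k i = finSnd rfl i := fun i => rfl
  simp only [e1, e2, h1, h2, (finFst_injective (rfl : k + l = k + l)).eq_iff, ne_eq,
    (finSnd_injective (rfl : k + l = k + l)).eq_iff, join_pow rfl hx, join_left_fst, join_left_snd]
  rfl

theorem cycElt_pow_left_last (ε : ℕ → ℕ) (k : ℕ) (γ : Γ) (j : ℕ) (hj : j ≤ k) :
    ((cycElt ε (k + 1) γ) ^ (j + 1)).left (Fin.last k) = γ := by
  induction j with
  | zero => simp [cycElt]
  | succ j ih =>
    rw [pow_succ, mul_left_apply, ih (by omega), pow_right, map_pow]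
    have : (spinToPerm (k + 1) (cycElt ε (k + 1) γ).right ^ (j + 1))⁻¹ (Fin.last k) =
        ⟨k - (j + 1), by omega⟩ := by
      rw [Equiv.Perm.inv_eq_iff_eq]
      refine Fin.ext ?_
      simp only [cycElt]
      rw [spinToPerm_cycleLift_pow, Nat.mod_eq_of_lt] <;> simp <;> omega
    rw [this]
    simp only [cycElt]
    rw [if_neg (by omega), mul_one]

/-- Comparing the left components of x·x^m and x^m·x at the image of i shows that cycle products
read from consecutive letters of a cycle are conjugate. -/
theorem mk_pow_left_perm (x : SpinWreathProduct Γ n) (m : ℕ) (i : Fin n)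
    (hi : (spinToPerm n x.right ^ m) (spinToPerm n x.right i) = spinToPerm n x.right i) :
    ConjClasses.mk ((x ^ m).left (spinToPerm n x.right i)) = ConjClasses.mk ((x ^ m).left i) := by
  have h := congrArg (fun y : SpinWreathProduct Γ n => y.left (spinToPerm n x.right i))
    ((pow_succ' x m).symm.trans (pow_succ x m))
  simp only [mul_left_apply] at h
  rw [perm_inv_apply_self, pow_right, map_pow, Equiv.Perm.inv_eq_iff_eq.2 hi.symm] at h
  exact (ConjClasses.mk_eq_mk_iff_isConj.2 (isConj_iff.2 ⟨_, by rw [h, mul_inv_cancel_right]⟩)).symm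

/-- At the last letter the cycle product is γ itself; the other letters follow by going backwards
along the cycle. -/
theorem mk_cycElt_pow_left (ε : ℕ → ℕ) (k : ℕ) (γ : Γ) (i : Fin k) :
    ConjClasses.mk (((cycElt ε k γ) ^ k).left i) = ConjClasses.mk γ := by
  rcases k with _ | k
  · exact i.elim0
  have hs : ∀ j : Fin (k + 1), ConjClasses.mk (((cycElt ε (k + 1) γ) ^ (k + 1)).left
      (spinToPerm (k + 1) (cycElt ε (k + 1) γ).right j)) =
        ConjClasses.mk (((cycElt ε (k + 1) γ) ^ (k + 1)).left j) := by
    intro j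
    refine mk_pow_left_perm _ _ _ (Fin.ext ?_)
    simp only [cycElt]
    rw [spinToPerm_cycleLift_pow, Nat.add_mod_right, Nat.mod_eq_of_lt (Fin.is_lt _)]
  induction i using Fin.reverseInduction with
  | last => rw [cycElt_pow_left_last ε k γ k le_rfl]
  | cast i ih =>
    have e : spinToPerm (k + 1) (cycElt ε (k + 1) γ).right i.castSucc = i.succ := by
      refine Fin.ext ?_
      simp only [cycElt]
      rw [spinToPerm_cycleLift_full, Nat.mod_eq_of_lt] <;> simp
    rw [← hs, e, ih]

open Classical in
theorem cycleStat_cycElt (ε : ℕ → ℕ) {k m : ℕ} (hk : 0 < k) (hm : 0 < m) (γ : Γ)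
    (c : ConjClasses Γ) : cycleStat m c (cycElt ε k γ) =
      if ConjClasses.mk γ = c ∧ k = m then m else 0 := by
  have hp : ∀ j (i : Fin k), (spinToPerm k (cycElt ε k γ).right ^ j) i = i ↔ k ∣ j := by
    intro j i
    simp only [cycElt]
    rw [Fin.ext_iff, spinToPerm_cycleLift_pow]
    constructor
    · intro h
      have h1 : i.1 + j ≡ i.1 + 0 [MOD k] := by
        rw [Nat.ModEq, h, add_zero, Nat.mod_eq_of_lt i.2]
      exact (Nat.modEq_zero_iff_dvd.1 (Nat.ModEq.add_left_cancel' _ h1))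
    · rintro ⟨r, rfl⟩
      rw [Nat.add_mul_mod_self_left, Nat.mod_eq_of_lt i.2]
  simp only [cycleStat, hp, ne_eq]
  by_cases h : k = m
  · subst h
    have h1 : ∀ j, 0 < j → j < k → ¬ k ∣ j := fun j h1 h2 h3 =>
      absurd (Nat.le_of_dvd h1 h3) (by omega)
    simp only [dvd_refl, true_and, mk_cycElt_pow_left, and_true]
    split_ifs with h2 h3 h3
    · simp
    · exact absurd h2.2 h3
    · exact absurd ⟨h1, h3⟩ h2
    · simp
  · rw [if_neg (fun h' => h h'.2)]
    refine Finset.sum_eq_zero fun i _ => if_neg ?_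
    rintro ⟨h1, h2, -⟩
    rcases lt_or_eq_of_le (Nat.le_of_dvd hm h1) with h3 | h3
    · exact h2 k hk h3 (dvd_refl k)
    · exact h h3

theorem cycleStat_rowList [DecidableEq (Row Γ)] (ε : ℕ → ℕ) (a : Row Γ) : ∀ L : List (Row Γ),
    cycleStat a.2.1 a.1 (listElt ε (listSize (rowList L)) (rowList L)) =
      a.2.1 * (L : Multiset (Row Γ)).count a
  | [] => by
    have : IsEmpty (Fin (listSize (rowList ([] : List (Row Γ))))) :=
      (inferInstance : IsEmpty (Fin 0))
    simp [cycleStat]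
  | b :: L => by
    classical
    have ih := cycleStat_rowList ε a L
    have e : rowList (b :: L) = (b.1, b.2.1) :: rowList L := rfl
    rw [e, listElt_cons ε (listSize_cons _ _).symm
      (fun p hp => (odd_of_mem_rowList p hp).pos), cycleStat_join _ (par_cycElt ε b.2.2 _), ih,
      cycleStat_cycElt ε b.2.2.pos a.2.2.pos, ← Multiset.cons_coe, Multiset.count_cons,
      show ConjClasses.mk (Quotient.out b.1) = b.1 from Quotient.out_eq b.1]
    have h : (b.1 = a.1 ∧ b.2.1 = a.2.1) ↔ a = b := by
      rw [eq_comm (a := a), Prod.ext_iff, Subtype.ext_iff]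
    simp only [h]
    split_ifs <;> ring

theorem cycleStat_rowElt [DecidableEq (Row Γ)] (ε : ℕ → ℕ) (a : Row Γ) {s : Multiset (Row Γ)}
    (hs : rowSize s = n) : cycleStat a.2.1 a.1 (rowElt ε n s) = a.2.1 * s.count a := by
  have h := cycleStat_rowList ε a s.toList
  rw [Multiset.coe_toList] at h
  rw [← h]
  have e := listSize_rowList_toList s
  rw [hs] at e
  rw [← e]; rfl

/-- The multiplicity of a row is its cycle statistic divided by its length. -/
theorem eq_of_conj_rowElt (ε : ℕ → ℕ) {s t : Multiset (Row Γ)} (hs : rowSize s = n)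
    (ht : rowSize t = n) (w : SpinWreathProduct Γ n)
    (h : w * rowElt ε n s * w⁻¹ = rowElt ε n t ∨ w * rowElt ε n s * w⁻¹ = wz Γ n * rowElt ε n t) :
    s = t := by
  classical
  have h1 : ∀ k c, cycleStat k c (rowElt ε n s) = cycleStat k c (rowElt ε n t) := by
    intro k c
    rw [← cycleStat_conj k c w]
    rcases h with h | h
    · rw [h]
    · rw [h, cycleStat_wz]
  refine Multiset.ext.2 fun a => ?_
  have h2 := h1 a.2.1 a.1
  rw [cycleStat_rowElt ε a hs, cycleStat_rowElt ε a ht] at h2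
  exact Nat.eq_of_mul_eq_mul_left a.2.2.pos h2

theorem oddOrder_rowElt (ε : ℕ → ℕ) {s : Multiset (Row Γ)} (hs : rowSize s = n) :
    ∃ e, OddOrder e (rowElt ε n s).right := by
  have e := listSize_rowList_toList s
  rw [hs] at e
  subst e
  exact oddOrder_listElt ε _ odd_of_mem_rowList

theorem par_rowElt (ε : ℕ → ℕ) {s : Multiset (Row Γ)} (hs : rowSize s = n) :
    par (rowElt ε n s) = 0 := by
  have e := listSize_rowList_toList s
  rw [hs] at e
  subst e
  exact par_listElt ε _ odd_of_mem_rowList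

end Statistics

/-! ### Spin super class functions are determined by their values at the representatives -/

section Dual
variable {Γ : Type u} [Group Γ] [Finite Γ] {n : ℕ}

theorem RMinus.eq_zero_of_values (ε : ℕ → ℕ) (f : RMinus Γ n)
    (hf : ∀ s ∈ rowSets Γ n, f.1 (rowElt ε n s) = 0) : f = 0 := by
  -- The complex conjugate of f is again a spin super class function, and the inner product formula
  -- for the pair says that the average of |f|² is zero.
  let h : RMinus Γ n := ⟨fun x => starRingEnd ℂ (f.1 x), fun g x => by simp only [f.2.1],
    fun x => by simp only [f.2.2.1, map_neg], fun x hx => by simp only [f.2.2.2 x hx, map_zero]⟩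
  have h1 := average_mul ε n f h
  rw [Finset.sum_eq_zero (fun s hs => by rw [hf s hs, zero_mul, zero_div]), average,
    mul_eq_zero] at h1
  have h2 := h1.resolve_left (inv_ne_zero (by exact_mod_cast Nat.card_pos.ne'))
  have h3 : ∀ x, f.1 x * h.1 x = ((Complex.normSq (f.1 x) : ℝ) : ℂ) := fun x =>
    Complex.mul_conj _
  simp only [h3] at h2
  rw [← Complex.ofReal_sum, Complex.ofReal_eq_zero,
    Finset.sum_eq_zero_iff_of_nonneg fun x _ => Complex.normSq_nonneg _] at h2
  exact Subtype.ext (funext fun x => Complex.normSq_eq_zero.1 (h2 x (Finset.mem_univ x)))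

open Classical in
/-- The class function supported on the class of `x` and of `z x`. -/
noncomputable def classFun (x₀ : SpinWreathProduct Γ n) (h0 : par x₀ = 0) : RMinus Γ n :=
  ⟨fun x => ∑ w, ((if w * x₀ * w⁻¹ = x then 1 else 0) -
      (if w * x₀ * w⁻¹ = wz Γ n * x then 1 else 0)), by
    refine ⟨fun g x => ?_, fun x => ?_, fun x hx => ?_⟩
    · refine Fintype.sum_equiv (Equiv.mulLeft g⁻¹) _ _ fun w => ?_
      have e : ∀ y, w * x₀ * w⁻¹ = g * y * g⁻¹ ↔ g⁻¹ * w * x₀ * (g⁻¹ * w)⁻¹ = y := by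
        intro y
        have e' : g⁻¹ * w * x₀ * (g⁻¹ * w)⁻¹ = g⁻¹ * (w * x₀ * w⁻¹) * g := by group
        rw [e']
        constructor
        · intro h; rw [h]; group
        · intro h; rw [← h]; group
      have e' : wz Γ n * (g * x * g⁻¹) = g * (wz Γ n * x) * g⁻¹ := by
        rw [← mul_assoc, ← mul_assoc, wz_central g, ← mul_assoc]
      simp only [e', e, Equiv.coe_mulLeft]
      congr!
    · rw [← Finset.sum_neg_distrib]
      refine Finset.sum_congr rfl fun w _ => ?_
      rw [← mul_assoc, wz_sq, one_mul, neg_sub]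
    · refine Finset.sum_eq_zero fun w _ => ?_
      have hp : ∀ b : ZMod 2, b + 0 + b = 0 := by decide
      rw [if_neg, if_neg, sub_zero]
      · intro h
        have := congrArg par h
        rw [par_mul, par_mul, par_inv, h0, hp, par_mul, par_wz, hx] at this
        exact absurd this (by decide)
      · intro h
        have := congrArg par h
        rw [par_mul, par_mul, par_inv, h0, hp, hx] at this
        exact absurd this (by decide)⟩

-- The function supported on the class of the representative of s and, with opposite sign, on z
-- times it does not cancel at s, by the odd order argument. It vanishes at the other
-- representatives because the cycle statistics differ.
open Classical in
theorem exists_dual (ε : ℕ → ℕ) {s : Multiset (Row Γ)} (hs : s ∈ rowSets Γ n) :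
    ∃ f : RMinus Γ n, ∀ t ∈ rowSets Γ n, f.1 (rowElt ε n t) = if t = s then 1 else 0 := by
  rw [mem_rowSets] at hs
  have hne : (classFun (rowElt ε n s) (par_rowElt ε hs)).1 (rowElt ε n s) ≠ 0 := by
    have h1 : ∀ w, w * rowElt ε n s * w⁻¹ ≠ wz Γ n * rowElt ε n s := by
      intro w hw
      obtain ⟨e, he⟩ := oddOrder_rowElt ε hs
      exact he.not_conj he w.right (congrArg SemidirectProduct.right hw)
    simp only [classFun, h1, if_false, sub_zero]
    rw [Finset.sum_boole, Nat.cast_ne_zero, Finset.card_ne_zero]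
    exact ⟨1, by simp⟩
  refine ⟨((classFun (rowElt ε n s) (par_rowElt ε hs)).1 (rowElt ε n s))⁻¹ •
    classFun (rowElt ε n s) (par_rowElt ε hs), fun t ht => ?_⟩
  rw [mem_rowSets] at ht
  rw [Submodule.coe_smul, Pi.smul_apply, smul_eq_mul]
  split_ifs with h
  · subst h; exact inv_mul_cancel₀ hne
  · rw [mul_eq_zero]; right
    refine Finset.sum_eq_zero fun w _ => ?_
    rw [if_neg, if_neg, sub_zero]
    · exact fun hw => h (eq_of_conj_rowElt ε hs ht w (Or.inr hw)).symm
    · exact fun hw => h (eq_of_conj_rowElt ε hs ht w (Or.inl hw)).symm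

end Dual

/-! ### Irreducible characters span the class functions -/

section CharactersSpan

open Representation

variable {Γ : Type u} [Group Γ]

theorem irreducible_of_equiv {V W : Type*} [AddCommGroup V] [Module ℂ V] [AddCommGroup W]
    [Module ℂ W] {ρ : Representation ℂ Γ V} {σ : Representation ℂ Γ W} (φ : ρ.Equiv σ)
    (h : ρ.IsIrreducible) : σ.IsIrreducible := by
  rw [irreducible_iff_isSimpleModule_asModule] at h ⊢
  let F := IntertwiningMap.equivLinearMapAsModule ρ σ φ.toIntertwiningMap
  have hF : Function.Bijective F := EquivLike.bijective φ
  exact IsSimpleModule.congr (LinearEquiv.ofBijective F hF).symm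

/-- The character of an irreducible representation on an arbitrary finite-dimensional space. -/
theorem exists_irrChar {V : Type*} [AddCommGroup V] [Module ℂ V] [FiniteDimensional ℂ V]
    (σ : Representation ℂ Γ V) (hσ : σ.IsIrreducible) : ∃ χ : IrrChar Γ, χ.1 = σ.character := by
  let b := (Module.finBasis ℂ V).equivFun
  let ρ : Representation ℂ Γ (Fin (Module.finrank ℂ V) → ℂ) :=
    ((b.conjAlgEquiv ℂ : _ →* _)).comp σ
  let φ : σ.Equiv ρ := Representation.Equiv.mk b (fun g => by
    ext x
    simp [ρ, LinearEquiv.conjAlgEquiv_apply])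
  exact ⟨⟨ρ.character, _, ρ, irreducible_of_equiv φ hσ, rfl⟩, (char_iso φ).symm⟩

variable [Fintype Γ] {f : Γ → ℂ}

/-- As f is a class function, the operator commutes with Γ, so it is a scalar by Schur's lemma. Its
trace is zero by hypothesis and the dimension is nonzero, hence the scalar is zero. -/
theorem sum_smul_eq_zero_of_irreducible (hf : ∀ g x, f (g * x * g⁻¹) = f x)
    (h0 : ∀ χ : IrrChar Γ, ∑ g, f g * χ.1 g = 0)
    {V : Type*} [AddCommGroup V] [Module ℂ V] [FiniteDimensional ℂ V]
    (σ : Representation ℂ Γ V) [hσ : σ.IsIrreducible] : ∑ g, f g • σ g = 0 := by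
  let T : IntertwiningMap σ σ := ⟨∑ g, f g • σ g, fun a => by
    change (∑ g, f g • σ g) * σ a = σ a * ∑ g, f g • σ g
    rw [Finset.sum_mul, Finset.mul_sum]
    refine Fintype.sum_equiv (MulAut.conj a⁻¹).toEquiv _ _ fun g => ?_
    simp only [MulEquiv.toEquiv_eq_coe, EquivLike.coe_coe, MulAut.conj_apply, hf]
    rw [smul_mul_assoc, mul_smul_comm, ← map_mul, ← map_mul]
    congr 2
    group⟩
  obtain ⟨c, hc⟩ :=
    (IsIrreducible.algebraMap_intertwiningMap_bijective_of_isAlgClosed (ρ := σ)).2 T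
  have hT : ∑ g, f g • σ g = c • (1 : V →ₗ[ℂ] V) :=
    (congrArg IntertwiningMap.toLinearMap hc).symm
  obtain ⟨χ, hχ⟩ := exists_irrChar σ hσ
  have htr := congrArg (LinearMap.trace ℂ V) hT
  have e : LinearMap.trace ℂ V (∑ g, f g • σ g) = 0 := by
    rw [← h0 χ, hχ, map_sum]
    simp [character]
  rw [e, map_smul, LinearMap.trace_one] at htr
  have : Nontrivial V := by
    have := (irreducible_iff_isSimpleModule_asModule σ).1 hσ
    exact IsSimpleModule.nontrivial (MonoidAlgebra ℂ Γ) σ.asModule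
  rcases smul_eq_zero.1 htr.symm with h | h
  · rw [hT, h, zero_smul]
  · exact absurd h (by exact_mod_cast Module.finrank_pos.ne')

theorem sum_single_smul_eq_zero (hf : ∀ g x, f (g * x * g⁻¹) = f x)
    (h0 : ∀ χ : IrrChar Γ, ∑ g, f g * χ.1 g = 0) {M : Type*} [AddCommGroup M] [Module ℂ M]
    [Module (MonoidAlgebra ℂ Γ) M] [IsScalarTower ℂ (MonoidAlgebra ℂ Γ) M]
    [IsSimpleModule (MonoidAlgebra ℂ Γ) M] [FiniteDimensional ℂ M] (m : M) :
    (∑ g, MonoidAlgebra.single g (f g)) • m = 0 := by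
  let σ : Representation ℂ Γ M := ofModule' M
  have hs : σ.asAlgebraHom = Algebra.lsmul ℂ ℂ M :=
    (MonoidAlgebra.lift ℂ (M →ₗ[ℂ] M) Γ).apply_symm_apply _
  have hσ : σ.IsIrreducible := by
    rw [irreducible_iff_isSimpleModule_asModule]
    refine IsSimpleModule.congr (M := σ.asModule) (N := M)
      { σ.asModuleEquiv with
        map_smul' := fun r x => ?_ }
    refine (asModuleEquiv_map_smul σ r x).trans ?_
    rw [hs]
    rfl
  have h := sum_smul_eq_zero_of_irreducible hf h0 σ
  have e : σ.asAlgebraHom (∑ g, MonoidAlgebra.single g (f g)) = 0 := by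
    rw [map_sum, ← h]
    simp [asAlgebraHom_single]
  rw [hs] at e
  exact LinearMap.congr_fun e m

/-- The element Σ f(g) g kills every simple submodule of the group algebra. By semisimplicity
(Maschke) it kills the whole algebra, in particular 1, so all its coefficients vanish. -/
theorem eq_zero_of_sum_irrChar (hf : ∀ g x, f (g * x * g⁻¹) = f x)
    (h0 : ∀ χ : IrrChar Γ, ∑ g, f g * χ.1 g = 0) : f = 0 := by
  classical
  have hne : NeZero (Nat.card Γ : ℂ) := ⟨by exact_mod_cast Nat.card_pos.ne'⟩
  let z : MonoidAlgebra ℂ Γ := ∑ g, MonoidAlgebra.single g (f g)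
  have key : ∀ m : MonoidAlgebra ℂ Γ, z * m = 0 := by
    intro m
    have hm : m ∈ sSup {N : Submodule (MonoidAlgebra ℂ Γ) (MonoidAlgebra ℂ Γ) |
        IsSimpleModule (MonoidAlgebra ℂ Γ) N} := by
      rw [IsSemisimpleModule.sSup_simples_eq_top]
      trivial
    rw [sSup_eq_iSup'] at hm
    induction hm using Submodule.iSup_induction' with
    | mem N m hm =>
      obtain ⟨N, hN⟩ := N
      have hN' : IsSimpleModule (MonoidAlgebra ℂ Γ) N := hN
      have : Module.Finite ℂ (MonoidAlgebra ℂ Γ) :=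
        Module.Finite.equiv (MonoidAlgebra.coeffLinearEquiv (S := ℂ) (M := Γ) ℂ).symm
      have : FiniteDimensional ℂ N :=
        FiniteDimensional.of_injective (N.subtype.restrictScalars ℂ) Subtype.val_injective
      exact congrArg Subtype.val (sum_single_smul_eq_zero hf h0 (⟨m, hm⟩ : N))
    | zero => exact mul_zero z
    | add x y _ _ hx hy => rw [mul_add, hx, hy, add_zero]
  have h1 := key 1
  rw [mul_one] at h1
  funext g
  have := congrArg (fun a : MonoidAlgebra ℂ Γ => a.coeff g) h1
  simpa [z, Finsupp.single_apply] using this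

end CharactersSpan

/-! ### The basis of generators attached to the conjugacy classes -/

section ClassBasis

variable {Γ : Type u} [Group Γ]

theorem IrrChar.conj (χ : IrrChar Γ) (g x : Γ) : χ.1 (g * x * g⁻¹) = χ.1 x := by
  obtain ⟨χ, k, ρ, hρ, rfl⟩ := χ
  exact Representation.char_conj ρ x g

theorem IrrChar.eq_of_isConj (χ : IrrChar Γ) {x y : Γ} (h : IsConj x y) : χ.1 x = χ.1 y := by
  obtain ⟨g, rfl⟩ := isConj_iff.1 h
  exact (χ.conj g x).symm

theorem isConj_out_mk (g : Γ) : IsConj (Quotient.out (ConjClasses.mk g)) g :=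
  ConjClasses.mk_eq_mk_iff_isConj.1 (Quotient.out_eq (ConjClasses.mk g))

theorem isConj_inv {x y : Γ} (h : IsConj x y) : IsConj x⁻¹ y⁻¹ := by
  obtain ⟨g, rfl⟩ := isConj_iff.1 h
  exact isConj_iff.2 ⟨g, by group⟩

theorem classInv_involutive : Function.Involutive (classInv (Γ := Γ)) := by
  intro c
  induction c using Quotient.inductionOn with
  | h g => exact congrArg _ (inv_inv g)

variable [Finite Γ]

theorem linearIndependent_irrChar : LinearIndependent ℂ (fun χ : IrrChar Γ => χ.1) := by
  classical
  have := Fintype.ofFinite Γ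
  have hne : (Nat.card Γ : ℂ) ≠ 0 := by exact_mod_cast Nat.card_pos.ne'
  have : Invertible (Nat.card Γ : ℂ) := invertibleOfNonzero hne
  let B : (Γ → ℂ) →ₗ[ℂ] (Γ → ℂ) →ₗ[ℂ] ℂ := LinearMap.mk₂ ℂ (fun f g => ∑ x, f x * g x⁻¹)
    (by intros; simp [add_mul, Finset.sum_add_distrib])
    (by intros; simp [mul_assoc, Finset.mul_sum])
    (by intros; simp [mul_add, Finset.sum_add_distrib])
    (by intros; simp [mul_left_comm, Finset.mul_sum])
  refine LinearMap.linearIndependent_of_isOrthoᵢ (B := B) ?_ ?_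
  · rintro ⟨χ, k, ρ, hρ, rfl⟩ ⟨χ', k', ρ', hρ', rfl⟩ hχ
    have h := Representation.char_orthonormal ρ ρ'
    rw [if_neg] at h
    · exact (mul_eq_zero.1 h).resolve_left (inv_ne_zero hne)
    · rintro ⟨φ⟩
      exact hχ (Subtype.ext (Representation.char_iso φ).symm)
  · rintro ⟨χ, k, ρ, hρ, rfl⟩ h0
    have h := Representation.char_orthonormal ρ ρ
    rw [if_pos ⟨Representation.Equiv.refl ρ⟩] at h
    rw [show ∑ g, ρ.character g * ρ.character g⁻¹ = 0 from h0, mul_zero] at h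
    exact zero_ne_one h

/-- A linear relation with coefficients a_c makes the class function taking g⁻¹ to a_c ζ_c, for g in
c, orthogonal to all irreducible characters, hence zero. The factor ζ_c compensates the weight 1/ζ_c
of a class in the average over Γ. -/
theorem linearIndependent_classValues :
    LinearIndependent ℂ (fun (c : ConjClasses Γ) (χ : IrrChar Γ) => χ.1 (Quotient.out c)⁻¹) := by
  have := Fintype.ofFinite Γ
  rw [Fintype.linearIndependent_iff]
  intro a ha
  have h0 : (fun g : Γ => a (ConjClasses.mk g⁻¹) * zeta (ConjClasses.mk g⁻¹)) = 0 := by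
    refine eq_zero_of_sum_irrChar (fun g x => ?_) fun χ => ?_
    · have e : ConjClasses.mk (g * x * g⁻¹)⁻¹ = ConjClasses.mk x⁻¹ :=
        ConjClasses.mk_eq_mk_iff_isConj.2 (isConj_inv (isConj_iff.2 ⟨g, rfl⟩).symm)
      simp only [e]
    · have h := congrFun ha χ
      have key := inv_card_mul_sum_mk (Γ := Γ) (fun c => a c * zeta c * χ.1 (Quotient.out c)⁻¹)
      have e : ∑ c, (zeta c : ℂ)⁻¹ * (a c * zeta c * χ.1 (Quotient.out c)⁻¹) = 0 := by
        simp only [Finset.sum_apply, Pi.smul_apply, smul_eq_mul, Pi.zero_apply] at h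
        rw [← h]
        refine Finset.sum_congr rfl fun c _ => ?_
        have : (zeta c : ℂ) ≠ 0 := by exact_mod_cast (zeta_pos c).ne'
        field_simp
      rw [e] at key
      have key := (mul_eq_zero.1 key).resolve_left
        (inv_ne_zero (by exact_mod_cast Nat.card_pos.ne'))
      rw [← key]
      refine Fintype.sum_equiv (Equiv.inv Γ) _ _ fun g => ?_
      simp only [Equiv.inv_apply]
      congr 1
      refine χ.eq_of_isConj ?_
      simpa using isConj_inv (isConj_out_mk g⁻¹).symm
  intro c
  have h1 := congrFun h0 (Quotient.out c)⁻¹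
  simp only [inv_inv, Pi.zero_apply] at h1
  rw [show ConjClasses.mk (Quotient.out c) = c from Quotient.out_eq c] at h1
  exact (mul_eq_zero.1 h1).resolve_right (by exact_mod_cast (zeta_pos c).ne')

/-- The rows and the columns of the character table are both linearly independent. -/
theorem card_irrChar : Fintype.card (IrrChar Γ) = Fintype.card (ConjClasses Γ) := by
  refine le_antisymm ?_ ?_
  · have h : LinearIndependent ℂ
        (fun (χ : IrrChar Γ) (c : ConjClasses Γ) => χ.1 (Quotient.out c)) := by
      rw [Fintype.linearIndependent_iff]
      intro a ha
      refine Fintype.linearIndependent_iff.1 (linearIndependent_irrChar (Γ := Γ)) a ?_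
      funext g
      refine Eq.trans ?_ (congrFun ha (ConjClasses.mk g))
      simp only [Finset.sum_apply, Pi.smul_apply]
      exact Finset.sum_congr rfl fun χ _ => by rw [χ.eq_of_isConj (isConj_out_mk g)]
    simpa using h.fintype_card_le_finrank
  · simpa using (linearIndependent_classValues (Γ := Γ)).fintype_card_le_finrank

/-- The basis of `ℂ^Γ^*` given by the values of characters on the conjugacy classes. -/
noncomputable def classBasis : Module.Basis (ConjClasses Γ) ℂ (IrrChar Γ → ℂ) :=
  have : Nonempty (ConjClasses Γ) := ⟨1⟩
  (basisOfLinearIndependentOfCardEqFinrank (linearIndependent_classValues (Γ := Γ))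
    -- Reindexing by inversion of classes anticipates the passage from ρ to ρ̄ in the characteristic
    -- map.
    (by rw [Module.finrank_fintype_fun_eq_card, card_irrChar])).reindex
      (classInv_involutive (Γ := Γ)).toPerm

theorem classBasis_apply (c : ConjClasses Γ) (χ : IrrChar Γ) :
    classBasis c χ = χ.1 (Quotient.out (classInv c))⁻¹ := by
  simp [classBasis]

/-- The basis of the space of generators of `S⁻` such that `(c, k)` corresponds to
`a_{-k}(c⁻¹)`. -/
noncomputable def rowBasis : Module.Basis (Row Γ) ℂ ((OddNat × IrrChar Γ) →₀ ℂ) :=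
  ((Finsupp.basis fun _ : OddNat => (classBasis (Γ := Γ)).map
    (Finsupp.linearEquivFunOnFinite ℂ ℂ (IrrChar Γ)).symm).map
      (Finsupp.curryLinearEquiv (α := OddNat) (β := IrrChar Γ) (M := ℂ) (R := ℂ)).symm).reindex
    ((Equiv.sigmaEquivProd _ _).trans (Equiv.prodComm _ _))

theorem ι_rowBasis (a : Row Γ) :
    SymmetricAlgebra.ι ℂ _ (rowBasis a) = aClass a.2 (classInv a.1) := by
  have : rowBasis a = ∑ χ : IrrChar Γ,
      χ.1 (Quotient.out (classInv a.1))⁻¹ • Finsupp.single (a.2, χ) (1 : ℂ) := by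
    classical
    ext ⟨k, χ⟩
    simp only [rowBasis, Module.Basis.reindex_apply, Module.Basis.map_apply]
    simp [Finsupp.finsetSum_apply, Finsupp.single_apply, Prod.ext_iff, ite_and]
    split_ifs
    · exact classBasis_apply _ _
    · rfl
  rw [this, map_sum, aClass]
  exact Finset.sum_congr rfl fun χ _ => map_smul _ _ _

end ClassBasis

/-! ### The basis of monomials -/

section Monomials

variable {Γ : Type u} [Group Γ] [Finite Γ]

/-- The generator `a_{-k}(c⁻¹)` attached to the row `(c, k)`. -/
noncomputable def aRow (a : Row Γ) : SGamma Γ := aClass a.2 (classInv a.1)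

/-- The monomial attached to a multiset of rows. -/
noncomputable def aMono (s : Multiset (Row Γ)) : SGamma Γ := (s.map aRow).prod

@[simp] theorem aMono_zero : aMono (0 : Multiset (Row Γ)) = 1 := rfl

@[simp] theorem aMono_cons (a : Row Γ) (s : Multiset (Row Γ)) :
    aMono (a ::ₘ s) = aRow a * aMono s := by simp [aMono]

theorem aMono_add (s t : Multiset (Row Γ)) : aMono (s + t) = aMono s * aMono t := by
  simp [aMono]

/-- Substituting c ↦ c⁻¹ in the product moves the bar from the partitions to the classes: a row (c,
k) contributes the generator a_{-k}(c⁻¹). -/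
theorem aPrime_toFam (s : Multiset (Row Γ)) :
    aPrime (fun c => toFam s (classInv c)) = aMono s := by
  have h : aPrime (fun c => toFam s (classInv c)) =
      ∏ c, ((toFam s c).map fun k => aClass k (classInv c)).prod := by
    refine Fintype.prod_equiv (classInv_involutive (Γ := Γ)).toPerm _ _ fun c => ?_
    simp only [Function.Involutive.coe_toPerm, classInv_involutive c]
  rw [h]
  induction s using Multiset.induction with
  | empty => simp
  | cons a s ih =>
    rw [prod_toFam_cons (fun c μ => (μ.map fun k => aClass k (classInv c)).prod) (aRow a) s a
      (by simp [aRow]), aMono_cons, ← ih]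
    refine Fintype.prod_equiv (classInv_involutive (Γ := Γ)).toPerm _ _ fun c => ?_
    simp only [Function.Involutive.coe_toPerm, classInv_involutive c]

/-- The monomials in the `a_{-k}(c)` form a basis of `S⁻`. -/
noncomputable def monoBasis : Module.Basis (Multiset (Row Γ)) ℂ (SGamma Γ) := by
  classical
  exact (rowBasis (Γ := Γ)).symmetricAlgebra.reindex Multiset.toFinsupp.symm.toEquiv

theorem monoBasis_apply (s : Multiset (Row Γ)) : monoBasis s = aMono s := by
  classical
  have h : ∀ s : Multiset (Row Γ), (SymmetricAlgebra.equivMvPolynomial (rowBasis (Γ := Γ))).symm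
      (MvPolynomial.monomial (Multiset.toFinsupp s) 1) = aMono s := by
    intro s
    induction s using Multiset.induction with
    | empty => simp
    | cons a s ih =>
      have : MvPolynomial.monomial (Multiset.toFinsupp (a ::ₘ s)) (1 : ℂ) =
          MvPolynomial.X a * MvPolynomial.monomial (Multiset.toFinsupp s) 1 := by
        rw [← Multiset.singleton_add, map_add, MvPolynomial.X, MvPolynomial.monomial_mul, one_mul,
          Multiset.toFinsupp_singleton]
      rw [this, map_mul, ih, aMono_cons, SymmetricAlgebra.equivMvPolynomial_symm_X, ι_rowBasis, aRow]
  rw [← h]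
  simp [monoBasis, Module.Basis.symmetricAlgebra]

/-- The list of rows used by `ch` is one ordering of the multiset s. With `apply_listElt`, the
enumeration of the classes and the sorting of parts play no further role. -/
theorem exists_rowList_eq_rows (e : Fin (Nat.card (ConjClasses Γ)) ≃ ConjClasses Γ)
    (s : Multiset (Row Γ)) :
    ∃ L : List (Row Γ), rowList L = rows e (toFam s) ∧ (L : Multiset (Row Γ)) = s := by
  have hL : ∀ μ : OddPartition, ∃ L : List OddNat, L.map Subtype.val =
      (μ.map Subtype.val).sort (· ≥ ·) ∧ (L : Multiset OddNat) = μ := by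
    intro μ
    have hodd : ∀ k ∈ (μ.map Subtype.val).sort (· ≥ ·), Odd k := by
      intro k hk
      obtain ⟨a, _, rfl⟩ := Multiset.mem_map.1 ((Multiset.mem_sort _).1 hk)
      exact a.2
    have h1 : (((μ.map Subtype.val).sort (· ≥ ·)).attachWith _ hodd).map Subtype.val =
        (μ.map Subtype.val).sort (· ≥ ·) := List.attachWith_map_subtype_val _
    refine ⟨_, h1, Multiset.map_injective Subtype.val_injective ?_⟩
    rw [Multiset.map_coe, h1, Multiset.sort_eq]
  choose L hL1 hL2 using hL
  refine ⟨(List.finRange _).flatMap fun j => (L (toFam s (e j))).map (Prod.mk (e j)), ?_, ?_⟩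
  · rw [rowList, List.map_flatMap, rows]
    congr 1
    funext j
    rw [← hL1, List.map_map, List.map_map]
    rfl
  · rw [← Multiset.coe_bind]
    refine toFam_injective (Eq.trans (congrArg toFam ?_) (toFam_sum (toFam s)))
    rw [← e.sum_comp, Fin.sum_univ_def, ← Multiset.sum_coe, Multiset.bind, Multiset.join,
      Multiset.map_coe]
    congr 3
    funext j
    rw [← Multiset.map_coe, hL2]

theorem ch_lof (e : Fin (Nat.card (ConjClasses Γ)) ≃ ConjClasses Γ) (ε : ℕ → ℕ) (n : ℕ)
    (f : RMinus Γ n) : ch e ε (DirectSum.lof ℂ ℕ (fun n => RMinus Γ n) n f) =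
      ∑ s ∈ rowSets Γ n, ((Real.sqrt 2 : ℂ) ^ Multiset.card s / (bigZ (toFam s) : ℂ) *
        f.1 (rowElt ε n s)) • aMono s := by
  rw [ch, DirectSum.toModule_lof, LinearMap.sum_apply]
  refine (sum_OPFam n (fun ρ => f.1 (listElt ε n (rows e ρ)) •
    (((Real.sqrt 2 : ℂ) ^ plen ρ / (bigZ ρ : ℂ)) • aPrime fun c => ρ (classInv c)))).trans ?_
  refine Finset.sum_congr rfl fun s hs => ?_
  obtain ⟨L, hL, hs'⟩ := exists_rowList_eq_rows e s
  rw [aPrime_toFam, plen_toFam, ← hL, apply_listElt ε f L (by rw [hs', mem_rowSets.1 hs]), hs',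
    smul_smul, mul_comm]

end Monomials

/-! ### Bijectivity of the characteristic map, units and counits -/

section CharacteristicMap

variable {Γ : Type u} [Group Γ]

@[simp] theorem rowElt_zero (ε : ℕ → ℕ) : rowElt ε 0 (0 : Multiset (Row Γ)) = 1 := by
  refine SemidirectProduct.ext (funext fun i => i.elim0) ?_
  simp [rowElt, rowList, listElt, blockT]

variable [Finite Γ]

/-- The coefficient `2^{l(ρ)/2} / Z_ρ` of the characteristic map. -/
noncomputable def chCoeff (s : Multiset (Row Γ)) : ℂ :=
  (Real.sqrt 2 : ℂ) ^ Multiset.card s / (bigZ (toFam s) : ℂ)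

theorem chCoeff_ne_zero (s : Multiset (Row Γ)) : chCoeff s ≠ 0 := by
  refine div_ne_zero (pow_ne_zero _ ?_) (bigZ_ne_zero s)
  exact_mod_cast (Real.sqrt_pos.2 two_pos).ne'

variable (e : Fin (Nat.card (ConjClasses Γ)) ≃ ConjClasses Γ) (ε : ℕ → ℕ)

theorem ch_lof_eq (n : ℕ) (f : RMinus Γ n) :
    ch e ε (DirectSum.lof ℂ ℕ (fun n => RMinus Γ n) n f) =
      ∑ s ∈ rowSets Γ n, (chCoeff s * f.1 (rowElt ε n s)) • aMono s := ch_lof e ε n f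

theorem ch_injective : Function.Injective (ch e ε) := by
  classical
  -- In the monomial basis `ch` is diagonal: the coordinate at s is a multiple of the value at the
  -- representative of s.
  have key : ∀ (s : Multiset (Row Γ)) (x : RGamma Γ), monoBasis.repr (ch e ε x) s =
      chCoeff s * (x (rowSize s)).1 (rowElt ε (rowSize s) s) := by
    intro s x
    induction x using DirectSum.induction_on with
    | zero => simp
    | add x y hx hy => 
      rw [map_add, map_add, Finsupp.add_apply, hx, hy, DirectSum.add_apply]
      simp [mul_add]
    | of n f =>
      change monoBasis.repr (ch e ε (DirectSum.lof ℂ ℕ (fun n => RMinus Γ n) n f)) s = _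
      rw [ch_lof_eq, map_sum, Finsupp.finsetSum_apply]
      simp only [← monoBasis_apply, map_smul, Module.Basis.repr_self, Finsupp.smul_apply,
        Finsupp.single_apply, smul_eq_mul, mul_ite, mul_one, mul_zero, Finset.sum_ite_eq',
        mem_rowSets]
      split_ifs with h
      · subst h
        rw [DirectSum.of_eq_same]
      · rw [DirectSum.of_eq_of_ne _ _ _ h]
        simp
  rw [injective_iff_map_eq_zero]
  intro x hx
  refine DFinsupp.ext fun n => RMinus.eq_zero_of_values ε _ fun s hs => ?_
  obtain rfl := mem_rowSets.1 hs
  have h := key s x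
  rw [hx, map_zero, Finsupp.zero_apply] at h
  exact (mul_eq_zero.1 h.symm).resolve_left (chCoeff_ne_zero s)

theorem ch_surjective : Function.Surjective (ch e ε) := by
  rw [← LinearMap.range_eq_top, eq_top_iff, ← monoBasis.span_eq, Submodule.span_le]
  rintro _ ⟨s, rfl⟩
  obtain ⟨f, hf⟩ := exists_dual ε (mem_rowSets.2 (rfl : rowSize s = rowSize s))
  refine ⟨(chCoeff s)⁻¹ • DirectSum.lof ℂ ℕ (fun n => RMinus Γ n) (rowSize s) f, ?_⟩
  rw [map_smul, ch_lof_eq, Finset.sum_eq_single s]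
  · rw [hf s (mem_rowSets.2 rfl), if_pos rfl, mul_one, smul_smul,
      inv_mul_cancel₀ (chCoeff_ne_zero s), one_smul, monoBasis_apply]
  · intro t ht hts
    rw [hf t ht, if_neg hts, mul_zero, zero_smul]
  · intro h
    exact absurd (mem_rowSets.2 rfl) h

theorem rowSets_zero : rowSets Γ 0 = {0} := by
  ext s
  rw [mem_rowSets, Finset.mem_singleton]
  refine ⟨fun h => ?_, fun h => by rw [h, rowSize_zero]⟩
  induction s using Multiset.induction with
  | empty => rfl
  | cons a s _ =>
    rw [rowSize_cons] at h
    have := a.2.2.pos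
    omega

@[simp] theorem chCoeff_zero : chCoeff (0 : Multiset (Row Γ)) = 1 := by
  simp [chCoeff, bigZ, zPart]

theorem ch_lof_zero (f : RMinus Γ 0) :
    ch e ε (DirectSum.lof ℂ ℕ (fun n => RMinus Γ n) 0 f) = f.1 1 • 1 := by
  rw [ch_lof_eq, rowSets_zero, Finset.sum_singleton, chCoeff_zero, one_mul, rowElt_zero, aMono_zero]

theorem ch_rOne : ch e ε (rOne Γ) = 1 := by
  rw [rOne, ch_lof_zero]
  have : (unitFun Γ).1 1 = 1 := by simp [unitFun]
  rw [this, one_smul]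

theorem counit_aMono (s : Multiset (Row Γ)) (hs : s ≠ 0) :
    Coalgebra.counit (R := ℂ) (aMono s) = 0 := by
  obtain ⟨a, ha⟩ := Multiset.exists_mem_of_ne_zero hs
  obtain ⟨t, rfl⟩ := Multiset.exists_cons_of_mem ha
  rw [aMono_cons, Bialgebra.counit_mul, aRow, ← ι_rowBasis]
  simp

theorem counit_ch (x : RGamma Γ) : Coalgebra.counit (R := ℂ) (ch e ε x) = rCounit Γ x := by
  induction x using DirectSum.induction_on with
  | zero => simp
  | add x y hx hy => rw [map_add, map_add, map_add, hx, hy]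
  | of n f =>
    change Coalgebra.counit (R := ℂ) (ch e ε (DirectSum.lof ℂ ℕ (fun n => RMinus Γ n) n f)) =
      rCounit Γ (DirectSum.lof ℂ ℕ (fun n => RMinus Γ n) n f)
    rcases Nat.eq_zero_or_pos n with rfl | hn
    · rw [ch_lof_zero, map_smul, Bialgebra.counit_one, smul_eq_mul, mul_one, rCounit]
      simp [DirectSum.component.lof_self]
    · rw [ch_lof_eq, map_sum, Finset.sum_eq_zero]
      · simp [rCounit, DirectSum.component.of, hn.ne']
      · intro s hs
        rw [map_smul, counit_aMono, smul_zero]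
        rintro rfl
        rw [mem_rowSets, rowSize_zero] at hs
        omega

end CharacteristicMap

/-! ### Products -/

section Multiplicativity

theorem average_comp_of_surjective {G H : Type*} [Group G] [Group H] [Fintype G] [Fintype H]
    (π : G →* H) (hπ : Function.Surjective π) (A : H → ℂ) :
    average (fun x => A (π x)) = average A := by
  classical
  have hfib : ∀ h : H, (Finset.univ.filter fun x => π x = h).card =
      (Finset.univ.filter fun x => π x = 1).card := fun h =>
    MonoidHom.card_fiber_eq_of_mem_range π (hπ h) (hπ 1)
  have hsum : ∀ B : H → ℂ, ∑ x, B (π x) =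
      (Finset.univ.filter fun x => π x = 1).card * ∑ h, B h := by
    intro B
    rw [← Finset.sum_fiberwise Finset.univ π, Finset.mul_sum]
    refine Finset.sum_congr rfl fun h _ => ?_
    rw [Finset.sum_congr rfl (g := fun _ => B h) (fun t ht => by rw [(Finset.mem_filter.1 ht).2]),
      Finset.sum_const, nsmul_eq_mul, hfib]
  have h1 := hsum fun _ => 1
  have hG : (Nat.card G : ℂ) ≠ 0 := by exact_mod_cast Nat.card_pos.ne'
  have hH : (Nat.card H : ℂ) ≠ 0 := by exact_mod_cast Nat.card_pos.ne'
  simp only [Finset.sum_const, Finset.card_univ, nsmul_eq_mul, mul_one,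
    ← Nat.card_eq_fintype_card] at h1
  rw [average, average, hsum, h1]
  have hc : ((Finset.univ.filter fun x => π x = 1).card : ℂ) ≠ 0 := by
    intro h; rw [h, zero_mul] at h1; exact hG h1
  field_simp

theorem average_prod {α β : Type*} [Fintype α] [Fintype β] (A : α × β → ℂ) :
    average A = average fun x => average fun y => A (x, y) := by
  simp only [average, Fintype.sum_prod_type, Nat.card_prod, Nat.cast_mul, mul_inv, Finset.mul_sum,
    mul_assoc]

theorem average_equiv {α β : Type*} [Fintype α] [Fintype β] (φ : α ≃ β) (A : β → ℂ) :
    average (fun x => A (φ x)) = average A := by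
  rw [average, average, φ.sum_comp, Nat.card_congr φ]

variable {Γ : Type u} [Group Γ] [Finite Γ] {k l n : ℕ}

/-- The quotient map has fibres of equal size and the twist changes only the multiplication, so
averages over the spin product are iterated averages. -/
theorem average_spinProd (A : SpinProd Γ k l → ℂ) :
    average A = average fun x => average fun y => A (SpinProd.mk x y) := by
  have := Fintype.ofFinite (TwistedProd Γ k l)
  rw [← average_comp_of_surjective (QuotientGroup.mk' (diagZ Γ k l))
    (QuotientGroup.mk'_surjective _) A]
  let φ : SpinWreathProduct Γ k × SpinWreathProduct Γ l ≃ TwistedProd Γ k l :=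
    ⟨fun p => ⟨p.1, p.2⟩, fun p => (p.fst, p.snd), fun _ => rfl, fun _ => rfl⟩
  rw [← average_equiv φ, average_prod]
  rfl

/-- Frobenius reciprocity. -/
theorem average_ind_mul (h : k + l = n) (F : RMinusProd Γ k l) (d : RMinus Γ n) :
    average (fun x => (ind Γ h F).1 x * d.1 x) =
      average fun w => F.1 w * d.1 (prodEmbed Γ h w) := by
  classical
  have h1 : ∀ x, (ind Γ h F).1 x = (Nat.card (SpinProd Γ k l) : ℂ)⁻¹ *
      ∑ g : SpinWreathProduct Γ n, ∑ w : SpinProd Γ k l,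
        if prodEmbed Γ h w = g⁻¹ * x * g then F.1 w else 0 := by
    intro x
    simp only [ind, LinearMap.coe_mk, AddHom.coe_mk]
  have h2 : ∀ (g : SpinWreathProduct Γ n) (w : SpinProd Γ k l),
      ∑ x, (if prodEmbed Γ h w = g⁻¹ * x * g then F.1 w else 0) * d.1 x =
        F.1 w * d.1 (prodEmbed Γ h w) := by
    intro g w
    -- For fixed g and w only one x contributes, and d, being a class function, takes the same value
    -- at x as at the image of w.
    rw [Finset.sum_eq_single (g * prodEmbed Γ h w * g⁻¹)]
    · rw [if_pos (by group), d.2.1]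
    · intro x _ hx
      rw [if_neg, zero_mul]
      intro e
      exact hx (by rw [e]; group)
    · simp
  have h3 : ∑ x, (ind Γ h F).1 x * d.1 x = (Nat.card (SpinProd Γ k l) : ℂ)⁻¹ *
      ∑ g : SpinWreathProduct Γ n, ∑ w : SpinProd Γ k l, F.1 w * d.1 (prodEmbed Γ h w) := by
    rw [Finset.mul_sum, Finset.sum_congr rfl fun x _ => by rw [h1, mul_assoc], ← Finset.mul_sum,
      ← Finset.mul_sum]
    congr 1
    simp only [Finset.sum_mul]
    rw [Finset.sum_comm]
    refine Finset.sum_congr rfl fun g _ => ?_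
    rw [Finset.sum_comm]
    exact Finset.sum_congr rfl fun w _ => h2 g w
  have hG : (Nat.card (SpinWreathProduct Γ n) : ℂ) ≠ 0 := by exact_mod_cast Nat.card_pos.ne'
  rw [average, average, h3, Finset.sum_const, Finset.card_univ, nsmul_eq_mul,
    ← Nat.card_eq_fintype_card]
  field_simp

variable (ε : ℕ → ℕ)

/-- The induced function is paired with the function d dual to s. The inner product formula turns
the pairing into the left-hand side. Frobenius reciprocity turns it into an iterated average, to
which the formula applies in each variable; the value of d at u joined with t tests whether u + t =
s. -/
theorem ind_phi_rowElt (h : k + l = n) (f : RMinus Γ k) (g : RMinus Γ l)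
    [DecidableEq (Multiset (Row Γ))] {s : Multiset (Row Γ)} (hs : rowSize s = n) :
    (ind Γ h (phi Γ k l (f ⊗ₜ g))).1 (rowElt ε n s) / (bigZ (toFam s) : ℂ) =
      ∑ u ∈ rowSets Γ k, ∑ t ∈ rowSets Γ l, if u + t = s then
        f.1 (rowElt ε k u) * g.1 (rowElt ε l t) / (bigZ (toFam u) * bigZ (toFam t) : ℂ) else 0 := by
  have hs := mem_rowSets.2 hs
  obtain ⟨d, hd⟩ := exists_dual ε hs
  have hd' : ∀ u ∈ rowSets Γ k, ∀ t ∈ rowSets Γ l,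
      d.1 (join h (rowElt ε k u) (rowElt ε l t)) = if u + t = s then 1 else 0 := by
    intro u hu t ht
    rw [mem_rowSets] at hu ht
    rw [join_rowElt ε h d hu ht, hd _ (by rw [mem_rowSets, rowSize_add, hu, ht, h])]
    split_ifs <;> rfl
  have h1 := average_ind_mul h (phi Γ k l (f ⊗ₜ g)) d
  rw [average_mul ε, Finset.sum_eq_single s] at h1
  rotate_left
  · intro t ht hts
    rw [hd t ht, if_neg hts, mul_zero, zero_div]
  · exact fun h => absurd hs h
  rw [hd s hs, if_pos rfl, mul_one] at h1
  rw [h1, average_spinProd]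
  simp only [phi_tmul]
  have h2 : ∀ x, (average fun y => f.1 x * g.1 y * d.1 (prodEmbed Γ h (SpinProd.mk x y))) =
      f.1 x * ∑ t ∈ rowSets Γ l, g.1 (rowElt ε l t) * d.1 (join h x (rowElt ε l t)) /
        (bigZ (toFam t) : ℂ) := by
    intro x
    have := average_mul ε l g ⟨_, slice_snd h d x⟩
    rw [← this]
    simp only [average, mul_assoc, ← Finset.mul_sum]
    rw [mul_left_comm]
    rfl
  simp only [h2]
  have h3 : (average fun x => f.1 x * ∑ t ∈ rowSets Γ l, g.1 (rowElt ε l t) *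
      d.1 (join h x (rowElt ε l t)) / (bigZ (toFam t) : ℂ)) =
      ∑ t ∈ rowSets Γ l, g.1 (rowElt ε l t) / (bigZ (toFam t) : ℂ) *
        average fun x => f.1 x * d.1 (join h x (rowElt ε l t)) := by
    simp only [average, Finset.mul_sum]
    rw [Finset.sum_comm]
    refine Finset.sum_congr rfl fun t _ => Finset.sum_congr rfl fun x _ => ?_
    ring
  rw [h3, Finset.sum_comm]
  refine Finset.sum_congr rfl fun t ht => ?_
  rw [average_mul ε k f ⟨_, slice_fst h d (rowElt ε l t)⟩, Finset.mul_sum]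
  refine Finset.sum_congr rfl fun u hu => ?_
  simp only
  rw [hd' u hu t ht]
  split_ifs
  · field_simp
  · simp

variable (e : Fin (Nat.card (ConjClasses Γ)) ≃ ConjClasses Γ)

/-- Length and monomial are additive and multiplicative in the multiset, so the value formula for
induction becomes the product of two sums. -/
theorem ch_ind_phi (h : k + l = n) (f : RMinus Γ k) (g : RMinus Γ l) :
    ch e ε (DirectSum.lof ℂ ℕ (fun n => RMinus Γ n) n (ind Γ h (phi Γ k l (f ⊗ₜ g)))) =
      ch e ε (DirectSum.lof ℂ ℕ (fun n => RMinus Γ n) k f) *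
        ch e ε (DirectSum.lof ℂ ℕ (fun n => RMinus Γ n) l g) := by
  classical
  rw [ch_lof_eq, ch_lof_eq, ch_lof_eq, Finset.sum_mul_sum]
  have h1 : ∀ s ∈ rowSets Γ n, (chCoeff s * (ind Γ h (phi Γ k l (f ⊗ₜ g))).1 (rowElt ε n s)) •
      aMono s = ∑ u ∈ rowSets Γ k, ∑ t ∈ rowSets Γ l, if u + t = s then
        ((chCoeff u * f.1 (rowElt ε k u)) • aMono u) *
          ((chCoeff t * g.1 (rowElt ε l t)) • aMono t) else 0 := by
    intro s hs
    have := ind_phi_rowElt ε h f g (mem_rowSets.1 hs)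
    rw [chCoeff, div_mul_eq_mul_div, mul_div_assoc, this, Finset.mul_sum, Finset.sum_smul]
    refine Finset.sum_congr rfl fun u _ => ?_
    rw [Finset.mul_sum, Finset.sum_smul]
    refine Finset.sum_congr rfl fun t _ => ?_
    split_ifs with hut
    · rw [smul_mul_smul_comm, ← aMono_add, hut, chCoeff, chCoeff, ← hut, Multiset.card_add, pow_add]
      congr 1
      ring
    · simp
  rw [Finset.sum_congr rfl h1, Finset.sum_comm]
  refine Finset.sum_congr rfl fun u hu => ?_
  rw [Finset.sum_comm]
  refine Finset.sum_congr rfl fun t ht => ?_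
  rw [Finset.sum_ite_eq, if_pos]
  rw [mem_rowSets] at *
  rw [rowSize_add, hu, ht, h]

theorem ch_rMul (x y : RGamma Γ) : ch e ε (rMul Γ (x ⊗ₜ[ℂ] y)) = ch e ε x * ch e ε y := by
  induction x using DirectSum.induction_on with
  | zero => simp
  | add x x' hx hx' => rw [TensorProduct.add_tmul, map_add, map_add, hx, hx', map_add, add_mul]
  | of k f =>
    induction y using DirectSum.induction_on with
    | zero => simp
    | add y y' hy hy' => rw [TensorProduct.tmul_add, map_add, map_add, hy, hy', map_add, mul_add]
    | of l g =>
      refine Eq.trans ?_ (ch_ind_phi ε e rfl f g)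
      congr 1
      change rMul Γ (DirectSum.lof ℂ ℕ (fun n => RMinus Γ n) k f ⊗ₜ[ℂ]
        DirectSum.lof ℂ ℕ (fun n => RMinus Γ n) l g) = _
      rw [rMul, TensorProduct.lift.tmul, DirectSum.toModule_lof, LinearMap.flip_apply,
        DirectSum.toModule_lof]
      rfl

end Multiplicativity

/-! ### Coproducts -/

section Comultiplicativity

variable {Γ : Type u} [Group Γ] [Finite Γ]

/-- The generators are primitive, so the coproduct distributes the rows over two factors in all
ways. The components are written in reverse order because `Multiset.antidiagonal_cons` first adds
the new row to the second one. -/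
theorem comul_aMono (s : Multiset (Row Γ)) : Coalgebra.comul (R := ℂ) (aMono s) =
    (s.antidiagonal.map fun p => aMono p.2 ⊗ₜ[ℂ] aMono p.1).sum := by
  have h : ∀ a : Row Γ, Coalgebra.comul (R := ℂ) (aRow a) =
      aRow a ⊗ₜ[ℂ] (1 : SGamma Γ) + 1 ⊗ₜ[ℂ] aRow a := by
    intro a
    rw [aRow, ← ι_rowBasis]
    simp
  induction s using Multiset.induction with
  | empty => simp; rfl
  | cons a s ih =>
    rw [aMono_cons, Bialgebra.comul_mul, h, ih, Multiset.antidiagonal_cons, Multiset.map_add,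
      Multiset.sum_add, Multiset.map_map, Multiset.map_map, add_mul,
      ← Multiset.sum_map_mul_left, ← Multiset.sum_map_mul_left]
    simp

/-- The multiplicity is a product of binomial coefficients. In the induction the new row a comes
from t or from u; the two contributions are proportional to the multiplicities of a in t and in u,
which add up to the multiplicity of a in the whole. -/
theorem bigZ_mul_count_antidiagonal [DecidableEq (Row Γ)] :
    ∀ (s u t : Multiset (Row Γ)), u + t = s →
      bigZ (toFam u) * bigZ (toFam t) * s.antidiagonal.count (u, t) = bigZ (toFam s) := by
  intro s
  induction s using Multiset.induction with
  | empty =>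
    intro u t h
    obtain ⟨rfl, rfl⟩ := add_eq_zero.1 h
    simp [bigZ, zPart]
  | cons a s ih =>
    intro u t h
    have hinj : Function.Injective (Multiset.cons a) := fun _ _ => (Multiset.cons_inj_right a).1
    have h1 : bigZ (toFam u) * bigZ (toFam t) *
        (s.antidiagonal.map (Prod.map id (Multiset.cons a))).count (u, t) =
        a.2.1 * zeta a.1 * t.count a * bigZ (toFam s) := by
      by_cases ha : a ∈ t
      · obtain ⟨t, rfl⟩ := Multiset.exists_cons_of_mem ha
        have hs : u + t = s := by
          rw [Multiset.add_cons] at h; exact (Multiset.cons_inj_right a).1 h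
        have hc : (s.antidiagonal.map (Prod.map id (Multiset.cons a))).count (u, a ::ₘ t) =
            s.antidiagonal.count (u, t) :=
          Multiset.count_map_eq_count' (Prod.map id (Multiset.cons a)) _
            (Function.injective_id.prodMap hinj) (u, t)
        rw [hc, bigZ_cons, ← ih u t hs, Multiset.count_cons_self]
        ring
      · rw [Multiset.count_eq_zero.2 ha, Multiset.count_eq_zero.2, mul_zero, mul_zero, zero_mul]
        intro hm
        obtain ⟨p, _, hp⟩ := Multiset.mem_map.1 hm
        refine ha ?_
        have hp : a ::ₘ p.2 = t := congrArg Prod.snd hp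
        exact hp ▸ Multiset.mem_cons_self _ _
    have h2 : bigZ (toFam u) * bigZ (toFam t) *
        (s.antidiagonal.map (Prod.map (Multiset.cons a) id)).count (u, t) =
        a.2.1 * zeta a.1 * u.count a * bigZ (toFam s) := by
      by_cases ha : a ∈ u
      · obtain ⟨u, rfl⟩ := Multiset.exists_cons_of_mem ha
        have hs : u + t = s := by
          rw [Multiset.cons_add] at h; exact (Multiset.cons_inj_right a).1 h
        have hc : (s.antidiagonal.map (Prod.map (Multiset.cons a) id)).count (a ::ₘ u, t) =
            s.antidiagonal.count (u, t) :=
          Multiset.count_map_eq_count' (Prod.map (Multiset.cons a) id) _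
            (hinj.prodMap Function.injective_id) (u, t)
        rw [hc, bigZ_cons, ← ih u t hs, Multiset.count_cons_self]
        ring
      · rw [Multiset.count_eq_zero.2 ha, Multiset.count_eq_zero.2, mul_zero, mul_zero, zero_mul]
        intro hm
        obtain ⟨p, _, hp⟩ := Multiset.mem_map.1 hm
        refine ha ?_
        have hp : a ::ₘ p.1 = u := congrArg Prod.fst hp
        exact hp ▸ Multiset.mem_cons_self _ _
    rw [Multiset.antidiagonal_cons, Multiset.count_add, mul_add, h1, h2, bigZ_cons]
    have := congrArg (Multiset.count a) h
    rw [Multiset.count_add, Multiset.count_cons_self] at this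
    rw [← this]
    ring

/-- Rewrites the coproduct of a monomial in the shape of the coproduct of class functions: a sum
over the splittings of the degree and over pairs of multisets of the given sizes. -/
theorem sum_antidiagonal_div {N : ℕ} [DecidableEq (Multiset (Row Γ))] {M : Type*} [AddCommGroup M]
    [Module ℂ M] {s : Multiset (Row Γ)} (hs : rowSize s = N)
    (X : Multiset (Row Γ) → Multiset (Row Γ) → M) :
    (bigZ (toFam s) : ℂ)⁻¹ • (s.antidiagonal.map fun p => X p.2 p.1).sum =
      ∑ p ∈ Finset.HasAntidiagonal.antidiagonal N, ∑ u ∈ rowSets Γ p.1, ∑ t ∈ rowSets Γ p.2,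
        if u + t = s then (bigZ (toFam u) * bigZ (toFam t) : ℂ)⁻¹ • X u t else 0 := by
  classical
  have hZ : ∀ u t, u + t = s → (s.antidiagonal.count (t, u) : ℂ) =
      bigZ (toFam s) * (bigZ (toFam u) * bigZ (toFam t) : ℂ)⁻¹ := by
    intro u t h
    rw [← bigZ_mul_count_antidiagonal s t u (by rw [add_comm, h])]
    have := bigZ_ne_zero u
    have := bigZ_ne_zero t
    push_cast
    field_simp
    congr!
  have hL : (s.antidiagonal.map fun p => X p.2 p.1).sum =
      ∑ p ∈ s.antidiagonal.toFinset, s.antidiagonal.count p • X p.2 p.1 :=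
    Finset.sum_multiset_map_count _ _
  have hterm : ∀ p ∈ s.antidiagonal.toFinset, (bigZ (toFam s) : ℂ)⁻¹ •
      s.antidiagonal.count p • X p.2 p.1 =
      (bigZ (toFam p.2) * bigZ (toFam p.1) : ℂ)⁻¹ • X p.2 p.1 := by
    intro p hp
    have h : p.2 + p.1 = s := by
      rw [add_comm]; exact Multiset.mem_antidiagonal.1 (Multiset.mem_toFinset.1 hp)
    rw [← Nat.cast_smul_eq_nsmul ℂ, hZ p.2 p.1 h, smul_smul, inv_mul_cancel_left₀ (bigZ_ne_zero s)]
  rw [hL, Finset.smul_sum, Finset.sum_congr rfl hterm]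
  symm
  simp only [Finset.sum_sigma', ← Finset.sum_filter]
  refine Finset.sum_bij (fun x _ => (x.2.2, x.2.1)) ?_ ?_ ?_ ?_
  · intro x h
    rw [Multiset.mem_toFinset, Multiset.mem_antidiagonal, add_comm]
    simp only [Finset.mem_sigma, Finset.mem_filter] at h
    exact h.2.2.2
  · intro x h y h' heq
    obtain ⟨⟨k, l⟩, u, t⟩ := x
    obtain ⟨⟨k', l'⟩, u', t'⟩ := y
    simp only [Finset.mem_filter, Finset.mem_sigma, mem_rowSets] at h h'
    obtain ⟨-, rfl, rfl, -⟩ := h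
    obtain ⟨-, rfl, rfl, -⟩ := h'
    obtain ⟨rfl, rfl⟩ := Prod.mk.inj heq
    rfl
  · rintro ⟨t, u⟩ h
    rw [Multiset.mem_toFinset, Multiset.mem_antidiagonal] at h
    refine ⟨⟨(rowSize u, rowSize t), u, t⟩, ?_, rfl⟩
    simp only [Finset.mem_filter, Finset.mem_sigma, mem_rowSets,
      Finset.HasAntidiagonal.mem_antidiagonal]
    simp only at h
    rw [← rowSize_add, add_comm u, h]
    simp [hs]
  · intro x _
    rfl

variable (e : Fin (Nat.card (ConjClasses Γ)) ≃ ConjClasses Γ) (ε : ℕ → ℕ)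

/-- Only the values of the outer product of T at pairs of representatives enter. As the coproduct is
restriction followed by the inverse of `phi`, this makes the inverse disappear. -/
theorem map_ch_lof {k l : ℕ} (T : RMinus Γ k ⊗[ℂ] RMinus Γ l) :
    TensorProduct.map (ch e ε) (ch e ε) (TensorProduct.map
      (DirectSum.lof ℂ ℕ (fun n => RMinus Γ n) k) (DirectSum.lof ℂ ℕ (fun n => RMinus Γ n) l) T) =
      ∑ u ∈ rowSets Γ k, ∑ t ∈ rowSets Γ l, (chCoeff u * chCoeff t *
        (phi Γ k l T).1 (SpinProd.mk (rowElt ε k u) (rowElt ε l t))) • (aMono u ⊗ₜ[ℂ] aMono t) := by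
  induction T with
  | zero => simp
  | add T T' h h' =>
    simp only [map_add, h, h', ← Finset.sum_add_distrib]
    refine Finset.sum_congr rfl fun u _ => Finset.sum_congr rfl fun t _ => ?_
    rw [← add_smul, ← mul_add]
    rfl
  | tmul f g =>
    rw [TensorProduct.map_tmul, TensorProduct.map_tmul, ch_lof_eq, ch_lof_eq,
      TensorProduct.sum_tmul]
    refine Finset.sum_congr rfl fun u _ => ?_
    rw [TensorProduct.tmul_sum]
    refine Finset.sum_congr rfl fun t _ => ?_
    rw [TensorProduct.smul_tmul_smul, phi_tmul]
    congr 1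
    ring

theorem comul_ch (x : RGamma Γ) : Coalgebra.comul (R := ℂ) (ch e ε x) =
    TensorProduct.map (ch e ε) (ch e ε) (rComul Γ x) := by
  classical
  induction x using DirectSum.induction_on with
  | zero => simp
  | add x y hx hy => rw [map_add, map_add, map_add, map_add, hx, hy]
  | of N f =>
    change Coalgebra.comul (R := ℂ) (ch e ε (DirectSum.lof ℂ ℕ (fun n => RMinus Γ n) N f)) =
      TensorProduct.map (ch e ε) (ch e ε) (rComul Γ (DirectSum.lof ℂ ℕ (fun n => RMinus Γ n) N f))
    have hR : TensorProduct.map (ch e ε) (ch e ε)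
        (rComul Γ (DirectSum.lof ℂ ℕ (fun n => RMinus Γ n) N f)) =
        ∑ p ∈ Finset.HasAntidiagonal.antidiagonal N, ∑ u ∈ rowSets Γ p.1, ∑ t ∈ rowSets Γ p.2,
          (chCoeff u * chCoeff t * f.1 (rowElt ε N (u + t))) • (aMono u ⊗ₜ[ℂ] aMono t) := by
      rw [rComul, DirectSum.toModule_lof, LinearMap.sum_apply, map_sum,
        ← Finset.sum_attach (Finset.HasAntidiagonal.antidiagonal N)]
      refine Finset.sum_congr rfl fun p _ => ?_
      rw [LinearMap.comp_apply, LinearMap.comp_apply, map_ch_lof]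
      refine Finset.sum_congr rfl fun u hu => Finset.sum_congr rfl fun t ht => ?_
      have hp := Finset.HasAntidiagonal.mem_antidiagonal.1 p.2
      rw [← join_rowElt ε hp f (mem_rowSets.1 hu) (mem_rowSets.1 ht)]
      have : phi Γ p.1.1 p.1.2 ((phiEquiv Γ p.1.1 p.1.2).symm (res Γ hp f)) = res Γ hp f :=
        (phiEquiv Γ p.1.1 p.1.2).apply_symm_apply _
      rw [LinearEquiv.coe_coe, this]
      rfl
    rw [hR, ch_lof_eq, map_sum]
    have hL : ∀ s ∈ rowSets Γ N, Coalgebra.comul (R := ℂ)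
        ((chCoeff s * f.1 (rowElt ε N s)) • aMono s) =
        ∑ p ∈ Finset.HasAntidiagonal.antidiagonal N, ∑ u ∈ rowSets Γ p.1, ∑ t ∈ rowSets Γ p.2,
          if u + t = s then
            (chCoeff u * chCoeff t * f.1 (rowElt ε N (u + t))) • (aMono u ⊗ₜ[ℂ] aMono t) else 0 := by
      intro s hs
      have h := sum_antidiagonal_div (mem_rowSets.1 hs) fun u t => aMono u ⊗ₜ[ℂ] aMono t
      have h1 : Coalgebra.comul (R := ℂ) ((chCoeff s * f.1 (rowElt ε N s)) • aMono s) =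
          ((Real.sqrt 2 : ℂ) ^ Multiset.card s * f.1 (rowElt ε N s)) •
          (bigZ (toFam s) : ℂ)⁻¹ • Coalgebra.comul (R := ℂ) (aMono s) := by
        rw [map_smul, smul_smul, chCoeff]
        congr 1
        ring
      rw [h1, comul_aMono, h]
      simp only [Finset.smul_sum]
      refine Finset.sum_congr rfl fun p _ => Finset.sum_congr rfl fun u _ =>
        Finset.sum_congr rfl fun t _ => ?_
      split_ifs with hut
      · rw [smul_smul, hut, chCoeff, chCoeff, ← hut, Multiset.card_add, pow_add]
        congr 1
        ring
      · exact smul_zero _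
    rw [Finset.sum_congr rfl hL, Finset.sum_comm]
    refine Finset.sum_congr rfl fun p hp => ?_
    rw [Finset.sum_comm]
    refine Finset.sum_congr rfl fun u hu => ?_
    rw [Finset.sum_comm]
    refine Finset.sum_congr rfl fun t ht => ?_
    rw [Finset.sum_ite_eq, if_pos]
    rw [mem_rowSets] at *
    rw [rowSize_add, hu, ht, Finset.HasAntidiagonal.mem_antidiagonal.1 hp]

end Comultiplicativity

/-! ### Transport of the Hopf algebra axioms -/

section Transport

open TensorProduct

/-- A vector space with operations that correspond to those of a Hopf algebra under a linear
isomorphism is a Hopf algebra. -/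
theorem isHopfAlgebra_of_linearEquiv {A H : Type*} [AddCommGroup A] [Module ℂ A] [CommRing H]
    [HopfAlgebra ℂ H] (C : A ≃ₗ[ℂ] H) (μ : A ⊗[ℂ] A →ₗ[ℂ] A) (e : A) (Δ : A →ₗ[ℂ] A ⊗[ℂ] A)
    (κ : A →ₗ[ℂ] ℂ) (hμ : ∀ x y, C (μ (x ⊗ₜ y)) = C x * C y) (he : C e = 1)
    (hΔ : ∀ x, TensorProduct.map C.toLinearMap C.toLinearMap (Δ x) = Coalgebra.comul (R := ℂ) (C x))
    (hκ : ∀ x, κ x = Coalgebra.counit (R := ℂ) (C x)) :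
    IsHopfAlgebra μ e Δ κ (C.symm.toLinearMap ∘ₗ HopfAlgebra.antipode ℂ ∘ₗ C.toLinearMap) := by
  have hμ' : C.toLinearMap ∘ₗ μ = LinearMap.mul' ℂ H ∘ₗ
      TensorProduct.map C.toLinearMap C.toLinearMap := TensorProduct.ext' fun x y => hμ x y
  have hΔ' : TensorProduct.map C.toLinearMap C.toLinearMap ∘ₗ Δ =
      Coalgebra.comul (R := ℂ) ∘ₗ C.toLinearMap := LinearMap.ext hΔ
  have hκ' : κ = Coalgebra.counit (R := ℂ) ∘ₗ C.toLinearMap := LinearMap.ext hκ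
  -- Identities in the tensor square and cube of A may be checked after applying C in each factor,
  -- where they become axioms of H. The operations are intertwined with C on pure tensors, hence
  -- everywhere by linearity.
  have hinj2 : Function.Injective (TensorProduct.map C.toLinearMap C.toLinearMap) :=
    (TensorProduct.congr C C).injective
  have hinj3 : Function.Injective (TensorProduct.map C.toLinearMap
      (TensorProduct.map C.toLinearMap C.toLinearMap)) :=
    (TensorProduct.congr C (TensorProduct.congr C C)).injective
  refine ⟨fun x y w => C.injective ?_, fun x => C.injective ?_, fun x => C.injective ?_,
    fun x => hinj3 ?_, fun x => C.injective ?_, fun x => C.injective ?_, hinj2 ?_,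
    fun x y => hinj2 ?_, ?_, fun x y => ?_, fun x => C.injective ?_, fun x => C.injective ?_⟩
  · rw [hμ, hμ, hμ, hμ, mul_assoc]
  · rw [hμ, he, one_mul]
  · rw [hμ, he, mul_one]
  · have h1 : ∀ T : A ⊗[ℂ] A, TensorProduct.map C.toLinearMap
        (TensorProduct.map C.toLinearMap C.toLinearMap) (TensorProduct.assoc ℂ A A A
          (Δ.rTensor A T)) = TensorProduct.assoc ℂ H H H ((Coalgebra.comul (R := ℂ)).rTensor H
            (TensorProduct.map C.toLinearMap C.toLinearMap T)) := by
      intro T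
      have e1 : ∀ U : (A ⊗[ℂ] A) ⊗[ℂ] A, TensorProduct.map C.toLinearMap
          (TensorProduct.map C.toLinearMap C.toLinearMap) (TensorProduct.assoc ℂ A A A U) =
          TensorProduct.assoc ℂ H H H (TensorProduct.map
            (TensorProduct.map C.toLinearMap C.toLinearMap) C.toLinearMap U) := fun U =>
        LinearMap.congr_fun (TensorProduct.map_map_comp_assoc_eq C.toLinearMap C.toLinearMap
          C.toLinearMap) U
      rw [e1]
      congr 1
      induction T with
      | zero => simp
      | add T T' h h' => simp only [map_add, h, h']
      | tmul a b => simp [hΔ]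
    have h2 : ∀ T : A ⊗[ℂ] A, TensorProduct.map C.toLinearMap
        (TensorProduct.map C.toLinearMap C.toLinearMap) (Δ.lTensor A T) =
        (Coalgebra.comul (R := ℂ)).lTensor H
          (TensorProduct.map C.toLinearMap C.toLinearMap T) := by
      intro T
      induction T with
      | zero => simp
      | add T T' h h' => simp only [map_add, h, h']
      | tmul a b => simp [hΔ]
    rw [h1, h2, hΔ, Coalgebra.coassoc_apply]
  · have h : ∀ T : A ⊗[ℂ] A, C (TensorProduct.lid ℂ A (κ.rTensor A T)) =
        TensorProduct.lid ℂ H ((Coalgebra.counit (R := ℂ)).rTensor H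
          (TensorProduct.map C.toLinearMap C.toLinearMap T)) := by
      intro T
      induction T with
      | zero => simp
      | add T T' h h' => simp only [map_add, h, h']
      | tmul a b => simp [hκ]
    rw [h, hΔ, Coalgebra.rTensor_counit_comul]
    simp
  · have h : ∀ T : A ⊗[ℂ] A, C (TensorProduct.rid ℂ A (κ.lTensor A T)) =
        TensorProduct.rid ℂ H ((Coalgebra.counit (R := ℂ)).lTensor H
          (TensorProduct.map C.toLinearMap C.toLinearMap T)) := by
      intro T
      induction T with
      | zero => simp
      | add T T' h h' => simp only [map_add, h, h']
      | tmul a b => simp [hκ]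
    rw [h, hΔ, Coalgebra.lTensor_counit_comul]
    simp
  · rw [hΔ, he, Bialgebra.comul_one, TensorProduct.map_tmul]
    simp only [LinearEquiv.coe_coe, he]
    rfl
  · have h : ∀ T U : A ⊗[ℂ] A, TensorProduct.map C.toLinearMap C.toLinearMap
        (TensorProduct.map μ μ (TensorProduct.tensorTensorTensorComm ℂ A A A A (T ⊗ₜ U))) =
        TensorProduct.map C.toLinearMap C.toLinearMap T *
          TensorProduct.map C.toLinearMap C.toLinearMap U := by
      intro T U
      induction T with
      | zero => simp
      | add T T' h h' => simp only [map_add, TensorProduct.add_tmul, add_mul, h, h']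
      | tmul a b =>
        induction U with
        | zero => simp
        | add U U' h h' => simp only [map_add, TensorProduct.tmul_add, mul_add, h, h']
        | tmul c d => simp [hμ]
    rw [h, hΔ, hΔ, hΔ, hμ, Bialgebra.comul_mul]
  · rw [hκ, he, Bialgebra.counit_one]
  · rw [hκ, hκ, hκ, hμ, Bialgebra.counit_mul]
  · have h : ∀ T : A ⊗[ℂ] A, C (μ ((C.symm.toLinearMap ∘ₗ HopfAlgebra.antipode ℂ ∘ₗ
        C.toLinearMap).rTensor A T)) = LinearMap.mul' ℂ H ((HopfAlgebra.antipode ℂ).rTensor H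
          (TensorProduct.map C.toLinearMap C.toLinearMap T)) := by
      intro T
      induction T with
      | zero => simp
      | add T T' h h' => simp only [map_add, h, h']
      | tmul a b => simp [hμ]
    rw [h, hΔ, HopfAlgebra.mul_antipode_rTensor_comul_apply, map_smul, he, hκ,
      Algebra.algebraMap_eq_smul_one]
  · have h : ∀ T : A ⊗[ℂ] A, C (μ ((C.symm.toLinearMap ∘ₗ HopfAlgebra.antipode ℂ ∘ₗ
        C.toLinearMap).lTensor A T)) = LinearMap.mul' ℂ H ((HopfAlgebra.antipode ℂ).lTensor H
          (TensorProduct.map C.toLinearMap C.toLinearMap T)) := by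
      intro T
      induction T with
      | zero => simp
      | add T T' h h' => simp only [map_add, h, h']
      | tmul a b => simp [hμ]
    rw [h, hΔ, HopfAlgebra.mul_antipode_lTensor_comul_apply, map_smul, he, hκ,
      Algebra.algebraMap_eq_smul_one]

end Transport

end SpinWreath

theorem mainTheorem4 {Γ : Type u} [Group Γ] [Finite Γ]
    (e : Fin (Nat.card (ConjClasses Γ)) ≃ ConjClasses Γ) (ε : ℕ → ℕ) :
    ∃ S : RGamma Γ →ₗ[ℂ] RGamma Γ,
      IsHopfAlgebra (rMul Γ) (rOne Γ) (rComul Γ) (rCounit Γ) S ∧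
      Function.Bijective (ch e ε) ∧
      ch e ε (rOne Γ) = 1 ∧
      (∀ x y : RGamma Γ, ch e ε (rMul Γ (x ⊗ₜ[ℂ] y)) = ch e ε x * ch e ε y) ∧
      (∀ x : RGamma Γ, Coalgebra.counit (R := ℂ) (ch e ε x) = rCounit Γ x) ∧
      (∀ x : RGamma Γ, Coalgebra.comul (R := ℂ) (ch e ε x) =
        TensorProduct.map (ch e ε) (ch e ε) (rComul Γ x)) ∧
      (∀ x : RGamma Γ, HopfAlgebra.antipode ℂ (ch e ε x) = ch e ε (S x)) := by
  obtain ⟨C, hC⟩ : ∃ C : RGamma Γ ≃ₗ[ℂ] SGamma Γ, C.toLinearMap = ch e ε :=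
    ⟨LinearEquiv.ofBijective (ch e ε) ⟨ch_injective e ε, ch_surjective e ε⟩, rfl⟩
  have hC' : ∀ x, C x = ch e ε x := fun x => LinearMap.congr_fun hC x
  have hopf := isHopfAlgebra_of_linearEquiv (A := RGamma Γ) (H := SGamma Γ) C (rMul Γ) (rOne Γ)
    (rComul Γ) (rCounit Γ) (fun x y => by rw [hC', hC', hC', ch_rMul]) (by rw [hC', ch_rOne])
    (fun x => by rw [hC, hC', comul_ch]) (fun x => by rw [hC', counit_ch])
  refine ⟨_, hopf, ⟨ch_injective e ε, ch_surjective e ε⟩, ch_rOne e ε, ch_rMul ε e, counit_ch e ε,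
    comul_ch e ε, fun x => ?_⟩
  rw [← hC', ← hC']
  -- The antipode on the left was defined by transport along `ch`, so compatibility holds by
  -- construction.
  exact (C.apply_symm_apply _).symm
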